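/- Let $V$ be a four-dimensional complex vector space with basis $v_0,\dots,v_3$ and dual basis $y_0,\dots,y_3$. Let $Q_4$ be the total morphism algebra, linear over $R_4=\mathbb{C}^4$, of the graded category with objects $X_1,\dots,X_4$ and $$Hom(X_j,X_k)=\begin{cases}\Lambda^{k-j}V & j<k,\\ \Lambda^0V\oplus(\Lambda^4V)[2] & j=k,\\ (\Lambda^{k-j+4}V)[2] & j>k,\end{cases}$$ where composition is the exterior product, and $\Lambda^pV[2]$ sits in degree $p-2$. Let $u_j\in R_4$ be the identity of $X_j$. Let $H\subset SL(V)$ be the maximal torus of automorphisms diagonal in the basis $v_i$, let $\Gamma_4=\{\pm I,\pm iI\}$ be the center of $SL(V)$, and let $T=H/\Gamma_4$. Choose a representative $\Sigma(t)\in H$ of each $t\in T$, and let $\rho_T(t)$ be the automorphism of $Q_4$ induced by $\Sigma(t)$. Multilinear maps are called $T$-equivariant if they commute with all $\rho_T(t)$. (The center $\Gamma_4$ acts on $Q_4$ by conjugation with elements of $R_4$, so for $R_4$-bimodule maps this is the same as $H$-equivariance, and it does not depend on $\Sigma$.) (1) For $d>2$ consider the cohomology $\big(HH^2(Q_4,Q_4)^{2-d}\big)^T$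 of the complex of $R_4$-linear $T$-equivariant Hochschild cochains, represented by cocycles $\tau: Q_4\otimes_{R_4}\cdots\otimes_{R_4}Q_4\to Q_4$ with $d$ inputs and of degree $2-d$. It vanishes for $d\neq 4$. For $d=4$ it is one-dimensional, spanned by the class corresponding to the polynomial $y_0y_1y_2y_3$: that is, by the class of a cocycle $\tau$ such that for all $v\in V$ and all $j$, $$\tau(v,v,v,v)=y_0(v)y_1(v)y_2(v)y_3(v)\,u_j,$$ where the four inputs are $v$, seen as a morphism $X_j\to X_{j+1}\to X_{j+2}\to X_{j+3}\to X_j$ at each successive step (indices mod 4). (2) Consider $R_4$-linear, $T$-equivariant $A_\infty$-structures on the graded vector space $Q_4$ with $\mu^1=0$ and $\mu^2(a_2,a_1)=(-1)^{|a_1|}a_2a_1$. Call such a structure trivial if $\mu^d=0$ for all $d>2$. Call two such structures gauge equivalent if there is an $R_4$-linear $T$-equivariant $A_\infty$-homomorphism between them whose linear part is the identity. Then any two such structures which are not gauge equivalent to the trivial one are related by an $R_4$-linear, $T$-equivariant $A_\infty$-isomorphism, that is, by an $A_\infty$-homomorphism whose linear part is bijective. -/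

import Mathlib

open scoped BigOperators

noncomputable section

namespace SeidelQ

/-! ### Graded multilinear maps over a semisimple subring, with a family of symmetries

`A` is a complex algebra, `𝒜 n` its piece of degree `n`, `R` a subalgebra of the degree zero part,
and `ρ` a family of linear maps of `A` (the symmetries, indexed by `T`).
A tuple `(a_d, …, a_1)` is stored in increasing order: the entry with index `i` is `a_{i+1}`. -/

section General

variable {A : Type*} [Ring A] [Algebra ℂ A]

/-- Multilinear maps `A ⊗ ⋯ ⊗ A → A` with `s` inputs. -/
abbrev Multi (A : Type*) [Ring A] [Algebra ℂ A] (s : ℕ) : Type _ :=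
  MultilinearMap ℂ (fun _ : Fin s => A) A

/-- `f` has degree `t`. -/
def HasDegree (𝒜 : ℤ → Submodule ℂ A) {s : ℕ} (f : Multi A s) (t : ℤ) : Prop :=
  ∀ (p : Fin s → ℤ) (a : Fin s → A), (∀ i, a i ∈ 𝒜 (p i)) → f a ∈ 𝒜 ((∑ i, p i) + t)

/-- `f` is a map of `R`-bimodules `A ⊗_R ⋯ ⊗_R A → A`:
it is balanced over `R` between neighbouring inputs, left `R`-linear in the
leftmost input (`a_s`, the one of highest index) and right `R`-linear in the rightmost one
(`a_1`, the one of index `0`). -/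
def IsBimoduleMap (R : Subalgebra ℂ A) {s : ℕ} (f : Multi A s) : Prop :=
  ∀ r ∈ R, ∀ a : Fin s → A,
    (∀ i j : Fin s, (j : ℕ) = i + 1 →
      f (Function.update a j (a j * r)) = f (Function.update a i (r * a i))) ∧
    (∀ i : Fin s, (i : ℕ) + 1 = s → f (Function.update a i (r * a i)) = r * f a) ∧
    (∀ i : Fin s, (i : ℕ) = 0 → f (Function.update a i (a i * r)) = f a * r)

/-- `f` commutes with all the symmetries `ρ t`. -/
def IsEquivariant {T : Type*} (ρ : T → A →ₗ[ℂ] A) {s : ℕ} (f : Multi A s) : Prop :=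
  ∀ (t : T) (a : Fin s → A), f (fun i => ρ t (a i)) = ρ t (f a)

/-- The space `CC^{s+t}(A,A)^t` of `R`-linear equivariant Hochschild cochains with
`s` inputs and of degree `t`. -/
def cochains {T : Type*} (𝒜 : ℤ → Submodule ℂ A) (R : Subalgebra ℂ A) (ρ : T → A →ₗ[ℂ] A)
    (s : ℕ) (t : ℤ) : Submodule ℂ (Multi A s) where
  carrier := {f | HasDegree 𝒜 f t ∧ IsBimoduleMap R f ∧ IsEquivariant ρ f}
  zero_mem' := by
    refine ⟨fun p a _ => by simp, fun r _ a => ⟨?_, ?_, ?_⟩, fun t a => by simp⟩ <;> simp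
  add_mem' := by
    rintro f g ⟨hf1, hf2, hf3⟩ ⟨hg1, hg2, hg3⟩
    refine ⟨fun p a h => by simpa using add_mem (hf1 p a h) (hg1 p a h),
      fun r hr a => ⟨fun i j h => ?_, fun i h => ?_, fun i h => ?_⟩, fun t a => ?_⟩
    · simp [(hf2 r hr a).1 i j h, (hg2 r hr a).1 i j h]
    · simp [(hf2 r hr a).2.1 i h, (hg2 r hr a).2.1 i h, mul_add]
    · simp [(hf2 r hr a).2.2 i h, (hg2 r hr a).2.2 i h, add_mul]
    · simp [hf3 t a, hg3 t a]
  smul_mem' := by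
    rintro c f ⟨hf1, hf2, hf3⟩
    refine ⟨fun p a h => by simpa using Submodule.smul_mem _ c (hf1 p a h),
      fun r hr a => ⟨fun i j h => ?_, fun i h => ?_, fun i h => ?_⟩, fun t a => ?_⟩
    · simp [(hf2 r hr a).1 i j h]
    · simp [(hf2 r hr a).2.1 i h]
    · simp [(hf2 r hr a).2.2 i h]
    · simp [hf3 t a]

/-- The sign `(-1)^n`. -/
def sgn (n : ℤ) : ℤ := (n.negOnePow : ℤ)

/-- The tuple obtained from `a` by replacing the `e` consecutive entries with indices
`i, …, i + e - 1` by the single entry `x`. -/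
def splice (a : ℕ → A) (i e : ℕ) (x : A) : ℕ → A :=
  fun n => if n < i then a n else if n = i then x else a (n + e - 1)

/-- The first `s` entries of `a` are inserted into `f`. -/
def app {s : ℕ} (f : Multi A s) (a : ℕ → A) : A := f fun n => a n

/-- For homogeneous `a_1, …, a_d` of degrees `p`, the sum
`∑ (-1)^* f^{d-e+1}(a_d, …, a_{i+e+1}, g^e(a_{i+e}, …, a_{i+1}), a_i, …, a_1)` over all
`e ≥ 1` and `0 ≤ i ≤ d - e`, where `* = |a_1| + ⋯ + |a_i| - i`. -/
def insertionSum (f g : ∀ d : ℕ, Multi A d) (d : ℕ) (p : ℕ → ℤ) (a : ℕ → A) : A :=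
  ∑ e ∈ Finset.Icc 1 d, ∑ i ∈ Finset.range (d + 1 - e),
    sgn (∑ n ∈ Finset.range i, (p n - 1)) •
      app (f (d + 1 - e)) (splice a i e (app (g e) fun n => a (i + n)))

/-- For `a_1, …, a_d`, the sum
`∑ g^r(f^{s_r}(a_d, …), …, f^{s_1}(a_{s_1}, …, a_1))` over all `r ≥ 1` and all
decompositions `s_1 + ⋯ + s_r = d` into positive integers. -/
def partitionSum (g f : ∀ d : ℕ, Multi A d) (d : ℕ) (a : ℕ → A) : A :=
  ∑ c : Composition d, g c.length fun k => f (c.blocksFun k) fun n => a (c.embedding k n)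

variable {T : Type*}

/-- An `R`-linear, equivariant `A_∞`-structure on the graded vector space underlying the graded
algebra `A`, with `μ^1 = 0` and `μ^2(a_2, a_1) = (-1)^{|a_1|} a_2 a_1`. -/
structure AInfStructure (𝒜 : ℤ → Submodule ℂ A) (R : Subalgebra ℂ A) (ρ : T → A →ₗ[ℂ] A) where
  /-- the compositions `μ^d`, `d ≥ 1` (there is no curvature term `μ^0`) -/
  μ : ∀ d : ℕ, Multi A d
  μ_zero : μ 0 = 0
  μ_mem : ∀ d : ℕ, 1 ≤ d → μ d ∈ cochains 𝒜 R ρ d (2 - d)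
  ainfty : ∀ d : ℕ, 1 ≤ d → ∀ (p : ℕ → ℤ) (a : ℕ → A), (∀ n, a n ∈ 𝒜 (p n)) →
    insertionSum μ μ d p a = 0
  μ_one : μ 1 = 0
  μ_two : ∀ (p : ℤ) (a₁ a₂ : A), a₁ ∈ 𝒜 p → μ 2 ![a₁, a₂] = sgn p • (a₂ * a₁)

/-- An `R`-linear, equivariant `A_∞`-homomorphism `M → N`. -/
structure AInfHom {𝒜 : ℤ → Submodule ℂ A} {R : Subalgebra ℂ A} {ρ : T → A →ₗ[ℂ] A}
    (M N : AInfStructure 𝒜 R ρ) where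
  /-- the components `F^d`, `d ≥ 1` -/
  F : ∀ d : ℕ, Multi A d
  F_zero : F 0 = 0
  F_mem : ∀ d : ℕ, 1 ≤ d → F d ∈ cochains 𝒜 R ρ d (1 - d)
  map_eq : ∀ d : ℕ, 1 ≤ d → ∀ (p : ℕ → ℤ) (a : ℕ → A), (∀ n, a n ∈ 𝒜 (p n)) →
    partitionSum N.μ F d a = insertionSum F M.μ d p a

/-- An `A_∞`-homomorphism is an isomorphism if its linear part is bijective. -/
def AInfHom.IsIso {𝒜 : ℤ → Submodule ℂ A} {R : Subalgebra ℂ A} {ρ : T → A →ₗ[ℂ] A}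
    {M N : AInfStructure 𝒜 R ρ} (F : AInfHom M N) : Prop :=
  Function.Bijective fun a : A => F.F 1 fun _ => a

/-- An `A_∞`-homomorphism is a gauge transformation if its linear part is the identity. -/
def AInfHom.IsGauge {𝒜 : ℤ → Submodule ℂ A} {R : Subalgebra ℂ A} {ρ : T → A →ₗ[ℂ] A}
    {M N : AInfStructure 𝒜 R ρ} (F : AInfHom M N) : Prop :=
  ∀ a : A, (F.F 1 fun _ => a) = a

/-- `M` is gauge equivalent to the trivial `A_∞`-structure, the one
whose compositions of order greater than two vanish. -/
def AInfStructure.IsGaugeTrivial {𝒜 : ℤ → Submodule ℂ A} {R : Subalgebra ℂ A}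
    {ρ : T → A →ₗ[ℂ] A} (M : AInfStructure 𝒜 R ρ) : Prop :=
  ∃ N : AInfStructure 𝒜 R ρ, (∀ d : ℕ, 2 < d → N.μ d = 0) ∧ ∃ F : AInfHom M N, F.IsGauge

/-- The Hochschild differential, that is, the commutator with `μ^2`, of a cochain `f` with `s`
inputs and of degree `t`, evaluated on homogeneous `a_1, …, a_{s+1}` of degrees `p`:
`μ^2(a_{s+1}, f(a_s, …, a_1)) + (-1)^{(s+t-1)(|a_1|-1)} μ^2(f(a_{s+1}, …, a_2), a_1)`
`+ (-1)^{s+t} ∑_i (-1)^{|a_1|+⋯+|a_i|-i} f(a_{s+1}, …, μ^2(a_{i+2}, a_{i+1}), a_i, …, a_1)`. -/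
def hochschildDifferential {s : ℕ} (t : ℤ) (f : Multi A s) (p : ℕ → ℤ) (a : ℕ → A) : A :=
  sgn ((∑ n ∈ Finset.range s, p n) + t) • (a s * app f a)
  + sgn ((s + t - 1) * (p 0 - 1)) • sgn (p 0) • (app f (fun n => a (n + 1)) * a 0)
  + sgn (s + t) • ∑ i ∈ Finset.range s,
      sgn (∑ n ∈ Finset.range i, (p n - 1)) •
        app f (splice a i 2 (sgn (p i) • (a (i + 1) * a i)))

lemma hochschildDifferential_zero {s : ℕ} (t : ℤ) (p : ℕ → ℤ) (a : ℕ → A) :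
    hochschildDifferential t (0 : Multi A s) p a = 0 := by
  simp [hochschildDifferential, app]

lemma hochschildDifferential_add {s : ℕ} (t : ℤ) (f g : Multi A s) (p : ℕ → ℤ) (a : ℕ → A) :
    hochschildDifferential t (f + g) p a =
      hochschildDifferential t f p a + hochschildDifferential t g p a := by
  simp only [hochschildDifferential, app, add_apply, mul_add, add_mul, smul_add,
    Finset.sum_add_distrib]
  abel

lemma hochschildDifferential_smul {s : ℕ} (t : ℤ) (c : ℂ) (f : Multi A s) (p : ℕ → ℤ)
    (a : ℕ → A) :
    hochschildDifferential t (c • f) p a = c • hochschildDifferential t f p a := by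
  simp only [hochschildDifferential, app, smul_apply, smul_add, Finset.smul_sum,
    Algebra.mul_smul_comm, Algebra.smul_mul_assoc, smul_comm _ c]

/-- The `R`-linear equivariant Hochschild cocycles with `s` inputs and of degree `t`. -/
def cocycles (𝒜 : ℤ → Submodule ℂ A) (R : Subalgebra ℂ A) (ρ : T → A →ₗ[ℂ] A)
    (s : ℕ) (t : ℤ) : Submodule ℂ (Multi A s) where
  carrier := {f | f ∈ cochains 𝒜 R ρ s t ∧
    ∀ (p : ℕ → ℤ) (a : ℕ → A), (∀ n, a n ∈ 𝒜 (p n)) → hochschildDifferential t f p a = 0}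
  zero_mem' := ⟨zero_mem _, fun p a _ => hochschildDifferential_zero t p a⟩
  add_mem' := by
    rintro f g ⟨hf, hf'⟩ ⟨hg, hg'⟩
    refine ⟨add_mem hf hg, fun p a h => ?_⟩
    rw [hochschildDifferential_add, hf' p a h, hg' p a h, add_zero]
  smul_mem' := by
    rintro c f ⟨hf, hf'⟩
    refine ⟨Submodule.smul_mem _ c hf, fun p a h => ?_⟩
    rw [hochschildDifferential_smul, hf' p a h, smul_zero]

/-- The differentials of `R`-linear equivariant Hochschild cochains of degree `t` with `s`
inputs, as multilinear maps with `s + 1` inputs. -/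
def coboundaries (𝒜 : ℤ → Submodule ℂ A) (R : Subalgebra ℂ A) (ρ : T → A →ₗ[ℂ] A)
    (s : ℕ) (t : ℤ) : Submodule ℂ (Multi A (s + 1)) where
  carrier := {f | f ∈ cochains 𝒜 R ρ (s + 1) t ∧ ∃ g ∈ cochains 𝒜 R ρ s t,
    ∀ (p : ℕ → ℤ) (a : ℕ → A), (∀ n, a n ∈ 𝒜 (p n)) →
      app f a = hochschildDifferential t g p a}
  zero_mem' := ⟨zero_mem _, 0, zero_mem _, fun p a _ => by
    rw [hochschildDifferential_zero]; simp [app]⟩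
  add_mem' := by
    rintro f f' ⟨hf, g, hg, h⟩ ⟨hf', g', hg', h'⟩
    refine ⟨add_mem hf hf', g + g', add_mem hg hg', fun p a ha => ?_⟩
    rw [hochschildDifferential_add, ← h p a ha, ← h' p a ha]; rfl
  smul_mem' := by
    rintro c f ⟨hf, g, hg, h⟩
    refine ⟨Submodule.smul_mem _ c hf, c • g, Submodule.smul_mem _ c hg, fun p a ha => ?_⟩
    rw [hochschildDifferential_smul, ← h p a ha]; rfl

/-- The `R`-linear equivariant Hochschild cohomology `HH^{s+1+t}(A,A)^t`: cocycles with `s + 1`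
inputs and of degree `t`, modulo coboundaries (as a subspace of all multilinear
maps modulo coboundaries). -/
def equivariantHH (𝒜 : ℤ → Submodule ℂ A) (R : Subalgebra ℂ A) (ρ : T → A →ₗ[ℂ] A)
    (s : ℕ) (t : ℤ) : Submodule ℂ (Multi A (s + 1) ⧸ coboundaries 𝒜 R ρ s t) :=
  (cocycles 𝒜 R ρ (s + 1) t).map (coboundaries 𝒜 R ρ s t).mkQ

end General

/-! ### The algebra `Q_4` -/

section Q4

variable (V : Type*) [AddCommGroup V] [Module ℂ V]

/-- The morphism space `Hom(X_j, X_k)`, where the objects `X_1, …, X_4` are indexed by `Fin 4`: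
the sum of the exterior powers `Λ^p V` with `p ≡ k - j` mod `4`. If `dim V = 4`, this is
`Λ^{k-j} V` for `j < k`, `Λ^0 V ⊕ Λ^4 V` for `j = k`, and `Λ^{k-j+4} V` for `j > k`. -/
def homSpace (j k : Fin 4) : Submodule ℂ (ExteriorAlgebra ℂ V) :=
  ⨆ (p : ℕ) (_ : p + j ≡ k [MOD 4]), ⋀[ℂ]^p V

/-- The degree `n` part of `Hom(X_j, X_k)`: elements of `Λ^p V` have degree `(p + k - j) / 2`,
that is, degree `k - j` if `p = k - j`, and degree `p - 2 = k - j + 2` if `p = k - j + 4`. -/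
def homDegree (j k : Fin 4) (n : ℤ) : Submodule ℂ (ExteriorAlgebra ℂ V) :=
  ⨆ (p : ℕ) (_ : p + j ≡ k [MOD 4] ∧ (p : ℤ) + k = 2 * n + j), ⋀[ℂ]^p V

variable {V}

lemma mem_homSpace {j k : Fin 4} {p : ℕ} (h : p + j ≡ k [MOD 4]) {x : ExteriorAlgebra ℂ V}
    (hx : x ∈ ⋀[ℂ]^p V) : x ∈ homSpace V j k :=
  Submodule.mem_iSup_of_mem p (Submodule.mem_iSup_of_mem h hx)

lemma homSpace_mul (j l k : Fin 4) {x y : ExteriorAlgebra ℂ V}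
    (hx : x ∈ homSpace V l k) (hy : y ∈ homSpace V j l) : x * y ∈ homSpace V j k := by
  have h : homSpace V l k * homSpace V j l ≤ homSpace V j k := by
    unfold homSpace
    rw [Submodule.iSup_mul]
    refine iSup_le fun p => ?_
    rw [Submodule.iSup_mul]
    refine iSup_le fun hp => ?_
    rw [Submodule.mul_iSup]
    refine iSup_le fun q => ?_
    rw [Submodule.mul_iSup]
    refine iSup_le fun hq => ?_
    have h : p + q + j ≡ k [MOD 4] := by
      rw [add_assoc]; exact (Nat.ModEq.add_left p hq).trans hp
    exact le_iSup₂_of_le (p + q) h (pow_add (LinearMap.range (ExteriorAlgebra.ι ℂ)) p q).ge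
  exact h (Submodule.mul_mem_mul hx hy)

lemma algebraMap_mem_homSpace (j : Fin 4) (c : ℂ) :
    algebraMap ℂ (ExteriorAlgebra ℂ V) c ∈ homSpace V j j := by
  refine mem_homSpace (p := 0) (by simp; rfl) ?_
  exact SetLike.algebraMap_mem_graded (fun i : ℕ => ⋀[ℂ]^i V) c

variable (V)

/-- The algebra `Q_4`: the total morphism algebra of the category with objects `X_1, …, X_4`
and morphism spaces `Hom(X_j, X_k) = homSpace V j k`, composed by the exterior product. The
`(k, j)` entry of a matrix is the component in `Hom(X_j, X_k)`. -/
def Q4 : Subalgebra ℂ (Matrix (Fin 4) (Fin 4) (ExteriorAlgebra ℂ V)) where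
  carrier := {M | ∀ j k, M k j ∈ homSpace V j k}
  mul_mem' := by
    intro M N hM hN j k
    rw [Matrix.mul_apply]
    exact sum_mem fun l _ => homSpace_mul j l k (hM l k) (hN j l)
  add_mem' := fun hM hN j k => add_mem (hM j k) (hN j k)
  algebraMap_mem' := by
    intro c j k
    rw [Matrix.algebraMap_matrix_apply]
    split_ifs with h
    · subst h; exact algebraMap_mem_homSpace _ c
    · exact zero_mem _

/-- The degree `n` part of `Q_4`. -/
def Q4.degree (n : ℤ) : Submodule ℂ (Q4 V) where
  carrier := {M | ∀ j k, (M : Matrix (Fin 4) (Fin 4) (ExteriorAlgebra ℂ V)) k j ∈ homDegree V j k n}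
  zero_mem' := fun _ _ => zero_mem _
  add_mem' := fun hM hN j k => add_mem (hM j k) (hN j k)
  smul_mem' := fun c _ hM j k => Submodule.smul_mem _ c (hM j k)

/-- The semisimple ring `R_4 ≅ ℂ^4` of diagonal scalar matrices inside `Q_4`. -/
def R4 : Subalgebra ℂ (Q4 V) where
  carrier := {M | ∃ r : Fin 4 → ℂ, (M : Matrix (Fin 4) (Fin 4) (ExteriorAlgebra ℂ V)) =
    Matrix.diagonal fun j => algebraMap ℂ (ExteriorAlgebra ℂ V) (r j)}
  mul_mem' := by
    rintro M N ⟨r, hr⟩ ⟨s, hs⟩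
    exact ⟨r * s, by simp [hr, hs]⟩
  add_mem' := by
    rintro M N ⟨r, hr⟩ ⟨s, hs⟩
    exact ⟨r + s, by simp [hr, hs]⟩
  algebraMap_mem' := fun c => ⟨fun _ => c, by
    ext i j
    simp [Matrix.algebraMap_matrix_apply, Matrix.diagonal_apply]⟩

variable {V}

lemma map_mem_homSpace (f : V →ₗ[ℂ] V) {j k : Fin 4} {x : ExteriorAlgebra ℂ V}
    (hx : x ∈ homSpace V j k) : ExteriorAlgebra.map f x ∈ homSpace V j k := by
  have key : (homSpace V j k).map (ExteriorAlgebra.map f).toLinearMap ≤ homSpace V j k := by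
    simp only [homSpace, Submodule.map_iSup]
    refine iSup_le fun p => iSup_le fun hp => le_iSup₂_of_le p hp ?_
    rw [Submodule.map_pow]
    refine pow_le_pow_left' ?_ p
    rw [ExteriorAlgebra.ι_range_map_map]
    rintro _ ⟨y, -, rfl⟩
    exact ⟨y, rfl⟩
  exact key ⟨x, hx, rfl⟩

/-- The action `ρ_G` of a linear automorphism of `V` on `Q_4`: it acts on each
`Hom(X_j, X_k)` through the exterior powers. -/
def rhoG (g : V ≃ₗ[ℂ] V) : Q4 V →ₗ[ℂ] Q4 V where
  toFun M := ⟨(M : Matrix (Fin 4) (Fin 4) (ExteriorAlgebra ℂ V)).map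
    (ExteriorAlgebra.map (g : V →ₗ[ℂ] V)), fun j k => map_mem_homSpace _ (M.2 j k)⟩
  map_add' M N := by ext; simp
  map_smul' c M := by ext; simp

/-- The maximal torus `H ⊂ SL(V)` of automorphisms which are diagonal in a given basis. -/
def torus (b : Module.Basis (Fin 4) ℂ V) : Subgroup (SpecialLinearGroup ℂ V) where
  carrier := {g | ∀ i, ∃ c : ℂ, g (b i) = c • b i}
  one_mem' := fun i => ⟨1, by simp⟩
  mul_mem' := by
    intro g h hg hh i
    obtain ⟨c, hc⟩ := hg i
    obtain ⟨d, hd⟩ := hh i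
    exact ⟨d * c, by simp [hc, hd, mul_smul]⟩
  inv_mem' := by
    intro g hg i
    obtain ⟨c, hc⟩ := hg i
    have hc0 : c ≠ 0 := by
      rintro rfl
      rw [zero_smul] at hc
      exact b.ne_zero i (g.1.map_eq_zero_iff.mp hc)
    refine ⟨c⁻¹, g.1.injective ?_⟩
    have h1 : g.1 ((g⁻¹ : SpecialLinearGroup ℂ V) (b i)) = b i := g.1.apply_symm_apply (b i)
    have hc' : g.1 (b i) = c • b i := hc
    change g.1 ((g⁻¹ : SpecialLinearGroup ℂ V) (b i)) = g.1 (c⁻¹ • b i)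
    rw [map_smul, hc', smul_smul, inv_mul_cancel₀ hc0, one_smul]
    exact h1

/-- The image `T = H / Γ_4` of the maximal torus in `PSL(V)`, where `Γ_4` is the
center of `SL(V)`. -/
abbrev projTorus (b : Module.Basis (Fin 4) ℂ V) : Type _ :=
  torus b ⧸ (Subgroup.center (SpecialLinearGroup ℂ V)).subgroupOf (torus b)

/-- The symmetries `ρ_T(t) = ρ_G(Σ(t))` obtained from a choice `lift` of representatives
`Σ(t)`. -/
def rhoT (b : Module.Basis (Fin 4) ℂ V) (lift : projTorus b → torus b) (t : projTorus b) :
    Q4 V →ₗ[ℂ] Q4 V :=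
  rhoG (lift t : SpecialLinearGroup ℂ V).1

/-- The idempotent `u_j` of `R_4`, that is, the identity of `X_j`. -/
def idem (j : Fin 4) : Q4 V :=
  ⟨Matrix.single j j 1, fun j' k' => by
    rw [Matrix.single_apply]
    split_ifs with h
    · obtain ⟨rfl, rfl⟩ := h
      simpa using algebraMap_mem_homSpace (V := V) j 1
    · exact zero_mem _⟩

/-- The vector `v ∈ V = Λ^1 V` as a morphism from `X_j` to `X_{j+1}`, with indices taken
mod `4`. -/
def arrow (v : V) (j : Fin 4) : Q4 V :=
  ⟨Matrix.single (j + 1) j (ExteriorAlgebra.ι ℂ v), fun j' k' => by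
    rw [Matrix.single_apply]
    split_ifs with h
    · obtain ⟨rfl, rfl⟩ := h
      refine mem_homSpace (p := 1) ?_ ?_
      · revert j; decide
      · exact (pow_one (LinearMap.range (ExteriorAlgebra.ι ℂ (M := V)))).ge ⟨v, rfl⟩
    · exact zero_mem _⟩

end Q4

end SeidelQ

end

open scoped BigOperators

set_option linter.unusedSectionVars false

noncomputable section

/-! Multilinear maps with all numbers of inputs are treated together as functions on lists, that is,
on the bar coalgebra. There an A∞-structure is a coderivation of square zero and an A∞-homomorphism
is a coalgebra map. Let `F` be a homomorphism up to some order. Its defect, the difference between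
applying the target structure after `F` and `F` after the source structure, is a Hochschild cocycle
in the first arity where it can be nonzero (`ins_defect`, `IsPartialHom.mem_cocycles`). Changing `F`
one arity earlier changes this cocycle by a coboundary (`defect_add`, `IsPartialHom.extend`). Gauge
transformations are therefore built arity by arity as soon as the obstruction classes vanish
(`AInfStructure.exists_gauge`), and everything comes down to cohomology.

The algebra Q_4 is generated by R_4 and a copy of the exterior algebra ΛV (`emb`). A bimodule
cochain is determined by its restriction to ΛV (`eq_of_comp_emb`), and a function on ΛV with the
correct weights extends back to a cochain (`ext4`, `exists_cochain`). An alternating twist by the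
parity turns the signed differential into the ordinary one (`hochschildDifferential_tw`). The
grading of Q_4 is itself given by weights: up to conjugation with elements of R_4, it is the scaling
action on V. Combined with torus equivariance, a cochain of degree -2m is equivariant under all
invertible diagonal matrices up to the m-th power of the determinant (`Good.map_diag`), and cochains
of odd degree vanish (`Good.eq_zero_of_odd`).

Filter Q_4 by exterior degree. On the leading term of a cocycle ΛV acts through its augmentation, so
Koszul duality applies: modulo coboundaries the leading term is a polynomial in the coordinates,
with coefficients of exterior degree q (`exists_koszul`). For 2m + 2 inputs, scaling V forces 4m + q
= 2m + 2, hence m = 1 and q = 0, and the other diagonal matrices force every variable to occur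
exactly once (`weight_eq_zero`). Only y_0 y_1 y_2 y_3 survives, with four inputs. All other cocycles
are removed step by step along the filtration (`exists_primitive`).

For four inputs the remaining class is detected by the value on (v,v,v,v) with v the sum of the
basis vectors. For a cocycle this value is a scalar multiple of 1 (`exists_scalar`), and for a
coboundary it is zero (`twF_eq_zero_of_mem_coboundaries`). A cocycle with nonzero scalar is the cup
product of four derivations, one for each coordinate (`exists_cocycle`).

Finally, an equivariant A∞-structure has vanishing μ^3, so μ^4 is a cocycle with a scalar c. If c =
0 the structure is gauge trivial; if two structures have the same c they are gauge equivalent.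
Scaling V by r multiplies c by r^4, so over ℂ any two nonzero scalars can be matched by pulling one
structure back along a scaling (`AInfStructure.exists_iso`). -/

namespace SeidelQ

/-! ### Functions on lists

A family of multilinear maps with any number of inputs is treated as a function on lists; the head
of the list is the rightmost input `a_1`. -/

section Lists

variable {A Z Z' : Type*} [AddCommGroup A] [Module ℂ A] [AddCommGroup Z] [Module ℂ Z]
  [AddCommGroup Z'] [Module ℂ Z']

/-- `f` is linear in each entry of the list. -/
def ML (f : List A → Z) : Prop :=
  ∀ (u v : List A) (x y : A) (c : ℂ),
    f (u ++ (c • x + y) :: v) = c • f (u ++ x :: v) + f (u ++ y :: v)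

lemma ML.cons {f : List A → Z} (hf : ML f) (a : A) : ML fun l => f (a :: l) :=
  fun u v x y c => hf (a :: u) v x y c

lemma ML.head {f : List A → Z} (hf : ML f) (c : ℂ) (x y : A) (v : List A) :
    f ((c • x + y) :: v) = c • f (x :: v) + f (y :: v) := hf [] v x y c

lemma ML.add {f g : List A → Z} (hf : ML f) (hg : ML g) : ML fun l => f l + g l := by
  intro u v x y c
  simp only [hf u v, hg u v, smul_add]; abel

lemma ML.smul {f : List A → Z} (hf : ML f) (k : ℂ) : ML fun l => k • f l := by
  intro u v x y c
  simp only [hf u v, smul_add, smul_comm c k]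

lemma ML.sub {f g : List A → Z} (hf : ML f) (hg : ML g) : ML fun l => f l - g l := by
  simpa [sub_eq_add_neg] using hf.add (hg.smul (-1))

lemma ML.comp {f : List A → Z} (hf : ML f) (L : Z →ₗ[ℂ] Z') : ML fun l => L (f l) := by
  intro u v x y c
  simp only [hf u v, map_add, map_smul]

lemma ML.map_zero {f : List A → Z} (hf : ML f) (u v : List A) : f (u ++ 0 :: v) = 0 := by
  have h := hf u v 0 0 1
  simpa using h

lemma ML.map_add {f : List A → Z} (hf : ML f) (u v : List A) (x y : A) :
    f (u ++ (x + y) :: v) = f (u ++ x :: v) + f (u ++ y :: v) := by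
  simpa using hf u v x y 1

lemma ML.map_smul {f : List A → Z} (hf : ML f) (u v : List A) (c : ℂ) (x : A) :
    f (u ++ (c • x) :: v) = c • f (u ++ x :: v) := by
  have h := hf u v x 0 c
  rw [hf.map_zero] at h
  simpa using h

lemma ML.map_neg {f : List A → Z} (hf : ML f) (u v : List A) (x : A) :
    f (u ++ (-x) :: v) = -f (u ++ x :: v) := by
  simpa using hf.map_smul u v (-1) x

/-- The partial function of the first entry, as a linear map. -/
def ML.headMap {f : List A → Z} (hf : ML f) (v : List A) : A →ₗ[ℂ] Z where
  toFun x := f (x :: v)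
  map_add' x y := hf.map_add [] v x y
  map_smul' c x := hf.map_smul [] v c x

lemma ML.map {f : List A → Z} (hf : ML f) (L : A →ₗ[ℂ] A) : ML fun l => f (l.map L) := by
  intro u v x y c
  simpa using hf (u.map L) (v.map L) (L x) (L y) c

/-- The sum of `φ(β(x), v)` over all decompositions `l = x v`. -/
def pre (φ : List A → Z) : (List A → A) → List A → Z
  | β, [] => φ [β []]
  | β, a :: l => φ (β [] :: a :: l) + pre φ (fun l => β (a :: l)) l

/-- The sum of `φ(σ u, b(x), v)` over all decompositions `l = u x v` with `x` nonempty. -/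
def ins (σ : A → A) (b : List A → A) : (List A → Z) → List A → Z
  | _, [] => 0
  | φ, a :: l => pre φ (fun l => b (a :: l)) l + ins σ b (fun l => φ (σ a :: l)) l

/-- The sum of `φ(β(x_1), F(x_2), …, F(x_r))` over all decompositions `l = x_1 ⋯ x_r` with
`x_2, …, x_r` nonempty. -/
def blk (F : List A → A) : (List A → Z) → (List A → A) → List A → Z
  | φ, β, [] => φ [β []]
  | φ, β, a :: l => blk F φ (fun l => β (a :: l)) l +
      blk F (fun l => φ (β [] :: l)) (fun l => F (a :: l)) l

/-- The sum of `φ(F(x_1), …, F(x_r))` over all decompositions `l = x_1 ⋯ x_r` into nonempty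
parts. -/
def com (F : List A → A) (φ : List A → Z) : List A → Z
  | [] => φ []
  | a :: l => blk F φ (fun l => F (a :: l)) l

/-- Postcomposition with a linear map commutes with all of these sums. Identities can therefore be
proved once, for a universal function with values in a ring of words, and then evaluated on any
multilinear function. -/
lemma pre_comp (L : Z →ₗ[ℂ] Z') (φ : List A → Z) (β : List A → A) (l : List A) :
    pre (fun l => L (φ l)) β l = L (pre φ β l) := by
  induction l generalizing β with
  | nil => rfl
  | cons a l ih => simp [pre, ih]

lemma ins_comp (σ : A → A) (b : List A → A) (L : Z →ₗ[ℂ] Z') (φ : List A → Z) (l : List A) :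
    ins σ b (fun l => L (φ l)) l = L (ins σ b φ l) := by
  induction l generalizing φ with
  | nil => simp [ins]
  | cons a l ih => simp [ins, ih (fun l => φ (σ a :: l)), pre_comp]

lemma blk_comp (F : List A → A) (L : Z →ₗ[ℂ] Z') (φ : List A → Z) (β : List A → A) (l : List A) :
    blk F (fun l => L (φ l)) β l = L (blk F φ β l) := by
  induction l generalizing φ β with
  | nil => rfl
  | cons a l ih => simp [blk, ih (fun l => φ (β [] :: l)), ih φ]

lemma com_comp (F : List A → A) (L : Z →ₗ[ℂ] Z') (φ : List A → Z) (l : List A) :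
    com F (fun l => L (φ l)) l = L (com F φ l) := by
  cases l with
  | nil => rfl
  | cons a l => simp [com, blk_comp]

lemma pre_add (φ ψ : List A → Z) (β : List A → A) (l : List A) :
    pre (fun l => φ l + ψ l) β l = pre φ β l + pre ψ β l := by
  induction l generalizing β with
  | nil => rfl
  | cons a l ih => simp only [pre, ih]; abel

lemma ins_add (σ : A → A) (b : List A → A) (φ ψ : List A → Z) (l : List A) :
    ins σ b (fun l => φ l + ψ l) l = ins σ b φ l + ins σ b ψ l := by
  induction l generalizing φ ψ with
  | nil => simp [ins]
  | cons a l ih =>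
    simp only [ins, pre_add, ih (fun l => φ (σ a :: l)) (fun l => ψ (σ a :: l))]; abel

lemma ins_smul (σ : A → A) (b : List A → A) (c : ℂ) (φ : List A → Z) (l : List A) :
    ins σ b (fun l => c • φ l) l = c • ins σ b φ l :=
  ins_comp σ b (c • LinearMap.id) φ l

lemma blk_add (F : List A → A) (φ ψ : List A → Z) (β : List A → A) (l : List A) :
    blk F (fun l => φ l + ψ l) β l = blk F φ β l + blk F ψ β l := by
  induction l generalizing φ ψ β with
  | nil => rfl
  | cons a l ih =>
    simp only [blk, ih φ ψ, ih (fun l => φ (β [] :: l)) (fun l => ψ (β [] :: l))]; abel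

lemma pre_lin {φ : List A → Z} (hφ : ML φ) (c : ℂ) (β γ : List A → A) (l : List A) :
    pre φ (fun l => c • β l + γ l) l = c • pre φ β l + pre φ γ l := by
  induction l generalizing β γ with
  | nil => simp [pre, hφ.head]
  | cons a l ih => simp only [pre, ih, hφ.head, smul_add]; abel

lemma blk_lin (F : List A → A) {φ : List A → Z} (hφ : ML φ) (c : ℂ) (β γ : List A → A)
    (l : List A) :
    blk F φ (fun l => c • β l + γ l) l = c • blk F φ β l + blk F φ γ l := by
  induction l generalizing β γ with
  | nil => simp [blk, hφ.head]
  | cons a l ih =>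
    have h : (fun l => φ ((c • β [] + γ []) :: l)) =
        fun l => c • φ (β [] :: l) + φ (γ [] :: l) := by
      funext l; exact hφ.head c _ _ l
    have h2 := fun β' => blk_comp F (c • (LinearMap.id : Z →ₗ[ℂ] Z)) (fun l => φ (β [] :: l)) β' l
    simp only [LinearMap.smul_apply, LinearMap.id_apply] at h2
    simp only [blk, ih (fun l => β (a :: l)), h, smul_add]
    rw [blk_add F (fun l => c • φ (β [] :: l)), h2]
    abel

lemma ML.pre {φ : List A → Z} {β : List A → A} (hφ : ML φ) (hβ : ML β) : ML (pre φ β) := by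
  intro u
  induction u generalizing β with
  | nil =>
    intro v x y c
    have h : (fun l => β ((c • x + y) :: l)) = fun l => c • β (x :: l) + β (y :: l) := by
      funext l; exact hβ.head c _ _ l
    have h2 := hφ [β []] v x y c
    simp only [List.cons_append, List.nil_append] at h2
    simp only [SeidelQ.pre, List.nil_append, h, pre_lin hφ, h2, smul_add]
    abel
  | cons a u ih =>
    intro v x y c
    have h2 := hφ (β [] :: a :: u) v x y c
    simp only [List.cons_append] at h2
    simp only [SeidelQ.pre, List.cons_append, h2, ih (hβ.cons a) v, smul_add]
    abel

lemma ML.ins {σ : A →ₗ[ℂ] A} {b : List A → A} {φ : List A → Z} (hb : ML b) (hφ : ML φ) :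
    ML (ins σ b φ) := by
  intro u
  induction u generalizing φ with
  | nil =>
    intro v x y c
    have h : (fun l => b ((c • x + y) :: l)) = fun l => c • b (x :: l) + b (y :: l) := by
      funext l; exact hb.head c _ _ l
    have h2 : (fun l => φ (σ (c • x + y) :: l)) =
        fun l => c • φ (σ x :: l) + φ (σ y :: l) := by
      funext l; rw [LinearMap.map_add, LinearMap.map_smul]; exact hφ.head c _ _ l
    simp only [SeidelQ.ins, List.nil_append, h, h2, pre_lin hφ,
      ins_add σ b (fun l => c • φ (σ x :: l)), ins_smul, smul_add]
    abel
  | cons a u ih =>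
    intro v x y c
    simp only [SeidelQ.ins, List.cons_append, hφ.pre (hb.cons a) u v, ih (hφ.cons _) v, smul_add]
    abel

lemma ML.blk {F : List A → A} (hF : ML F) {φ : List A → Z} {β : List A → A} (hφ : ML φ)
    (hβ : ML β) : ML (blk F φ β) := by
  intro u
  induction u generalizing φ β with
  | nil =>
    intro v x y c
    have h : (fun l => β ((c • x + y) :: l)) = fun l => c • β (x :: l) + β (y :: l) := by
      funext l; exact hβ.head c _ _ l
    have h2 : (fun l => F ((c • x + y) :: l)) = fun l => c • F (x :: l) + F (y :: l) := by
      funext l; exact hF.head c _ _ l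
    simp only [SeidelQ.blk, List.nil_append, h, h2, blk_lin F hφ, blk_lin F (hφ.cons _), smul_add]
    abel
  | cons a u ih =>
    intro v x y c
    simp only [SeidelQ.blk, List.cons_append, ih hφ (hβ.cons a) v, ih (hφ.cons _) (hF.cons a) v,
      smul_add]
    abel

lemma ML.com {F : List A → A} (hF : ML F) {φ : List A → Z} (hφ : ML φ) : ML (com F φ) := by
  intro u
  cases u with
  | nil =>
    intro v x y c
    have h2 : (fun l => F ((c • x + y) :: l)) = fun l => c • F (x :: l) + F (y :: l) := by
      funext l; exact hF.head c _ _ l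
    simp only [SeidelQ.com, List.nil_append, h2, blk_lin F hφ]
  | cons a u => exact fun v x y c => hF.blk hφ (hF.cons a) u v x y c

end Lists

/-! ### Closure of the bimodule, degree and equivariance conditions under insertion and composition.
-/

section Closure

variable {A : Type*} [Ring A] [Algebra ℂ A] {T : Type*}

/-- A list of homogeneous elements of total shifted degree `∑ (|a_i| - 1) = q`. -/
inductive HomList (𝒜 : ℤ → Submodule ℂ A) : List A → ℤ → Prop
  | nil : HomList 𝒜 [] 0
  | cons {a : A} {l : List A} {p q : ℤ} : a ∈ 𝒜 p → HomList 𝒜 l q → HomList 𝒜 (a :: l) (p - 1 + q)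

/-- Balanced over `R` between neighbouring inputs. -/
def Bal (R : Subalgebra ℂ A) {Z : Type*} (f : List A → Z) : Prop :=
  ∀ r ∈ R, ∀ (u v : List A) (x y : A), f (u ++ x :: (y * r) :: v) = f (u ++ (r * x) :: y :: v)

/-- Left `R`-linear in the last entry of the list. -/
def LastLin (R : Subalgebra ℂ A) (f : List A → A) : Prop :=
  ∀ r ∈ R, ∀ (u : List A) (x : A), f (u ++ [r * x]) = r * f (u ++ [x])

/-- Right `R`-linear in the first entry of the list. -/
def HeadLin (R : Subalgebra ℂ A) (f : List A → A) : Prop :=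
  ∀ r ∈ R, ∀ (x : A) (l : List A), f ((x * r) :: l) = f (x :: l) * r

/-- `f` sends lists of shifted degree `q` to degree `q + c`. -/
def Deg (𝒜 : ℤ → Submodule ℂ A) (c : ℤ) (f : List A → A) : Prop :=
  ∀ (l : List A) (q : ℤ), HomList 𝒜 l q → f l ∈ 𝒜 (q + c)

/-- The conditions of `cochains`, for functions on lists. -/
structure Good (𝒜 : ℤ → Submodule ℂ A) (R : Subalgebra ℂ A) (ρ : T → A →ₗ[ℂ] A) (c : ℤ)
    (f : List A → A) : Prop where
  ml : ML f
  bal : Bal R f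
  last : LastLin R f
  head : HeadLin R f
  deg : Deg 𝒜 c f
  eqv : ∀ (t : T) (l : List A), f (l.map (ρ t)) = ρ t (f l)
  nil : f [] = 0

/-- `σ` is the operator `a ↦ (-1)^{|a| - 1} a`. -/
structure IsSign (𝒜 : ℤ → Submodule ℂ A) (R : Subalgebra ℂ A) (ρ : T → A →ₗ[ℂ] A)
    (σ : A →ₗ[ℂ] A) : Prop where
  apply : ∀ (p : ℤ) (a : A), a ∈ 𝒜 p → σ a = sgn (p - 1) • a
  mul_left : ∀ r ∈ R, ∀ a, σ (r * a) = r * σ a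
  mul_right : ∀ r ∈ R, ∀ a, σ (a * r) = σ a * r
  rho : ∀ t a, σ (ρ t a) = ρ t (σ a)
  invol : ∀ a, σ (σ a) = a

variable {R : Subalgebra ℂ A} {𝒜 : ℤ → Submodule ℂ A} {ρ : T → A →ₗ[ℂ] A}
  {σ : A →ₗ[ℂ] A}

lemma IsSign.mem (hσ : IsSign 𝒜 R ρ σ) {p : ℤ} {a : A} (ha : a ∈ 𝒜 p) : σ a ∈ 𝒜 p := by
  rw [hσ.apply p a ha]
  exact zsmul_mem ha _

section Bal

variable {Z : Type*} [AddCommGroup Z] [Module ℂ Z]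

lemma Bal.cons {f : List A → Z} (hf : Bal R f) (a : A) : Bal R fun l => f (a :: l) :=
  fun r hr u v x y => hf r hr (a :: u) v x y

lemma LastLin.cons {f : List A → A} (hf : LastLin R f) (a : A) : LastLin R fun l => f (a :: l) :=
  fun r hr u x => hf r hr (a :: u) x

/-- In every term the value of β stands directly after x, so a factor on its right can be moved to
the left of x. -/
lemma Bal.pre_mul {φ : List A → Z} (hφ : Bal R φ) {r : A} (hr : r ∈ R) (x : A) (β : List A → A)
    (l : List A) : pre (fun l => φ (x :: l)) (fun l => β l * r) l =
      pre (fun l => φ ((r * x) :: l)) β l := by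
  induction l generalizing β with
  | nil => exact hφ r hr [] [] x _
  | cons a l ih =>
    simp only [SeidelQ.pre, ih]
    rw [show φ (x :: (β [] * r) :: a :: l) = _ from hφ r hr [] (a :: l) x _]
    rfl

lemma Bal.blk_mul {F : List A → A} {φ : List A → Z} (hφ : Bal R φ) {r : A} (hr : r ∈ R) (x : A)
    (β : List A → A) (l : List A) : blk F (fun l => φ (x :: l)) (fun l => β l * r) l =
      blk F (fun l => φ ((r * x) :: l)) β l := by
  induction l generalizing β with
  | nil => exact hφ r hr [] [] x _
  | cons a l ih =>
    have h : (fun l => φ (x :: (β [] * r) :: l)) = fun l => φ ((r * x) :: β [] :: l) := by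
      funext l; exact hφ r hr [] l x _
    simp only [SeidelQ.blk, ih (fun l => β (a :: l)), h]

lemma Bal.pre {φ : List A → Z} {β : List A → A} (hφ : Bal R φ) (hβ : Bal R β)
    (hβ' : LastLin R β) : Bal R (pre φ β) := by
  intro r hr u
  induction u generalizing β with
  | nil =>
    intro v x y
    have h1 := hφ r hr [β []] v x y
    have h2 := hφ r hr [] v (β [x]) y
    have h3 : (fun l => β (x :: (y * r) :: l)) = fun l => β ((r * x) :: y :: l) := by
      funext l; exact hβ r hr [] l x y
    have h4 : β [r * x] = r * β [x] := hβ' r hr [] x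
    simp only [List.nil_append, List.cons_append] at h1 h2
    simp only [SeidelQ.pre, List.nil_append, h1, h2, h3, h4]
  | cons a u ih =>
    intro v x y
    have h1 := hφ r hr (β [] :: a :: u) v x y
    simp only [List.cons_append] at h1
    simp only [SeidelQ.pre, List.cons_append, h1, ih (hβ.cons a) (hβ'.cons a)]

lemma Bal.blk {F : List A → A} (hF : Bal R F) (hF' : LastLin R F) (hF'' : HeadLin R F)
    {φ : List A → Z} {β : List A → A} (hφ : Bal R φ) (hβ : Bal R β)
    (hβ' : LastLin R β) : Bal R (blk F φ β) := by
  intro r hr u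
  induction u generalizing φ β with
  | nil =>
    intro v x y
    have h3 : (fun l => β (x :: (y * r) :: l)) = fun l => β ((r * x) :: y :: l) := by
      funext l; exact hβ r hr [] l x y
    have h4 : β [r * x] = r * β [x] := hβ' r hr [] x
    have h5 : (fun l => F (x :: (y * r) :: l)) = fun l => F ((r * x) :: y :: l) := by
      funext l; exact hF r hr [] l x y
    have h6 : F [r * x] = r * F [x] := hF' r hr [] x
    have h7 : (fun l => F ((y * r) :: l)) = fun l => F (y :: l) * r := by
      funext l; exact hF'' r hr y l
    simp only [SeidelQ.blk, List.nil_append, h3, h4, h5, h6, h7, hφ.blk_mul hr,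
      (hφ.cons (β [])).blk_mul hr]
  | cons a u ih =>
    intro v x y
    simp only [SeidelQ.blk, List.cons_append, ih hφ (hβ.cons a) (hβ'.cons a),
      ih (hφ.cons _) (hF.cons a) (hF'.cons a)]

lemma Bal.com {F : List A → A} (hF : Bal R F) (hF' : LastLin R F) (hF'' : HeadLin R F)
    {φ : List A → Z} (hφ : Bal R φ) : Bal R (com F φ) := by
  intro r hr u v x y
  cases u with
  | nil =>
    have h5 : (fun l => F (x :: (y * r) :: l)) = fun l => F ((r * x) :: y :: l) := by
      funext l; exact hF r hr [] l x y
    have h6 : F [r * x] = r * F [x] := hF' r hr [] x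
    have h7 : (fun l => F ((y * r) :: l)) = fun l => F (y :: l) * r := by
      funext l; exact hF'' r hr y l
    simp only [SeidelQ.com, SeidelQ.blk, List.nil_append, h5, h6, h7, hφ.blk_mul hr]
  | cons a u => exact Bal.blk hF hF' hF'' hφ (hF.cons a) (hF'.cons a) r hr u v x y

/-- When x and y lie in the same block, balancing of `b` moves the factor. When a block ends at x or
begins at y, linearity of `b` in its last or first entry releases the factor, and balancing of `φ`
carries it across. Outside the block, the R-linearity of σ is used. -/
lemma Bal.ins (hσ : IsSign 𝒜 R ρ σ) {b : List A → A} (hb : Bal R b) (hb' : LastLin R b)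
    (hb'' : HeadLin R b) {φ : List A → Z} (hφ : Bal R φ) : Bal R (ins σ b φ) := by
  intro r hr u
  induction u generalizing φ with
  | nil =>
    intro v x y
    have h5 : (fun l => b (x :: (y * r) :: l)) = fun l => b ((r * x) :: y :: l) := by
      funext l; exact hb r hr [] l x y
    have h6 : b [r * x] = r * b [x] := hb' r hr [] x
    have h7 : (fun l => b ((y * r) :: l)) = fun l => b (y :: l) * r := by
      funext l; exact hb'' r hr y l
    have h8 : (fun l => φ (σ x :: (σ y * r) :: l)) = fun l => φ ((r * σ x) :: σ y :: l) := by
      funext l; exact hφ r hr [] l _ _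
    have h9 := hφ r hr [] v (b [x]) y
    simp only [List.nil_append] at h9
    simp only [SeidelQ.ins, SeidelQ.pre, List.nil_append, h5, h6, h7, hφ.pre_mul hr,
      hσ.mul_left r hr, hσ.mul_right r hr, h8, h9]
  | cons a u ih =>
    intro v x y
    simp only [SeidelQ.ins, List.cons_append, ih (hφ.cons _),
      Bal.pre hφ (hb.cons a) (hb'.cons a) r hr]

lemma HeadLin.pre {φ : List A → A} (hφ : HeadLin R φ) {r : A} (hr : r ∈ R) (β : List A → A)
    (l : List A) : pre φ (fun l => β l * r) l = pre φ β l * r := by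
  induction l generalizing β with
  | nil => exact hφ r hr _ []
  | cons a l ih => simp only [SeidelQ.pre, ih, hφ r hr, add_mul]

lemma HeadLin.blk {F : List A → A} {φ : List A → A} (hφ : HeadLin R φ) {r : A} (hr : r ∈ R)
    (β : List A → A) (l : List A) : blk F φ (fun l => β l * r) l = blk F φ β l * r := by
  induction l generalizing β with
  | nil => exact hφ r hr _ []
  | cons a l ih =>
    have h : (fun l => φ ((β [] * r) :: l)) = fun l => LinearMap.mulRight ℂ r (φ (β [] :: l)) := by
      funext l; exact hφ r hr _ l
    simp only [SeidelQ.blk, ih (fun l => β (a :: l)), h]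
    rw [blk_comp F (LinearMap.mulRight ℂ r) (fun l => φ (β [] :: l)), add_mul]
    rfl

lemma HeadLin.com {F : List A → A} (hF : HeadLin R F) {φ : List A → A} (hφ : HeadLin R φ) :
    HeadLin R (com F φ) := by
  intro r hr x l
  have h7 : (fun l => F ((x * r) :: l)) = fun l => F (x :: l) * r := by
    funext l; exact hF r hr x l
  simp only [SeidelQ.com, h7, hφ.blk hr]

lemma HeadLin.ins (hσ : IsSign 𝒜 R ρ σ) {b : List A → A} (hb : HeadLin R b) {φ : List A → A}
    (hφ : HeadLin R φ) : HeadLin R (ins σ b φ) := by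
  intro r hr x l
  have h7 : (fun l => b ((x * r) :: l)) = fun l => b (x :: l) * r := by
    funext l; exact hb r hr x l
  have h : (fun l => φ ((σ x * r) :: l)) = fun l => LinearMap.mulRight ℂ r (φ (σ x :: l)) := by
    funext l; exact hφ r hr _ l
  simp only [SeidelQ.ins, h7, hφ.pre hr, hσ.mul_right r hr, h]
  rw [ins_comp σ b (LinearMap.mulRight ℂ r) (fun l => φ (σ x :: l)), add_mul]
  rfl

lemma LastLin.pre {φ : List A → A} {β : List A → A} (hφ : LastLin R φ) (hβ : LastLin R β) :
    LastLin R (pre φ β) := by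
  intro r hr u
  induction u generalizing β with
  | nil =>
    intro x
    have h1 := hφ r hr [β []] x
    have h2 : β [r * x] = r * β [x] := hβ r hr [] x
    have h3 := hφ r hr [] (β [x])
    simp only [List.nil_append, List.cons_append] at h1 h3
    simp only [SeidelQ.pre, List.nil_append, h1, h2, h3, mul_add]
  | cons a u ih =>
    intro x
    have h1 := hφ r hr (β [] :: a :: u) x
    simp only [List.cons_append] at h1
    simp only [SeidelQ.pre, List.cons_append, h1, ih (hβ.cons a) x, mul_add]

lemma LastLin.blk {F : List A → A} (hF : LastLin R F) {φ : List A → A} {β : List A → A}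
    (hφ : LastLin R φ) (hβ : LastLin R β) : LastLin R (blk F φ β) := by
  intro r hr u
  induction u generalizing φ β with
  | nil =>
    intro x
    have h1 := hφ r hr [β []] (F [x])
    have h2 : β [r * x] = r * β [x] := hβ r hr [] x
    have h3 := hφ r hr [] (β [x])
    have h4 : F [r * x] = r * F [x] := hF r hr [] x
    simp only [List.nil_append, List.cons_append] at h1 h3
    simp only [SeidelQ.blk, List.nil_append, h1, h2, h3, h4, mul_add]
  | cons a u ih =>
    intro x
    simp only [SeidelQ.blk, List.cons_append, ih hφ (hβ.cons a) x, ih (hφ.cons _) (hF.cons a) x,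
      mul_add]

lemma LastLin.com {F : List A → A} (hF : LastLin R F) {φ : List A → A}
    (hφ : LastLin R φ) : LastLin R (com F φ) := by
  intro r hr u x
  cases u with
  | nil =>
    have h4 : F [r * x] = r * F [x] := hF r hr [] x
    have h3 := hφ r hr [] (F [x])
    simp only [List.nil_append] at h3
    simp only [SeidelQ.com, SeidelQ.blk, List.nil_append, h3, h4]
  | cons a u => exact LastLin.blk hF hφ (hF.cons a) r hr u x

lemma LastLin.ins {σ : A → A} {b : List A → A} (hb : LastLin R b) {φ : List A → A}
    (hφ : LastLin R φ) : LastLin R (ins σ b φ) := by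
  intro r hr u
  induction u generalizing φ with
  | nil =>
    intro x
    have h4 : b [r * x] = r * b [x] := hb r hr [] x
    have h3 := hφ r hr [] (b [x])
    simp only [List.nil_append] at h3
    simp only [SeidelQ.ins, SeidelQ.pre, List.nil_append, h3, h4, add_zero]
  | cons a u ih =>
    intro x
    simp only [SeidelQ.ins, List.cons_append, ih (hφ.cons _) x,
      LastLin.pre hφ (hb.cons a) r hr u x, mul_add]

end Bal

lemma Deg.cons {c : ℤ} {f : List A → A} (hf : Deg 𝒜 c f) {a : A} {p : ℤ} (ha : a ∈ 𝒜 p) :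
    Deg 𝒜 (p - 1 + c) fun l => f (a :: l) := by
  intro l q hl
  have := hf _ _ (hl.cons ha)
  rwa [show p - 1 + q + c = q + (p - 1 + c) by ring] at this

/-- Each entry counts with its degree minus one, so substituting a value of offset e for a block
contributes e - 1. -/
lemma Deg.pre {c e : ℤ} {φ β : List A → A} (hφ : Deg 𝒜 c φ) (hβ : Deg 𝒜 e β) :
    Deg 𝒜 (c + e - 1) (pre φ β) := by
  intro l q hl
  induction hl generalizing β e with
  | nil =>
    have := hφ _ _ (HomList.nil.cons (hβ _ _ HomList.nil))
    simp only [SeidelQ.pre]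
    convert this using 2; ring
  | @cons a l p q ha hl ih =>
    simp only [SeidelQ.pre]
    refine add_mem ?_ ?_
    · have := hφ _ _ ((hl.cons ha).cons (hβ _ _ HomList.nil))
      convert this using 2; ring
    · have := ih (hβ.cons ha)
      convert this using 2; ring

lemma Deg.blk {F : List A → A} (hF : Deg 𝒜 1 F) {c e : ℤ} {φ β : List A → A} (hφ : Deg 𝒜 c φ)
    (hβ : Deg 𝒜 e β) : Deg 𝒜 (c + e - 1) (blk F φ β) := by
  intro l q hl
  induction hl generalizing φ β c e with
  | nil =>
    have := hφ _ _ (HomList.nil.cons (hβ _ _ HomList.nil))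
    simp only [SeidelQ.blk]
    convert this using 2; ring
  | @cons a l p q ha hl ih =>
    simp only [SeidelQ.blk]
    refine add_mem ?_ ?_
    · have := ih hφ (hβ.cons ha)
      convert this using 2; ring
    · have := ih (hφ.cons (hβ _ _ HomList.nil)) (hF.cons ha)
      convert this using 2; ring

lemma Deg.com {F : List A → A} (hF : Deg 𝒜 1 F) {c : ℤ} {φ : List A → A} (hφ : Deg 𝒜 c φ) :
    Deg 𝒜 c (com F φ) := by
  intro l q hl
  cases hl with
  | nil => exact hφ _ _ HomList.nil
  | @cons a l p q ha hl =>
    have := Deg.blk hF hφ (hF.cons ha) _ _ hl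
    simp only [SeidelQ.com]
    convert this using 2; ring

lemma Deg.ins (hσ : IsSign 𝒜 R ρ σ) {b : List A → A} (hb : Deg 𝒜 2 b) {c : ℤ} {φ : List A → A}
    (hφ : Deg 𝒜 c φ) : Deg 𝒜 (c + 1) (ins σ b φ) := by
  intro l q hl
  induction hl generalizing φ c with
  | nil => exact zero_mem _
  | @cons a l p q ha hl ih =>
    simp only [SeidelQ.ins]
    refine add_mem ?_ ?_
    · have := hφ.pre (hb.cons ha) _ _ hl
      convert this using 2; ring
    · have := ih (hφ.cons (hσ.mem ha))
      convert this using 2; ring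

lemma pre_eqv (g : A →ₗ[ℂ] A) {φ φ' β β' : List A → A} (hφ : ∀ l, φ' (l.map g) = g (φ l))
    (hβ : ∀ l, β' (l.map g) = g (β l)) (l : List A) :
    pre φ' β' (l.map g) = g (pre φ β l) := by
  induction l generalizing β β' with
  | nil =>
    have h1 := hβ []
    have h2 := hφ [β []]
    simp only [List.map_nil, List.map_cons] at h1 h2
    simp only [pre, List.map_nil, h1, h2]
  | cons a l ih =>
    have h1 := hβ []
    have h2 := hφ (β [] :: a :: l)
    simp only [List.map_nil, List.map_cons] at h1 h2
    simp only [pre, List.map_cons, h1, h2, map_add]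
    rw [ih fun l => hβ (a :: l)]

lemma blk_eqv (g : A →ₗ[ℂ] A) {F φ φ' β β' : List A → A} (hF : ∀ l, F (l.map g) = g (F l))
    (hφ : ∀ l, φ' (l.map g) = g (φ l))
    (hβ : ∀ l, β' (l.map g) = g (β l)) (l : List A) :
    blk F φ' β' (l.map g) = g (blk F φ β l) := by
  induction l generalizing φ φ' β β' with
  | nil =>
    have h1 := hβ []
    have h2 := hφ [β []]
    simp only [List.map_nil, List.map_cons] at h1 h2
    simp only [blk, List.map_nil, h1, h2]
  | cons a l ih =>
    have h1 := hβ []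
    simp only [List.map_nil] at h1
    simp only [blk, List.map_cons, map_add]
    rw [ih hφ fun l => hβ (a :: l), ih (φ := fun l => φ (β [] :: l)) (β := fun l => F (a :: l))]
    · intro l; rw [h1]; exact hφ (β [] :: l)
    · intro l; exact hF (a :: l)

lemma ins_eqv (g : A →ₗ[ℂ] A) (hg : ∀ a, σ (g a) = g (σ a)) {b φ φ' : List A → A}
    (hb : ∀ l, b (l.map g) = g (b l)) (hφ : ∀ l, φ' (l.map g) = g (φ l)) (l : List A) :
    ins σ b φ' (l.map g) = g (ins σ b φ l) := by
  induction l generalizing φ φ' with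
  | nil => simp [ins]
  | cons a l ih =>
    simp only [ins, List.map_cons, map_add]
    rw [pre_eqv g hφ (β := fun l => b (a :: l)) fun l => hb (a :: l),
      ih (φ := fun l => φ (σ a :: l))]
    intro l; rw [hg]; exact hφ (σ a :: l)

lemma Good.ins (hσ : IsSign 𝒜 R ρ σ) {b : List A → A} {c : ℤ} {φ : List A → A}
    (hb : Good 𝒜 R ρ 2 b) (hφ : Good 𝒜 R ρ c φ) : Good 𝒜 R ρ (c + 1) (ins σ b φ) where
  ml := hb.ml.ins hφ.ml
  bal := hb.bal.ins hσ hb.last hb.head hφ.bal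
  last := hb.last.ins hφ.last
  head := hb.head.ins hσ hφ.head
  deg := hb.deg.ins hσ hφ.deg
  eqv t l := ins_eqv (ρ t) (hσ.rho t) (hb.eqv t) (hφ.eqv t) l
  nil := rfl

lemma Good.com {F : List A → A} {c : ℤ} {φ : List A → A}
    (hF : Good 𝒜 R ρ 1 F) (hφ : Good 𝒜 R ρ c φ) : Good 𝒜 R ρ c (com F φ) where
  ml := hF.ml.com hφ.ml
  bal := hF.bal.com hF.last hF.head hφ.bal
  last := hF.last.com hφ.last
  head := hF.head.com hφ.head
  deg := hF.deg.com hφ.deg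
  eqv t l := by
    cases l with
    | nil => exact hφ.eqv t []
    | cons a l => exact blk_eqv (ρ t) (hF.eqv t) (hφ.eqv t) (fun l => hF.eqv t (a :: l)) l
  nil := hφ.nil

lemma Good.add {c : ℤ} {f g : List A → A} (hf : Good 𝒜 R ρ c f) (hg : Good 𝒜 R ρ c g) :
    Good 𝒜 R ρ c fun l => f l + g l where
  ml := hf.ml.add hg.ml
  bal r hr u v x y := by beta_reduce; rw [hf.bal r hr, hg.bal r hr]
  last r hr u x := by beta_reduce; rw [hf.last r hr, hg.last r hr, mul_add]
  head r hr x l := by beta_reduce; rw [hf.head r hr, hg.head r hr, add_mul]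
  deg l q hl := add_mem (hf.deg l q hl) (hg.deg l q hl)
  eqv t l := by rw [hf.eqv, hg.eqv, map_add]
  nil := by rw [hf.nil, hg.nil, add_zero]

lemma Good.smul {c : ℤ} {f : List A → A} (k : ℂ) (hf : Good 𝒜 R ρ c f) :
    Good 𝒜 R ρ c fun l => k • f l where
  ml := hf.ml.smul k
  bal r hr u v x y := by beta_reduce; rw [hf.bal r hr]
  last r hr u x := by beta_reduce; rw [hf.last r hr, mul_smul_comm]
  head r hr x l := by beta_reduce; rw [hf.head r hr, smul_mul_assoc]
  deg l q hl := Submodule.smul_mem _ _ (hf.deg l q hl)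
  eqv t l := by rw [hf.eqv, map_smul]
  nil := by rw [hf.nil, smul_zero]

lemma Good.sub {c : ℤ} {f g : List A → A} (hf : Good 𝒜 R ρ c f) (hg : Good 𝒜 R ρ c g) :
    Good 𝒜 R ρ c fun l => f l - g l := by
  simpa [sub_eq_add_neg] using hf.add (hg.smul (-1))

end Closure

/-! ### Passage between families of multilinear maps and functions on lists. -/

section Bridge

variable {A : Type*} [Ring A] [Algebra ℂ A] {T : Type*}

/-- The sequence of entries of a list, extended by zero. -/
def seq (l : List A) : ℕ → A := fun n => l.getD n 0

/-- The function on lists defined by a family of multilinear maps. -/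
def toL (μ : ∀ d : ℕ, Multi A d) (l : List A) : A := app (μ l.length) (seq l)

lemma ofFn_update {s : ℕ} (a : Fin s → A) (i : Fin s) (z : A) :
    List.ofFn (Function.update a i z) = (List.ofFn a).set i z := by
  apply List.ext_getElem
  · simp
  · intro n h1 h2
    simp only [List.getElem_ofFn, List.getElem_set]
    by_cases hn : (i : ℕ) = n
    · subst hn; simp
    · rw [if_neg hn, Function.update_of_ne (fun h => hn (by rw [← h]))]

lemma list_set_eq (l : List A) {i : ℕ} (hi : i < l.length) (z : A) :
    l.set i z = l.take i ++ z :: l.drop (i + 1) := by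
  rw [List.set_eq_take_append_cons_drop, if_pos hi]

/-- The multilinear map with `s` inputs defined by a function on lists. -/
def toMulti (s : ℕ) (f : List A → A) (hf : ML f) : Multi A s where
  toFun a := f (List.ofFn a)
  map_update_add' := by
    intro inst a i x y
    obtain rfl : inst = instDecidableEqFin s := Subsingleton.elim _ _
    have hi : (i : ℕ) < (List.ofFn a).length := by simp
    simp only [ofFn_update, list_set_eq _ hi, hf.map_add]
  map_update_smul' := by
    intro inst a i c x
    obtain rfl : inst = instDecidableEqFin s := Subsingleton.elim _ _
    have hi : (i : ℕ) < (List.ofFn a).length := by simp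
    simp only [ofFn_update, list_set_eq _ hi, hf.map_smul]

lemma toL_eq (μ : ∀ d : ℕ, Multi A d) {l : List A} {s : ℕ} (h : l.length = s) :
    toL μ l = app (μ s) (seq l) := by
  subst h; rfl

lemma app_congr {s : ℕ} (f : Multi A s) {a a' : ℕ → A} (h : ∀ n < s, a n = a' n) :
    app f a = app f a' := by
  unfold app
  congr 1
  funext n
  exact h n n.2

lemma toL_single {s : ℕ} (f : Multi A s) {l : List A} (h : l.length = s) :
    toL (Pi.single s f) l = app f (seq l) := by
  rw [toL_eq _ h, Pi.single_eq_same]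

lemma toL_single_of_ne {s : ℕ} (f : Multi A s) {l : List A} (h : l.length ≠ s) :
    toL (Pi.single s f) l = 0 := by
  unfold toL
  rw [Pi.single_eq_of_ne h]
  rfl

lemma seq_ofFn {s : ℕ} (a : ℕ → A) {n : ℕ} (hn : n < s) :
    seq (List.ofFn fun i : Fin s => a i) n = a n := by
  simp [seq, hn]

lemma ofFn_seq (l : List A) : (List.ofFn fun i : Fin l.length => seq l i) = l := by
  apply List.ext_getElem
  · simp
  · intro n h1 h2
    simp [seq]

lemma app_toMulti (f : List A → A) (hf : ML f) (s : ℕ) (a : ℕ → A) :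
    app (toMulti s f hf) a = f (List.ofFn fun i : Fin s => a i) := rfl

lemma toL_ofFn (μ : ∀ d : ℕ, Multi A d) (s : ℕ) (a : Fin s → A) :
    toL μ (List.ofFn a) = μ s a := by
  rw [toL_eq μ (List.length_ofFn)]
  unfold app
  congr 1
  funext i
  simp [seq]

lemma seq_append_cons (u v : List A) (x y : A) {s : ℕ} (h : u.length < s) :
    (fun i : Fin s => seq (u ++ x :: v) i) =
      Function.update (fun i : Fin s => seq (u ++ y :: v) i) ⟨u.length, h⟩ x := by
  funext i
  by_cases hi : i = ⟨u.length, h⟩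
  · subst hi; simp [seq]
  · rw [Function.update_of_ne hi]
    have hi' : (i : ℕ) ≠ u.length := fun h' => hi (Fin.ext h')
    rcases lt_or_gt_of_ne hi' with h1 | h1
    · simp only [seq, List.getD_append _ _ _ _ h1]
    · simp only [seq, List.getD_append_right _ _ _ _ h1.le]
      obtain ⟨k, hk⟩ := Nat.exists_eq_add_of_lt h1
      rw [hk, show u.length + k + 1 - u.length = k + 1 by omega]
      simp

lemma toL_append_cons (μ : ∀ d : ℕ, Multi A d) (u v : List A) (x y : A) {s : ℕ}
    (hs : s = u.length + v.length + 1) :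
    toL μ (u ++ x :: v) = μ s (Function.update (fun i : Fin s => seq (u ++ y :: v) i)
      ⟨u.length, by omega⟩ x) := by
  rw [toL_eq μ (s := s) (by simp; omega)]
  unfold app
  rw [seq_append_cons u v x y]

lemma ML.toL (μ : ∀ d : ℕ, Multi A d) : ML (toL μ) := by
  intro u v x y c
  simp only [toL_append_cons μ u v _ 0 rfl, (μ _).map_update_add, (μ _).map_update_smul]

lemma HomList.exists_degrees {𝒜 : ℤ → Submodule ℂ A} {l : List A} {q : ℤ} (h : HomList 𝒜 l q) :
    ∃ p : Fin l.length → ℤ, (∀ i : Fin l.length, seq l i ∈ 𝒜 (p i)) ∧ q = ∑ i, (p i - 1) := by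
  induction h with
  | nil => exact ⟨fun _ => 0, fun i => i.elim0, by simp⟩
  | @cons a l p q ha hl ih =>
    obtain ⟨P, hP, rfl⟩ := ih
    refine ⟨Fin.cons p P, fun i => ?_, ?_⟩
    · refine Fin.cases ?_ (fun i => ?_) i
      · simpa [seq] using ha
      · simpa [seq] using hP i
    · change _ = ∑ i : Fin (l.length + 1), _
      rw [Fin.sum_univ_succ]; simp

lemma HomList.ofFn {𝒜 : ℤ → Submodule ℂ A} {s : ℕ} {a : Fin s → A} {p : Fin s → ℤ}
    (h : ∀ i, a i ∈ 𝒜 (p i)) : HomList 𝒜 (List.ofFn a) (∑ i, (p i - 1)) := by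
  induction s with
  | zero => simpa using HomList.nil
  | succ s ih =>
    rw [List.ofFn_succ, Fin.sum_univ_succ]
    exact (ih fun i => h i.succ).cons (h 0)

variable {R : Subalgebra ℂ A} {𝒜 : ℤ → Submodule ℂ A} {ρ : T → A →ₗ[ℂ] A}

lemma seq_mid (u v : List A) (x : A) : seq (u ++ x :: v) u.length = x := by simp [seq]

/-- In shifted degrees the dependence of the degree on the arity disappears: the offset is 2 for
A∞-structures and 1 for homomorphisms. -/
lemma Good.toL {μ : ∀ d : ℕ, Multi A d} {c : ℤ} (h0 : μ 0 = 0)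
    (h : ∀ d : ℕ, 1 ≤ d → μ d ∈ cochains 𝒜 R ρ d (c - d)) : Good 𝒜 R ρ c (toL μ) where
  ml := ML.toL μ
  bal r hr u v x y := by
    have hs : u.length + (y :: v).length + 1 = (u ++ [x]).length + v.length + 1 := by simp; ring
    have key := ((h (u.length + (y :: v).length + 1) (by omega)).2.1 r hr
      (fun i => seq (u ++ x :: y :: v) i)).1 ⟨u.length, by omega⟩
      ⟨(u ++ [x]).length, by omega⟩ (by simp)
    rw [toL_append_cons μ u (y :: v) (r * x) x rfl,
      show u ++ x :: (y * r) :: v = (u ++ [x]) ++ (y * r) :: v by simp,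
      toL_append_cons μ (u ++ [x]) v (y * r) y hs]
    have e1 : u ++ [x] ++ y :: v = u ++ x :: y :: v := by simp
    simp only [e1] at key ⊢
    have e2 : seq (u ++ x :: y :: v) (u ++ [x]).length = y := by
      rw [← e1]; exact seq_mid _ _ _
    simp only [e2, seq_mid] at key
    exact key
  last r hr u x := by
    have key := ((h (u.length + ([] : List A).length + 1) (by omega)).2.1 r hr
      (fun i => seq (u ++ [x]) i)).2.1 ⟨u.length, by omega⟩ (by simp)
    rw [toL_append_cons μ u [] (r * x) x rfl]
    simp only [seq_mid] at key
    rw [key, toL_eq μ (l := u ++ [x]) (s := u.length + ([] : List A).length + 1) (by simp)]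
    rfl
  head r hr x l := by
    have key := ((h (([] : List A).length + l.length + 1) (by omega)).2.1 r hr
      (fun i => seq ([] ++ x :: l) i)).2.2 ⟨([] : List A).length, by simp⟩ (by simp)
    have e := toL_append_cons μ [] l (x * r) x rfl
    simp only [seq_mid] at key
    rw [key] at e
    rw [toL_eq μ (l := x :: l) (s := ([] : List A).length + l.length + 1) (by simp)]
    exact e
  deg l q hl := by
    obtain ⟨p, hp, rfl⟩ := hl.exists_degrees
    rcases Nat.eq_zero_or_pos l.length with h' | h'
    · rw [List.length_eq_zero_iff] at h'
      subst h'
      have : SeidelQ.toL μ ([] : List A) = 0 := by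
        rw [toL_eq μ (s := 0) rfl, h0]; rfl
      rw [this]; exact zero_mem _
    · have := (h l.length h').1 p (fun i => seq l i) hp
      rw [Finset.sum_sub_distrib]
      change (μ l.length) (fun i => seq l i) ∈ _
      convert this using 2
      simp; ring
  eqv t l := by
    rcases Nat.eq_zero_or_pos l.length with h' | h'
    · rw [List.length_eq_zero_iff] at h'
      subst h'
      have : SeidelQ.toL μ ([] : List A) = 0 := by
        rw [toL_eq μ (s := 0) rfl, h0]; rfl
      simp [this]
    · have := (h l.length h').2.2 t (fun i => seq l i)
      rw [toL_eq μ (s := l.length) (by simp)]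
      refine Eq.trans ?_ this
      unfold app
      congr 1
      funext i
      simp [seq]
  nil := by rw [toL_eq μ (s := 0) rfl, h0]; rfl

lemma Good.toMulti_mem {c : ℤ} {f : List A → A} (hf : Good 𝒜 R ρ c f) (s : ℕ) :
    toMulti s f hf.ml ∈ cochains 𝒜 R ρ s (c - s) := by
  refine ⟨fun p a ha => ?_, fun r hr a => ⟨fun i j hij => ?_, fun i hi => ?_, fun i hi => ?_⟩,
    fun t a => ?_⟩
  · have := hf.deg _ _ (HomList.ofFn ha)
    rw [Finset.sum_sub_distrib] at this
    change f (List.ofFn a) ∈ _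
    convert this using 2
    simp; ring
  · change f (List.ofFn _) = f (List.ofFn _)
    rw [ofFn_update, ofFn_update, list_set_eq _ (by simp), list_set_eq _ (by simp)]
    have e1 : (List.ofFn a).take j = (List.ofFn a).take i ++ [a i] := by
      rw [hij, List.take_add_one]; simp
    have e2 : (List.ofFn a).drop (i + 1) = a j :: (List.ofFn a).drop (j + 1) := by
      rw [← hij, List.drop_eq_getElem_cons (by simp)]; simp
    rw [e1, e2, List.append_assoc]
    exact hf.bal r hr _ _ _ _
  · change f (List.ofFn _) = r * f (List.ofFn _)
    have e2 : (List.ofFn a).drop (i + 1) = [] := by rw [hi]; simp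
    rw [ofFn_update, list_set_eq _ (by simp), e2, hf.last r hr]
    congr 2
    have := list_set_eq (List.ofFn a) (i := i) (by simp) (a i)
    rw [e2] at this
    rw [← this, ← ofFn_update, Function.update_eq_self]
  · change f (List.ofFn _) = f (List.ofFn _) * r
    rw [ofFn_update, list_set_eq _ (by simp), hi]
    simp only [List.take_zero, List.nil_append]
    rw [hf.head r hr]
    congr 2
    have := list_set_eq (List.ofFn a) (i := i) (by simp) (a i)
    rw [hi] at this
    simp only [List.take_zero, List.nil_append] at this
    rw [← this, ← hi, ← ofFn_update, Function.update_eq_self]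
  · change f (List.ofFn _) = ρ t (f (List.ofFn _))
    rw [← hf.eqv, List.map_ofFn]
    rfl

end Bridge

/-! ### The A∞-equations in terms of insertion and composition. -/

section Sums

variable {A : Type*} [Ring A] [Algebra ℂ A] {T : Type*} {Z : Type*} [AddCommGroup Z] [Module ℂ Z]

lemma pre_eq_sum (φ : List A → Z) (β : List A → A) (l : List A) :
    pre φ β l = ∑ e ∈ Finset.range (l.length + 1), φ (β (l.take e) :: l.drop e) := by
  induction l generalizing β with
  | nil => simp [pre]
  | cons a l ih =>
    rw [List.length_cons, Finset.sum_range_succ', pre, ih, add_comm]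
    simp

lemma ins_eq_sum (σ : A → A) (b : List A → A) (φ : List A → Z) (l : List A) :
    ins σ b φ l = ∑ i ∈ Finset.range l.length, ∑ e ∈ Finset.range (l.length - i),
      φ ((l.take i).map σ ++ b ((l.drop i).take (e + 1)) :: l.drop (i + (e + 1))) := by
  induction l generalizing φ with
  | nil => simp [ins]
  | cons a l ih =>
    rw [List.length_cons, Finset.sum_range_succ', ins, ih, pre_eq_sum, add_comm]
    simp [Nat.add_right_comm _ 1]

lemma sum_Icc_eq_sum_range (n : ℕ) (f : ℕ → Z) :
    ∑ e ∈ Finset.Icc 1 n, f e = ∑ e ∈ Finset.range n, f (e + 1) := by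
  induction n with
  | zero => simp
  | succ n ih => rw [Finset.sum_Icc_succ_top (by omega), ih, Finset.sum_range_succ]

lemma sgn_add (m n : ℤ) : sgn (m + n) = sgn m * sgn n := by
  simp [sgn, Int.negOnePow_add]

variable {R : Subalgebra ℂ A} {𝒜 : ℤ → Submodule ℂ A} {ρ : T → A →ₗ[ℂ] A} {σ : A →ₗ[ℂ] A}

lemma ML.map_zsmul {f : List A → Z} (hf : ML f) (u v : List A) (n : ℤ) (x : A) :
    f (u ++ (n • x) :: v) = n • f (u ++ x :: v) := by
  have := hf.map_smul u v (n : ℂ) x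
  rwa [Int.cast_smul_eq_zsmul, Int.cast_smul_eq_zsmul] at this

/-- The sign in `insertionSum` depends only on the entries before the inserted block, and it is
produced by applying σ to each of them. Degrees thus disappear from the formulas. -/
lemma IsSign.map_sign (hσ : IsSign 𝒜 R ρ σ) {φ : List A → Z} (hφ : ML φ) {u : List A} {q : ℤ}
    (hu : HomList 𝒜 u q) (w : List A) : φ (u.map σ ++ w) = sgn q • φ (u ++ w) := by
  induction hu generalizing φ with
  | nil => simp [sgn]
  | @cons a l p q ha hl ih =>
    rw [List.map_cons, List.cons_append, List.cons_append, ih (hφ.cons _), hσ.apply p a ha,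
      sgn_add, mul_comm, mul_smul]
    exact congrArg _ (hφ.map_zsmul [] _ _ _)

lemma homList_take {l : List A} {p : ℕ → ℤ} (h : ∀ n < l.length, seq l n ∈ 𝒜 (p n)) {i : ℕ}
    (hi : i ≤ l.length) : HomList 𝒜 (l.take i) (∑ n ∈ Finset.range i, (p n - 1)) := by
  have e : l.take i = List.ofFn fun n : Fin i => seq l n := by
    apply List.ext_getElem
    · simpa using hi
    · intro n h1 h2
      simp only [List.length_take] at h1
      have : n < l.length := by omega
      simp [seq, this]
  rw [e, ← Fin.sum_univ_eq_sum_range (fun n => p n - 1)]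
  exact HomList.ofFn fun n => h n (by omega)

lemma toL_splice (μ : ∀ d : ℕ, Multi A d) {l : List A} {i e : ℕ} (hi : i < l.length)
    (he : e < l.length - i) (x : A) :
    toL μ (l.take i ++ x :: l.drop (i + (e + 1))) =
      app (μ (l.length + 1 - (e + 1))) (splice (seq l) i (e + 1) x) := by
  have hlen : (l.take i ++ x :: l.drop (i + (e + 1))).length = l.length + 1 - (e + 1) := by
    simp; omega
  rw [toL_eq μ hlen]
  apply app_congr
  intro n hn
  have ht : (l.take i).length = i := by simp; omega
  unfold splice
  split_ifs with h1 h2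
  · have : n < l.length := by omega
    simp only [seq, List.getD_append _ _ _ _ (ht.symm ▸ h1)]
    simp [this, h1]
  · subst h2
    have := seq_mid (l.take n) (l.drop (n + (e + 1))) x
    rwa [ht] at this
  · obtain ⟨k, rfl⟩ : ∃ k, n = i + (k + 1) := ⟨n - i - 1, by omega⟩
    simp only [seq]
    rw [List.getD_append_right _ _ _ _ (by omega), ht, Nat.add_sub_cancel_left, List.getD_cons_succ]
    simp only [List.getD_eq_getElem?_getD, List.getElem?_drop]
    congr 2; omega

lemma insertionSum_eq (hσ : IsSign 𝒜 R ρ σ) (f g : ∀ d : ℕ, Multi A d) (l : List A) (p : ℕ → ℤ)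
    (h : ∀ n < l.length, seq l n ∈ 𝒜 (p n)) :
    insertionSum f g l.length p (seq l) = ins σ (toL g) (toL f) l := by
  rw [ins_eq_sum]
  unfold insertionSum
  rw [sum_Icc_eq_sum_range, Finset.sum_comm' (t' := Finset.range l.length)
    (s' := fun i => Finset.range (l.length - i))]
  · refine Finset.sum_congr rfl fun i hi => Finset.sum_congr rfl fun e he => ?_
    rw [Finset.mem_range] at hi he
    rw [hσ.map_sign (ML.toL f) (homList_take h hi.le), toL_splice f hi he]
    congr 3
    rw [toL_eq g (s := e + 1) (by simp; omega)]
    apply app_congr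
    intro n hn
    have : i + n < l.length := by omega
    simp [seq, hn, this]
  · intro e i; simp only [Finset.mem_range]; omega

lemma blk_eq_sum (F : List A → A) (φ : List A → Z) (β : List A → A) (l : List A) :
    blk F φ β l = ∑ e ∈ Finset.range (l.length + 1),
      com F (fun w => φ (β (l.take e) :: w)) (l.drop e) := by
  induction l generalizing β with
  | nil => simp [blk, com]
  | cons a l ih =>
    rw [List.length_cons, Finset.sum_range_succ', blk, ih]
    simp [com]

/-- A composition of n + 1 is its first block, of size e + 1, followed by a composition of n - e.
This recursion matches the one for `blk`. -/
lemma sum_composition_succ (n : ℕ) (G : List ℕ → Z) :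
    ∑ c : Composition (n + 1), G c.blocks =
      ∑ e ∈ Finset.range (n + 1), ∑ c : Composition (n - e), G ((e + 1) :: c.blocks) := by
  rw [← Fin.sum_univ_eq_sum_range (fun e => ∑ c : Composition (n - e), G ((e + 1) :: c.blocks)),
    ← Fintype.sum_sigma' (fun (e : Fin (n + 1)) (c : Composition (n - e)) =>
      G ((e + 1) :: c.blocks))]
  symm
  let f : (Σ e : Fin (n + 1), Composition (n - e)) → Composition (n + 1) := fun x =>
    { blocks := (x.1 + 1) :: x.2.blocks
      blocks_pos := by
        intro i hi
        rcases List.mem_cons.mp hi with rfl | hi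
        · omega
        · exact x.2.blocks_pos hi
      blocks_sum := by
        rw [List.sum_cons, x.2.blocks_sum]; have := x.1.2; omega }
  refine Fintype.sum_bijective f ⟨?_, ?_⟩ _ _ fun x => rfl
  · rintro ⟨e, c⟩ ⟨e', c'⟩ h
    have hb : ((e : ℕ) + 1) :: c.blocks = ((e' : ℕ) + 1) :: c'.blocks := congrArg Composition.blocks h
    simp only [List.cons.injEq, add_left_inj] at hb
    obtain ⟨h1, h2⟩ := hb
    obtain rfl := Fin.ext h1
    obtain rfl := Composition.ext h2
    rfl
  · intro c
    rcases hb : c.blocks with _ | ⟨e, bs⟩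
    · have := c.blocks_sum; rw [hb] at this; simp at this
    · have hs := c.blocks_sum
      have hpos : 0 < e := c.blocks_pos (by rw [hb]; exact List.mem_cons_self)
      rw [hb, List.sum_cons] at hs
      refine ⟨⟨⟨e - 1, by omega⟩, ⟨bs, fun {i} hi => c.blocks_pos ?_, ?_⟩⟩, ?_⟩
      · rw [hb]; exact List.mem_cons_of_mem _ hi
      · simp only; omega
      · apply Composition.ext
        change (e - 1 + 1) :: bs = c.blocks
        rw [hb, Nat.sub_add_cancel hpos]

lemma com_eq_sum (F : List A → A) (φ : List A → Z) (l : List A) {n : ℕ} (h : l.length = n) :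
    com F φ l = ∑ c : Composition n, φ ((List.splitWrtCompositionAux l c.blocks).map F) := by
  induction n using Nat.strong_induction_on generalizing φ l with
  | _ n ih =>
    cases l with
    | nil =>
      simp only [List.length_nil] at h
      subst h
      have : ∀ c : Composition 0, c.blocks = [] := fun c => by simp
      simp only [com, this, List.splitWrtCompositionAux, List.map_nil]
      simp [composition_card]
    | cons a l =>
      obtain ⟨n, rfl⟩ : ∃ m, n = m + 1 := ⟨l.length, by simpa using h.symm⟩
      simp only [List.length_cons, add_left_inj] at h
      rw [sum_composition_succ n (fun bs => φ ((List.splitWrtCompositionAux (a :: l) bs).map F)),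
        com, blk_eq_sum, h]
      refine Finset.sum_congr rfl fun e he => ?_
      rw [Finset.mem_range] at he
      rw [ih (n - e) (by omega) _ _ (by simp; omega)]
      simp [List.splitWrtCompositionAux_cons]

lemma partitionSum_eq (g f : ∀ d : ℕ, Multi A d) (l : List A) {d : ℕ} (h : l.length = d) :
    partitionSum g f d (seq l) = com (toL f) (toL g) l := by
  rw [com_eq_sum _ _ _ h]
  refine Finset.sum_congr rfl fun c _ => ?_
  subst h
  have hlen : ((List.splitWrtCompositionAux l c.blocks).map (toL f)).length = c.length := by
    simp [List.length_splitWrtCompositionAux]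
  rw [toL_eq g hlen]
  unfold app
  congr 1
  funext k
  have hk : (k : ℕ) < (List.splitWrtComposition l c).length := by
    rw [List.length_splitWrtComposition]; exact k.2
  have hk' : (k : ℕ) < (List.splitWrtCompositionAux l c.blocks).length := hk
  have e0 : (List.splitWrtCompositionAux l c.blocks)[(k : ℕ)] =
    (l.take (c.sizeUpTo (k + 1))).drop (c.sizeUpTo k) := List.getElem_splitWrtComposition l c k hk
  have e1 : seq ((List.splitWrtCompositionAux l c.blocks).map (toL f)) k =
      toL f ((List.splitWrtCompositionAux l c.blocks)[(k : ℕ)]) := by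
    simp [seq, hk']
  rw [e1, e0]
  have hb := c.sizeUpTo_succ k.2
  have hle := c.sizeUpTo_le (k + 1)
  have hb' : c.sizeUpTo (k + 1) = c.sizeUpTo k + c.blocksFun k := hb
  rw [toL_eq f (s := c.blocksFun k) (by simp; omega)]
  unfold app
  congr 1
  funext n
  have hn := n.2
  rw [c.coe_embedding]
  simp only [seq, List.getD_eq_getElem?_getD, List.getElem?_drop]
  rw [List.getElem?_take_of_lt (by omega)]

end Sums

/-! ### Insertion as a coderivation and composition as a coalgebra map. -/

section Convolution

variable {A W : Type*} [Ring A] [Algebra ℂ A] [Ring W] [Algebra ℂ W]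

/-- The convolution `(φ * ψ)(l) = ∑ φ(x) ψ(v)`, over all decompositions `l = x v`. -/
def conv : (List A → W) → (List A → W) → List A → W
  | φ, ψ, [] => φ [] * ψ []
  | φ, ψ, a :: l => φ [] * ψ (a :: l) + conv (fun l => φ (a :: l)) ψ l

/-- The unit of the convolution product. -/
def eps : List A → W
  | [] => 1
  | _ :: _ => 0

/-- The identity cochain, of length one. -/
def one : List A → A
  | [a] => a
  | _ => 0

lemma conv_eq_sum (φ ψ : List A → W) (l : List A) :
    conv φ ψ l = ∑ i ∈ Finset.range (l.length + 1), φ (l.take i) * ψ (l.drop i) := by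
  induction l generalizing φ with
  | nil => simp [conv]
  | cons a l ih =>
    rw [List.length_cons, Finset.sum_range_succ', conv, ih, add_comm]
    simp

lemma conv_add_left (φ φ' ψ : List A → W) (l : List A) :
    conv (fun l => φ l + φ' l) ψ l = conv φ ψ l + conv φ' ψ l := by
  simp only [conv_eq_sum, add_mul, Finset.sum_add_distrib]

lemma conv_sub_left (φ φ' ψ : List A → W) (l : List A) :
    conv (fun l => φ l - φ' l) ψ l = conv φ ψ l - conv φ' ψ l := by
  simp only [conv_eq_sum, sub_mul, Finset.sum_sub_distrib]

lemma conv_sub_right (φ ψ ψ' : List A → W) (l : List A) :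
    conv φ (fun l => ψ l - ψ' l) l = conv φ ψ l - conv φ ψ' l := by
  simp only [conv_eq_sum, mul_sub, Finset.sum_sub_distrib]

lemma pre_conv (β : List A → A) (φ ψ : List A → W) (l : List A) :
    pre (conv φ ψ) β l = φ [] * pre ψ β l + conv (pre φ β) ψ l := by
  induction l generalizing β with
  | nil => simp [pre, conv]
  | cons a l ih =>
    simp only [pre, conv, ih, conv_add_left (fun l => φ (β [] :: a :: l))
      (fun l => pre φ (fun l => β (a :: l)) l), mul_add]
    abel

/-- The letter produced by `b` ends up in the first or in the second factor. In the second case all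
letters of the first factor precede it and carry σ. -/
lemma ins_conv (σ : A → A) (b : List A → A) (φ ψ : List A → W) (l : List A) :
    ins σ b (conv φ ψ) l =
      conv (ins σ b φ) ψ l + conv (fun l => φ (l.map σ)) (ins σ b ψ) l := by
  induction l generalizing φ with
  | nil => simp [ins, conv]
  | cons a l ih =>
    have h := ins_comp σ b (LinearMap.mulLeft ℂ (φ [])) (fun l => ψ (σ a :: l)) l
    simp only [LinearMap.mulLeft_apply] at h
    simp only [ins, conv, pre_conv, ins_add σ b (fun l => φ [] * ψ (σ a :: l)), h,
      conv_add_left (fun l => pre φ (fun l => b (a :: l)) l), ih (fun l => φ (σ a :: l)),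
      List.map_nil, List.map_cons, mul_add, zero_mul, zero_add]
    abel

lemma blk_conv (F : List A → A) (β : List A → A) (φ ψ : List A → W) (l : List A) :
    blk F (conv φ ψ) β l = φ [] * blk F ψ β l + conv (blk F φ β) (com F ψ) l := by
  induction l generalizing β φ with
  | nil => simp [blk, conv, com]
  | cons a l ih =>
    have h := blk_comp F (LinearMap.mulLeft ℂ (φ [])) (fun l => ψ (β [] :: l))
    simp only [LinearMap.mulLeft_apply] at h
    simp only [blk, conv, ih, blk_add F (fun l => φ [] * ψ (β [] :: l)), h,
      com,
      conv_add_left (fun l => blk F φ (fun l => β (a :: l)) l), mul_add]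
    abel

/-- Cutting a sequence of blocks between two of them is the same as cutting the list first and
decomposing both parts. -/
lemma com_conv (F : List A → A) (φ ψ : List A → W) (l : List A) :
    com F (conv φ ψ) l = conv (com F φ) (com F ψ) l := by
  cases l with
  | nil => simp [com, conv]
  | cons a l => simp only [com, blk_conv, conv]

section Vanish

variable {Z : Type*} [AddCommGroup Z] [Module ℂ Z]

lemma pre_of_vanish {φ : List A → Z} (h : ∀ a l, φ (a :: l) = 0) (β : List A → A) (l : List A) :
    pre φ β l = 0 := by
  induction l generalizing β with
  | nil => exact h _ _
  | cons a l ih => simp [pre, h, ih]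

lemma ins_of_vanish (σ : A → A) (b : List A → A) {φ : List A → Z} (h : ∀ a l, φ (a :: l) = 0)
    (l : List A) : ins σ b φ l = 0 := by
  induction l generalizing φ with
  | nil => rfl
  | cons a l ih => rw [ins, pre_of_vanish h, ih (φ := fun l => φ (σ a :: l)) fun a' l => h _ _, add_zero]

lemma blk_of_vanish (F : List A → A) {φ : List A → Z} (h : ∀ a l, φ (a :: l) = 0)
    (β : List A → A) (l : List A) : blk F φ β l = 0 := by
  induction l generalizing β φ with
  | nil => exact h _ _
  | cons a l ih => rw [blk, ih h, ih (φ := fun l => φ (β [] :: l)) fun a' l => h _ _, add_zero]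

end Vanish

lemma one_cons_cons (a a' : A) (l : List A) : one (a :: a' :: l) = 0 := rfl

lemma pre_one (β : List A → A) (l : List A) : pre one β l = β l := by
  induction l generalizing β with
  | nil => rfl
  | cons a l ih => rw [pre, ih, one_cons_cons, zero_add]

lemma ins_one (σ : A → A) {b : List A → A} (hb : b [] = 0) (l : List A) : ins σ b one l = b l := by
  cases l with
  | nil => exact hb.symm
  | cons a l =>
    rw [ins, pre_one, ins_of_vanish σ b fun a' l => one_cons_cons _ a' l, add_zero]

lemma blk_one (F β : List A → A) (l : List A) : blk F one β l = β l := by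
  induction l generalizing β with
  | nil => rfl
  | cons a l ih =>
    rw [blk, ih, blk_of_vanish F fun a' l => one_cons_cons _ a' l, add_zero]

lemma com_one {F : List A → A} (hF : F [] = 0) (l : List A) : com F one l = F l := by
  cases l with
  | nil => exact hF.symm
  | cons a l => exact blk_one _ _ _

lemma ins_eps (σ : A → A) (b : List A → A) (l : List A) :
    ins σ b (eps : List A → W) l = 0 := ins_of_vanish σ b (fun _ _ => rfl) l

lemma com_eps (F : List A → A) (l : List A) : com F (eps : List A → W) l = eps l := by
  cases l with
  | nil => rfl
  | cons a l => exact blk_of_vanish F (fun _ _ => rfl) _ _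

/-- As φ vanishes on the empty list, only values of ψ on strictly shorter lists enter. Recursions
with a convolution factor of this kind can hence be solved by induction on the length. -/
lemma conv_vanish {φ ψ : List A → W} {d : ℕ} (h0 : φ [] = 0) {l : List A} (hl : l.length ≤ d)
    (hψ : ∀ l : List A, l.length < d → ψ l = 0) : conv φ ψ l = 0 := by
  rw [conv_eq_sum]
  refine Finset.sum_eq_zero fun i hi => ?_
  rcases Nat.eq_zero_or_pos i with rfl | h
  · simp [h0]
  · rcases Nat.eq_zero_or_pos l.length with hl0 | hl0
    · rw [List.length_eq_zero_iff] at hl0; subst hl0; simp [h0]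
    · rw [hψ (l.drop i) (by simp; omega), mul_zero]

variable (ι : A →ₗ[ℂ] W)

/-- The solution of `Y = D * H + κ * Y`, in the two lowest orders. -/
lemma low_order {D κ : List A → A} {H Y : List A → W}
    (hY : ∀ l, Y l = conv (fun l => ι (D l)) H l + conv (fun l => ι (κ l)) Y l)
    (hκ : κ [] = 0) (hH0 : H [] = 1) (hH1 : ∀ x, H [x] = ι x) {d : ℕ}
    (hD : ∀ l : List A, l.length < d → D l = 0) :
    (∀ l : List A, l.length ≤ d → Y l = ι (D l)) ∧
    ∀ (a x : A) (l : List A), (a :: l).length = d → Y (a :: (l ++ [x])) =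
      ι (D (a :: (l ++ [x]))) + ι (D (a :: l)) * ι x + ι (κ [a]) * ι (D (l ++ [x])) := by
  have hc : ∀ l : List A, l.length < d → conv (fun l => ι (D l)) H l = 0 := by
    intro l hl
    rw [conv_eq_sum]
    refine Finset.sum_eq_zero fun i _ => ?_
    rw [hD _ (by simp; omega), map_zero, zero_mul]
  have h1 : ∀ (n : ℕ) (l : List A), l.length = n → l.length < d → Y l = 0 := by
    intro n
    induction n using Nat.strong_induction_on with
    | _ n ih =>
      intro l hn hl
      rw [hY, hc l hl, zero_add]
      exact conv_vanish (by simp [hκ]) le_rfl fun l' hl' => ih _ (hn ▸ hl') l' rfl (by omega)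
  have h1' : ∀ l : List A, l.length < d → Y l = 0 := fun l hl => h1 _ l rfl hl
  have h2 : ∀ l : List A, l.length = d → Y l = ι (D l) := by
    intro l hl
    rw [hY, conv_vanish (by simp [hκ]) hl.le h1', add_zero, conv_eq_sum, hl,
      Finset.sum_range_succ, Finset.sum_eq_zero, zero_add, ← hl, List.take_length,
      List.drop_length, hH0, mul_one]
    intro i hi
    rw [Finset.mem_range] at hi
    rw [hD _ (by simp; omega), map_zero, zero_mul]
  refine ⟨fun l hl => ?_, fun a x l hl => ?_⟩
  · rcases hl.lt_or_eq with hl | hl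
    · rw [h1' l hl, hD l hl, map_zero]
    · exact h2 l hl
  simp only [List.length_cons] at hl
  rw [hY, conv_eq_sum]
  have e1 : (a :: (l ++ [x])).length + 1 = d + 1 + 1 := by simp; omega
  -- In D * H only the cuts after d and after d + 1 entries remain, because D vanishes on lists
  -- shorter than d.
  rw [e1, Finset.sum_range_succ, Finset.sum_range_succ, Finset.sum_eq_zero, zero_add]
  · have e2 : (a :: (l ++ [x])).take d = a :: l := by
      rw [← List.cons_append, List.take_append_of_le_length (by simp; omega)]
      exact List.take_of_length_le (by simp; omega)
    have e3 : (a :: (l ++ [x])).drop d = [x] := by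
      rw [← List.cons_append, List.drop_append_of_le_length (by simp; omega),
        List.drop_of_length_le (by simp; omega), List.nil_append]
    have e4 : (a :: (l ++ [x])).take (d + 1) = a :: (l ++ [x]) :=
      List.take_of_length_le (by simp; omega)
    have e5 : (a :: (l ++ [x])).drop (d + 1) = [] := List.drop_of_length_le (by simp; omega)
    rw [e2, e3, e4, e5, hH0, hH1, mul_one, add_comm (ι (D (a :: l)) * ι x), conv]
    congr 1
    -- In κ * Y only the cut after the first entry remains: the empty cut is killed by κ, and a
    -- later cut leaves for Y a list shorter than d.
    rw [hκ, map_zero, zero_mul, zero_add, conv_eq_sum, Finset.sum_range_succ',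
      Finset.sum_eq_zero, zero_add]
    · simp only [List.take_zero, List.drop_zero]
      rw [h2 _ (by simp; omega)]
    · intro i hi
      rw [h1' _ (by simp; omega), mul_zero]
  · intro i hi
    rw [Finset.mem_range] at hi
    rw [hD _ (by simp; omega), map_zero, zero_mul]

end Convolution

/-! ### The universal multilinear function, with values in a ring of words. -/

section Words

variable (A : Type*) [Ring A] [Algebra ℂ A]

/-- The space of multilinear functions on lists. -/
def MLSpace : Submodule ℂ (List A → A) where
  carrier := {f | ML f}
  zero_mem' := fun u v x y c => by simp
  add_mem' := fun hf hg => hf.add hg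
  smul_mem' := fun c _ hf => hf.smul c

/-- The ring in which words are multiplied: words act on multilinear functions by inserting their
letters. -/
def WordRing : Type _ := (Module.End ℂ (MLSpace A))ᵐᵒᵖ

instance : Ring (WordRing A) := inferInstanceAs (Ring (Module.End ℂ (MLSpace A))ᵐᵒᵖ)

instance : Algebra ℂ (WordRing A) := inferInstanceAs (Algebra ℂ (Module.End ℂ (MLSpace A))ᵐᵒᵖ)

variable {A}

/-- Letters as elements of the ring of words. -/
def letter : A →ₗ[ℂ] WordRing A where
  toFun a := MulOpposite.op
    { toFun := fun f => ⟨fun l => f.1 (a :: l), ML.cons f.2 a⟩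
      map_add' := fun _ _ => rfl
      map_smul' := fun _ _ => rfl }
  map_add' a a' := by
    apply MulOpposite.unop_injective
    ext f l
    exact ML.map_add f.2 [] l a a'
  map_smul' c a := by
    apply MulOpposite.unop_injective
    ext f l
    exact ML.map_smul f.2 [] l c a

/-- A list as an element of the ring of words. -/
def word : List A → WordRing A
  | [] => 1
  | a :: l => letter a * word l

/-- The evaluation of a multilinear function on elements of the ring of words. -/
def evalWord (f : List A → A) (hf : ML f) : WordRing A →ₗ[ℂ] A where
  toFun w := (w.unop ⟨f, hf⟩).1 []
  map_add' _ _ := rfl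
  map_smul' _ _ := rfl

lemma evalWord_letter_mul {f : List A → A} (hf : ML f) (a : A) (w : WordRing A) :
    evalWord f hf (letter a * w) = evalWord (fun l => f (a :: l)) (hf.cons a) w := rfl

lemma evalWord_letter {f : List A → A} (hf : ML f) (a : A) :
    evalWord f hf (letter a) = f [a] := rfl

lemma evalWord_word {f : List A → A} (hf : ML f) (l : List A) : evalWord f hf (word l) = f l := by
  induction l generalizing f with
  | nil => rfl
  | cons a l ih => rw [word, evalWord_letter_mul, ih]

/-- Peeling off the first letter writes `word` as the solution of a convolution recursion, to which
`ins_conv` and `com_conv` can be applied. -/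
lemma word_eq : (word : List A → WordRing A) =
    fun l => eps l + conv (fun l => letter (one l)) word l := by
  funext l
  cases l with
  | nil =>
    have : (one : List A → A) [] = 0 := rfl
    simp [word, conv, this, eps]
  | cons a l =>
    have h0 : (one : List A → A) [] = 0 := rfl
    rw [conv_eq_sum, List.length_cons, Finset.sum_range_succ', Finset.sum_range_succ',
      Finset.sum_eq_zero]
    · have h1 : (one : List A → A) [a] = a := rfl
      simp [word, h0, h1, eps]
    · intro i hi
      rw [Finset.mem_range] at hi
      have : one ((a :: l).take (i + 1 + 1)) = 0 := by
        cases l with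
        | nil => simp at hi
        | cons a' l => exact one_cons_cons _ _ _
      rw [this, map_zero, zero_mul]

lemma ins_word (σ : A → A) {b : List A → A} (hb : b [] = 0) (l : List A) :
    ins σ b word l = conv (fun l => letter (b l)) word l +
      conv (fun l => letter (one (l.map σ))) (ins σ b word) l := by
  conv_lhs => rw [word_eq]
  rw [ins_add, ins_eps, zero_add, ins_conv]
  congr 2
  funext l
  exact (ins_comp σ b letter one l).trans (by rw [ins_one σ hb])

lemma com_word {F : List A → A} (hF : F [] = 0) (l : List A) :
    com F word l = eps l + conv (fun l => letter (F l)) (com F word) l := by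
  have h : ∀ φ ψ : List A → WordRing A, com F (fun l => φ l + ψ l) l = com F φ l + com F ψ l := by
    intro φ ψ
    cases l with
    | nil => rfl
    | cons a l => exact blk_add _ _ _ _ _
  conv_lhs => rw [word_eq]
  rw [h, com_eps, com_conv]
  congr 2
  funext l
  exact (com_comp F letter one l).trans (by rw [com_one hF])

lemma one_map (σ : A →ₗ[ℂ] A) (l : List A) : one (l.map σ) = σ (one l) := by
  match l with
  | [] => exact (map_zero σ).symm
  | [a] => rfl
  | a :: a' :: l => exact (map_zero σ).symm

lemma com_letter {F : List A → A} (f : List A → A) (L : A →ₗ[ℂ] A) (l : List A) :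
    com F (fun l => letter (L (f l))) l = letter (L (com F f l)) :=
  com_comp F (letter ∘ₗ L) f l

variable {σ : A →ₗ[ℂ] A}

/-- The comparison of `F ∘ b̂` with `b' ∘ F̂`. -/
lemma com_ins_word {b b' F : List A → A} (hb0' : b' [] = 0) (hF0 : F [] = 0)
    (hFσ : ∀ l, F (l.map σ) = σ (F l)) (l : List A) :
    com F (ins σ b' word) l - ins σ b (com F word) l =
      conv (fun l => letter (com F b' l - ins σ b F l)) (com F word) l +
      conv (fun l => letter (σ (F l)))
        (fun l => com F (ins σ b' word) l - ins σ b (com F word) l) l := by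
  have hadd : ∀ (l) (φ ψ : List A → WordRing A),
      com F (fun l => φ l + ψ l) l = com F φ l + com F ψ l := by
    intro l φ ψ
    cases l with
    | nil => rfl
    | cons a l => exact blk_add _ _ _ _ _
  -- Both orders of composition satisfy recursions with the same factor σ ∘ F. Only their source
  -- terms differ, and that difference is the defect.
  have h1 : com F (ins σ b' word) l = conv (fun l => letter (com F b' l)) (com F word) l +
      conv (fun l => letter (σ (F l))) (com F (ins σ b' word)) l := by
    conv_lhs => rw [show ins σ b' (word : List A → WordRing A) = fun l => _ from
      funext fun l => ins_word σ hb0' l]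
    rw [hadd, com_conv, com_conv]
    congr 2
    · funext l; exact com_letter b' LinearMap.id l
    · funext l
      rw [show (fun l => letter (one (List.map σ l))) = fun l => letter (σ (one l)) from
        funext fun l => by rw [one_map], com_letter, com_one hF0]
  have h2 : ins σ b (com F word) l = conv (fun l => letter (ins σ b F l)) (com F word) l +
      conv (fun l => letter (σ (F l))) (ins σ b (com F word)) l := by
    conv_lhs => rw [show com F (word : List A → WordRing A) = fun l => _ from
      funext fun l => com_word hF0 l]
    rw [ins_add, ins_eps, zero_add, ins_conv]
    simp only [hFσ]
    congr 2
    funext l; exact ins_comp σ b letter F l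
  conv_lhs => rw [h1, h2]
  simp only [map_sub]
  rw [conv_sub_left (fun l => letter (com F b' l)), conv_sub_right]
  abel

/-- If `b` is an `A_∞`-structure then the associated coderivation squares to zero. -/
lemma ins_ins {b f : List A → A} (hb0 : b [] = 0) (hσ : ∀ a, σ (σ a) = a)
    (hbσ : ∀ l, b (l.map σ) = -σ (b l)) (hbb : ∀ l, ins σ b b l = 0) (hf : ML f) (l : List A) :
    ins σ b (ins σ b f) l = 0 := by
  -- The recursion for the square has no source: the term with `b` inserted into `b` vanishes, and
  -- the two mixed terms cancel because `b` anticommutes with σ. Induction on the length then gives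
  -- zero.
  have hY : ∀ l : List A, ins σ b (ins σ b word) l =
      conv (fun l => letter (one l)) (ins σ b (ins σ b word)) l := by
    intro l
    conv_lhs => rw [show ins σ b (word : List A → WordRing A) = fun l => _ from
      funext fun l => ins_word σ hb0 l]
    rw [ins_add, ins_conv, ins_conv]
    have e1 : ins σ b (fun l => letter (b l)) = fun _ => 0 := by
      funext l; exact (ins_comp σ b letter b l).trans (by rw [hbb, map_zero])
    have e2 : ins σ b (fun l => letter (one (l.map σ))) = fun l => letter (σ (b l)) := by
      funext l
      simp only [one_map]
      exact (ins_comp σ b (letter ∘ₗ σ) one l).trans (by rw [ins_one σ hb0]; rfl)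
    have e3 : (fun l : List A => letter (one ((l.map σ).map σ))) = fun l => letter (one l) := by
      funext l; rw [one_map, one_map, hσ]
    rw [e1, e2]
    simp only [hbσ]
    have e4 : ∀ ψ : List A → WordRing A, conv (fun _ : List A => (0 : WordRing A)) ψ l = 0 := by
      intro ψ; simp [conv_eq_sum]
    have e5 : ∀ ψ : List A → WordRing A, conv (fun l => letter (-σ (b l))) ψ l =
        - conv (fun l => letter (σ (b l))) ψ l := by
      intro ψ; simp [conv_eq_sum]
    rw [e4, e5, e3]
    abel
  have hY0 : ∀ (n : ℕ) (l : List A), l.length = n →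
      ins σ b (ins σ b (word : List A → WordRing A)) l = 0 := by
    intro n
    induction n using Nat.strong_induction_on with
    | _ n ih =>
      intro l hl
      rw [hY]
      have h0 : (one : List A → A) [] = 0 := rfl
      exact conv_vanish (by rw [h0, map_zero]) hl.le fun l' hl' => ih _ hl' l' rfl
  -- Evaluating words on f transfers the universal identity to f.
  have h := hY0 _ l rfl
  have := congrArg (evalWord f hf) h
  rw [map_zero, ← ins_comp σ b (evalWord f hf)] at this
  rw [← this]
  congr 1
  funext l
  rw [← ins_comp σ b (evalWord f hf)]
  congr 1
  funext l
  rw [evalWord_word]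

end Words

/-! ### The defect of a partial A∞-homomorphism. -/

section Obstruction

variable {A : Type*} [Ring A] [Algebra ℂ A] {T : Type*}
  {R : Subalgebra ℂ A} {𝒜 : ℤ → Submodule ℂ A} {ρ : T → A →ₗ[ℂ] A} {σ : A →ₗ[ℂ] A}

/-- The conditions of `AInfStructure`, for functions on lists. -/
structure IsAInf (𝒜 : ℤ → Submodule ℂ A) (R : Subalgebra ℂ A) (ρ : T → A →ₗ[ℂ] A)
    (σ : A →ₗ[ℂ] A) (b : List A → A) : Prop where
  good : Good 𝒜 R ρ 2 b
  sq : ∀ l, ins σ b b l = 0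
  one : ∀ x, b [x] = 0
  two : ∀ x y, b [x, y] = -(y * σ x)
  sign : ∀ l, b (l.map σ) = -σ (b l)

/-- The failure of `F` to be an `A_∞`-homomorphism. -/
def defect (σ : A → A) (b b' F : List A → A) (l : List A) : A := com F b' l - ins σ b F l

lemma Good.defect (hσ : IsSign 𝒜 R ρ σ) {b b' F : List A → A} (hb : Good 𝒜 R ρ 2 b)
    (hb' : Good 𝒜 R ρ 2 b') (hF : Good 𝒜 R ρ 1 F) : Good 𝒜 R ρ 2 (defect σ b b' F) :=
  (hF.com hb').sub (hb.ins hσ hF)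

lemma com_word_single {F : List A → A} (hF0 : F [] = 0) (x : A) :
    com F word [x] = letter (F [x]) := by
  rw [com_word hF0]
  have h : com F (word : List A → WordRing A) [] = 1 := rfl
  simp [conv, hF0, h, eps]

/-- Write b̂, b̂' for the coderivations, F̂ for the coalgebra map and D for the defect. Applying b'
to b̂' F̂ - F̂ b̂ gives -D b̂, since b' b̂' = 0 and b̂ b̂ = 0. By `low_order` the left side only
involves the arity two part of b' in the first relevant length. The outcome is the cocycle equation
for the lowest order part of D. -/
lemma ins_defect (hσσ : ∀ a, σ (σ a) = a) {b b' F : List A → A} (hb : IsAInf 𝒜 R ρ σ b)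
    (hb' : IsAInf 𝒜 R ρ σ b')
    (hF : ML F) (hF0 : F [] = 0) (hF1 : ∀ x, F [x] = x) (hFσ : ∀ l, F (l.map σ) = σ (F l)) {d : ℕ}
    (hD : ∀ l : List A, l.length < d → defect σ b b' F l = 0) (a x : A) (l : List A)
    (hl : (a :: l).length = d) :
    ins σ b (defect σ b b' F) (a :: (l ++ [x])) =
      x * σ (defect σ b b' F (a :: l)) + defect σ b b' F (l ++ [x]) * a := by
  have h := (low_order letter (D := defect σ b b' F) (κ := fun l => σ (F l)) (H := com F word)
    (Y := fun l => com F (ins σ b' word) l - ins σ b (com F word) l)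
    (com_ins_word hb'.good.nil hF0 hFσ)
    (by rw [hF0, map_zero]) rfl (fun x => by rw [com_word_single hF0, hF1]) hD).2 a x l hl
  have h' := congrArg (evalWord b' hb'.good.ml) h
  rw [map_sub, ← com_comp F (evalWord b' hb'.good.ml), ← ins_comp σ b (evalWord b' hb'.good.ml),
    map_add, map_add] at h'
  have e1 : (fun l => evalWord b' hb'.good.ml (ins σ b' word l)) = fun _ => 0 := by
    funext l
    rw [← ins_comp σ b' (evalWord b' hb'.good.ml), ← hb'.sq l]
    congr 1
    funext l; exact evalWord_word _ l
  have e2 : (fun l => evalWord b' hb'.good.ml (com F word l)) =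
      fun l => defect σ b b' F l + ins σ b F l := by
    funext l
    rw [← com_comp F (evalWord b' hb'.good.ml), defect, sub_add_cancel]
    congr 1
    funext l; exact evalWord_word _ l
  have e3 : com F (fun _ => (0 : A)) (a :: (l ++ [x])) = 0 := by
    exact blk_of_vanish F (fun _ _ => rfl) _ _
  rw [e1, e2, e3, ins_add, ins_ins hb.good.nil hσσ hb.sign hb.sq hF, add_zero, evalWord_letter,
    evalWord_letter_mul, evalWord_letter_mul, evalWord_letter, evalWord_letter, hb'.one, hb'.two,
    hb'.two, hF1, hσσ] at h'
  rw [← sub_eq_zero, ← neg_eq_zero, ← sub_eq_zero.mpr h']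
  simp only [defect]
  abel

lemma com_add_word {F g : List A → A} (hF0 : F [] = 0) (hg0 : g [] = 0) (l : List A) :
    com (fun l => F l + g l) word l - com F word l =
      conv (fun l => letter (g l)) (com (fun l => F l + g l) word) l +
      conv (fun l => letter (F l))
        (fun l => com (fun l => F l + g l) word l - com F word l) l := by
  conv_lhs => rw [com_word (F := fun l => F l + g l) (by simp [hF0, hg0]), com_word hF0]
  simp only [map_add]
  rw [conv_add_left (fun l => letter (F l)), conv_sub_right]
  abel

/-- The difference of the coalgebra maps of F + g and F satisfies a recursion with source g, so to
lowest order b' sees only the products of g with one outer entry. Together with the insertion of `b`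
into g these form the Hochschild differential of g. -/
lemma defect_add {b b' F g : List A → A} (hb' : IsAInf 𝒜 R ρ σ b')
    (hF0 : F [] = 0) (hF1 : ∀ x, F [x] = x) (hg1 : ∀ x, g [x] = 0) {d : ℕ}
    (hg : ∀ l : List A, l.length < d → g l = 0) (hd : 0 < d) :
    (∀ l : List A, l.length ≤ d → defect σ b b' (fun l => F l + g l) l =
      defect σ b b' F l - ins σ b g l) ∧
    ∀ (a x : A) (l : List A), (a :: l).length = d →
      defect σ b b' (fun l => F l + g l) (a :: (l ++ [x])) = defect σ b b' F (a :: (l ++ [x]))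
      - x * σ (g (a :: l)) - g (l ++ [x]) * σ a - ins σ b g (a :: (l ++ [x])) := by
  have hg0 : g [] = 0 := hg [] hd
  have h := low_order letter (D := g) (κ := F) (H := com (fun l => F l + g l) word)
    (Y := fun l => com (fun l => F l + g l) word l - com F word l) (com_add_word hF0 hg0) hF0 rfl
    (fun x => by rw [com_word_single (by simp [hF0, hg0]), hF1, hg1, add_zero]) hg
  have key : ∀ l, defect σ b b' (fun l => F l + g l) l = defect σ b b' F l - ins σ b g l +
      evalWord b' hb'.good.ml (com (fun l => F l + g l) word l - com F word l) := by
    intro l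
    rw [map_sub, ← com_comp F (evalWord b' hb'.good.ml),
      ← com_comp (fun l => F l + g l) (evalWord b' hb'.good.ml)]
    have e : (fun l => evalWord b' hb'.good.ml (word l)) = b' := funext fun l => evalWord_word _ l
    rw [e]
    simp only [defect, ins_add]
    abel
  refine ⟨fun l hl => ?_, fun a x l hl => ?_⟩
  · rw [key, h.1 l hl, evalWord_letter, hb'.one, add_zero]
  · rw [key, h.2 a x l hl, map_add, map_add, evalWord_letter,
      evalWord_letter_mul, evalWord_letter_mul, evalWord_letter, evalWord_letter, hb'.one, hb'.two,
      hb'.two, hF1]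
    abel

end Obstruction

/-! ### Obstruction classes in Hochschild cohomology. -/

section Gauge

variable {A : Type*} [Ring A] [Algebra ℂ A] {T : Type*}
  {R : Subalgebra ℂ A} {𝒜 : ℤ → Submodule ℂ A} {ρ : T → A →ₗ[ℂ] A} {σ : A →ₗ[ℂ] A}

lemma ML.eq_zero_of_homList (hspan : ⨆ p, 𝒜 p = ⊤) {Z : Type*} [AddCommGroup Z] [Module ℂ Z]
    {f : List A → Z} (hf : ML f) {n : ℕ}
    (h : ∀ l q, HomList 𝒜 l q → l.length = n → f l = 0) (l : List A) (hl : l.length = n) :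
    f l = 0 := by
  induction l generalizing f n with
  | nil => exact h [] 0 HomList.nil hl
  | cons a l ih =>
    have h1 : ⨆ p, 𝒜 p ≤ LinearMap.ker (hf.headMap l) := by
      refine iSup_le fun p a' ha' => ?_
      exact ih (hf.cons a') (n := l.length)
        (fun l' q hl' hn => h _ _ (hl'.cons ha') (by simpa [hn] using hl)) rfl
    exact h1 (hspan ▸ Submodule.mem_top)

/-- Both sides are multilinear, so homogeneous entries suffice; there the two sign exponents differ
by 2(c - 1). -/
lemma Good.sign (hσ : IsSign 𝒜 R ρ σ) (hspan : ⨆ p, 𝒜 p = ⊤) {c : ℤ} {f : List A → A}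
    (hf : Good 𝒜 R ρ c f) (l : List A) : f (l.map σ) = sgn (c - 1) • σ (f l) := by
  have h : ML fun l => f (l.map σ) - ((sgn (c - 1) : ℤ) : ℂ) • σ (f l) :=
    (hf.ml.map σ).sub ((hf.ml.comp σ).smul _)
  have := h.eq_zero_of_homList hspan (n := l.length) (fun l q hl _ => ?_) l rfl
  · rwa [sub_eq_zero, Int.cast_smul_eq_zsmul] at this
  · have h1 := hσ.map_sign hf.ml hl []
    rw [List.append_nil, List.append_nil] at h1
    rw [h1, hσ.apply _ _ (hf.deg l q hl), Int.cast_smul_eq_zsmul, smul_smul, ← sgn_add, sub_eq_zero]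
    congr 1
    unfold sgn
    rw [show c - 1 + (q + c - 1) = q + 2 * (c - 1) by ring, Int.negOnePow_add,
      Int.negOnePow_two_mul, mul_one]

/-- The quadratic part of an `A_∞`-structure. -/
def quad (σ : A → A) : List A → A
  | [x, y] => -(y * σ x)
  | _ => 0

lemma quad_of_length {l : List A} (h : l.length ≠ 2) : quad σ l = 0 := by
  match l, h with
  | [], _ => rfl
  | [_], _ => rfl
  | [_, _], h => simp at h
  | _ :: _ :: _ :: _, _ => rfl

lemma ins_eq_zero {b φ : List A → A} (hb : ∀ x, b [x] = 0) (hφ : ML φ) {s : ℕ}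
    (h : ∀ l : List A, l.length < s → φ l = 0) {l : List A} (hl : l.length ≤ s) :
    ins σ b φ l = 0 := by
  rw [ins_eq_sum]
  refine Finset.sum_eq_zero fun i hi => Finset.sum_eq_zero fun e he => ?_
  rw [Finset.mem_range] at hi he
  rcases Nat.eq_zero_or_pos e with rfl | he'
  · obtain ⟨x, hx⟩ : ∃ x, (l.drop i).take (0 + 1) = [x] :=
      List.length_eq_one_iff.mp (by simp; omega)
    rw [hx, hb, hφ.map_zero]
  · exact h _ (by simp; omega)

/-- Insertion of `b` on a single entry gives zero, and insertion on three or more entries leaves a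
list too short for φ. -/
lemma ins_eq_ins_quad {b φ : List A → A} (hb : IsAInf 𝒜 R ρ σ b) {s : ℕ}
    (h : ∀ l : List A, l.length < s → φ l = 0) {l : List A} (hl : l.length = s + 1) :
    ins σ b φ l = ins σ (quad σ) φ l := by
  rw [ins_eq_sum, ins_eq_sum]
  refine Finset.sum_congr rfl fun i hi => Finset.sum_congr rfl fun e he => ?_
  rw [Finset.mem_range] at hi he
  rcases e with _ | _ | e
  · obtain ⟨x, hx⟩ : ∃ x, (l.drop i).take (0 + 1) = [x] :=
      List.length_eq_one_iff.mp (by simp; omega)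
    rw [hx, hb.one]; rfl
  · obtain ⟨x, y, hx⟩ : ∃ x y, (l.drop i).take (0 + 1 + 1) = [x, y] :=
      List.length_eq_two.mp (by simp; omega)
    rw [hx, hb.two]; rfl
  · rw [h _ (by simp; omega), h _ (by simp; omega)]

/-- The two outer multiplications are kept apart, while all inner ones are collected into an
insertion of `quad`. Here f is extended by zero to lists of other lengths. -/
lemma hochschildDifferential_eq (hσ : IsSign 𝒜 R ρ σ) {s : ℕ} (f : Multi A s) (t : ℤ)
    (p : ℕ → ℤ) {a x : A} {m : List A} (hm : (a :: m).length = s)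
    (h : ∀ n < s + 1, seq (a :: (m ++ [x])) n ∈ 𝒜 (p n)) :
    hochschildDifferential t f p (seq (a :: (m ++ [x]))) =
      sgn ((∑ n ∈ Finset.range s, p n) + t) • (x * toL (Pi.single s f) (a :: m))
      + sgn ((s + t - 1) * (p 0 - 1)) • sgn (p 0) • (toL (Pi.single s f) (m ++ [x]) * a)
      + sgn (s + t) • ins σ (quad σ) (toL (Pi.single s f)) (a :: (m ++ [x])) := by
  set l := a :: (m ++ [x]) with hl
  have hlen : l.length = s + 1 := by simp [hl, ← hm]
  have hs : seq l s = x := by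
    have := seq_mid (a :: m) [] x
    rwa [hm] at this
  have h0 : seq l 0 = a := rfl
  have h1 : app f (seq l) = toL (Pi.single s f) (a :: m) := by
    rw [toL_single f hm]
    refine app_congr f fun n hn => ?_
    simp only [seq, hl, ← List.cons_append]
    exact List.getD_append _ _ _ _ (by omega)
  have h2 : app f (fun n => seq l (n + 1)) = toL (Pi.single s f) (m ++ [x]) := by
    rw [toL_single f (by simpa using hm)]
    exact app_congr f fun n hn => rfl
  unfold hochschildDifferential
  rw [hs, h0, h1, h2]
  congr 2
  rw [ins_eq_sum, hlen, Finset.sum_range_succ]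
  -- A block starting at the last position has a single entry, whereas `quad` needs two.
  have e0 : ∑ e ∈ Finset.range (s + 1 - s), toL (Pi.single s f)
      ((l.take s).map σ ++ quad σ ((l.drop s).take (e + 1)) :: l.drop (s + (e + 1))) = 0 := by
    refine Finset.sum_eq_zero fun e he => ?_
    rw [quad_of_length (by simp; omega), (ML.toL _).map_zero]
  rw [e0, add_zero]
  refine Finset.sum_congr rfl fun i hi => ?_
  rw [Finset.mem_range] at hi
  refine Eq.trans ?_ (Finset.sum_eq_single_of_mem 1 (Finset.mem_range.mpr (by omega)) ?_).symm
  · rw [hσ.map_sign (ML.toL _) (homList_take (p := p) (fun n hn => h n (by omega)) (by omega)),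
      toL_splice _ (by omega) (by omega), show l.length + 1 - (1 + 1) = s by omega,
      Pi.single_eq_same]
    congr 3
    have e1 : (l.drop i).take (1 + 1) = [seq l i, seq l (i + 1)] := by
      have hi1 : i < l.length := by omega
      have hi2 : i + 1 < l.length := by omega
      rw [List.drop_eq_getElem_cons hi1, List.drop_eq_getElem_cons hi2]
      simp only [seq, List.getD_eq_getElem _ _ hi1, List.getD_eq_getElem _ _ hi2]
      rfl
    rw [e1, quad, hσ.apply _ _ (h i (by omega))]
    have : sgn (p i - 1) = - sgn (p i) := by
      simp [sgn, Int.negOnePow_sub]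
    rw [this, neg_smul, mul_neg, neg_neg, mul_smul_comm]
  · intro e he hne
    rw [Finset.mem_range] at he
    rw [quad_of_length (by simp; omega), (ML.toL _).map_zero]

lemma HomList.exists_seq {l : List A} {q : ℤ} (h : HomList 𝒜 l q) :
    ∃ p : ℕ → ℤ, ∀ n, seq l n ∈ 𝒜 (p n) := by
  induction h with
  | nil => exact ⟨fun _ => 0, fun n => by simp [seq]⟩
  | @cons a l p q ha hl ih =>
    obtain ⟨P, hP⟩ := ih
    refine ⟨fun n => n.casesOn p P, fun n => ?_⟩
    cases n with
    | zero => exact ha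
    | succ n => exact hP n

lemma homList_seq {l : List A} {p : ℕ → ℤ} (h : ∀ n < l.length, seq l n ∈ 𝒜 (p n)) :
    HomList 𝒜 l (∑ n ∈ Finset.range l.length, (p n - 1)) := by
  simpa using homList_take h le_rfl

lemma exists_cons_append {l : List A} {n : ℕ} (h : l.length = n + 2) :
    ∃ a m x, l = a :: (m ++ [x]) ∧ m.length = n := by
  cases l with
  | nil => simp at h
  | cons a l =>
    have : l ≠ [] := by rintro rfl; simp at h
    refine ⟨a, l.dropLast, l.getLast this, by rw [List.dropLast_append_getLast], ?_⟩
    simp at h ⊢; omega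

lemma hochschildDifferential_congr {s : ℕ} (t : ℤ) (f : Multi A s) (p : ℕ → ℤ) {a a' : ℕ → A}
    (h : ∀ n < s + 1, a n = a' n) :
    hochschildDifferential t f p a = hochschildDifferential t f p a' := by
  unfold hochschildDifferential
  rw [h s (by omega), h 0 (by omega), app_congr f (a := a) (a' := a') fun n hn => h n (by omega),
    app_congr f (a := fun n => a (n + 1)) (a' := fun n => a' (n + 1)) fun n hn => h _ (by omega)]
  congr 2
  refine Finset.sum_congr rfl fun i hi => ?_
  rw [Finset.mem_range] at hi
  congr 1
  refine app_congr f fun n hn => ?_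
  unfold splice
  split_ifs
  · exact h _ (by omega)
  · rw [h i (by omega), h (i + 1) (by omega)]
  · exact h _ (by omega)

/-- `F` is an `A_∞`-homomorphism up to order `n`, with linear part the identity. -/
structure IsPartialHom (𝒜 : ℤ → Submodule ℂ A) (R : Subalgebra ℂ A) (ρ : T → A →ₗ[ℂ] A)
    (σ : A →ₗ[ℂ] A) (b b' F : List A → A) (n : ℕ) : Prop where
  good : Good 𝒜 R ρ 1 F
  one : ∀ x, F [x] = x
  defect : ∀ l : List A, l.length ≤ n → defect σ b b' F l = 0

lemma sgn_eq_one {n : ℤ} (h : Even n) : sgn n = 1 := by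
  simp [sgn, Int.negOnePow_even n h]

lemma sgn_eq_neg_one {n : ℤ} (h : Odd n) : sgn n = -1 := by
  simp [sgn, Int.negOnePow_odd n h]

lemma sgn_sub_one (n : ℤ) : sgn (n - 1) = - sgn n := by
  simp [sgn, Int.negOnePow_sub]

lemma sgn_mul_self (n : ℤ) : sgn n * sgn n = 1 := by
  rw [← sgn_add]; exact sgn_eq_one ⟨n, rfl⟩

variable {b b' F : List A → A}

/-- The identity `ins_defect` is already the cocycle equation. It remains to match signs, using that
arity plus degree of the cochain is 2. -/
lemma IsPartialHom.mem_cocycles (hσ : IsSign 𝒜 R ρ σ) (hspan : ⨆ p, 𝒜 p = ⊤)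
    (hb : IsAInf 𝒜 R ρ σ b) (hb' : IsAInf 𝒜 R ρ σ b') {n : ℕ}
    (hF : IsPartialHom 𝒜 R ρ σ b b' F n) {f : Multi A (n + 1)}
    (hf : ∀ l : List A, l.length = n + 1 → app f (seq l) = SeidelQ.defect σ b b' F l)
    (hfm : f ∈ cochains 𝒜 R ρ (n + 1) (2 - (n + 1 : ℕ))) :
    f ∈ cocycles 𝒜 R ρ (n + 1) (2 - (n + 1 : ℕ)) := by
  have hDg : Good 𝒜 R ρ 2 (SeidelQ.defect σ b b' F) := Good.defect hσ hb.good hb'.good hF.good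
  have hFσ : ∀ l, F (l.map σ) = σ (F l) := by
    intro l; simpa [sgn] using hF.good.sign hσ hspan l
  refine ⟨hfm, fun p a ha => ?_⟩
  rw [hochschildDifferential_congr (a' := seq (List.ofFn fun i : Fin (n + 1 + 1) => a i))]
  swap
  · intro k hk; rw [seq_ofFn a hk]
  have hl : (List.ofFn fun i : Fin (n + 1 + 1) => a i).length = n + 2 := by simp
  have hp : ∀ k < n + 1 + 1, seq (List.ofFn fun i : Fin (n + 1 + 1) => a i) k ∈ 𝒜 (p k) := by
    intro k hk; rw [seq_ofFn a hk]; exact ha k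
  obtain ⟨a0, m, x, e, hm⟩ := exists_cons_append hl
  rw [e] at hp ⊢
  rw [hochschildDifferential_eq hσ f _ p (by simp [hm]) hp]
  have hE : ∀ l : List A, l.length = n + 1 →
      toL (Pi.single (n + 1) f) l = SeidelQ.defect σ b b' F l := fun l hl => by
    rw [toL_single f hl, hf l hl]
  have hins : ins σ (quad σ) (toL (Pi.single (n + 1) f)) (a0 :: (m ++ [x])) =
      ins σ b (SeidelQ.defect σ b b' F) (a0 :: (m ++ [x])) := by
    rw [ins_eq_ins_quad hb (s := n + 1)
      (fun l hl => hF.defect l (by omega)) (by simp [hm]), ins_eq_sum, ins_eq_sum]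
    refine Finset.sum_congr rfl fun i hi => Finset.sum_congr rfl fun j hj => ?_
    rw [Finset.mem_range] at hi hj
    by_cases hj1 : j = 1
    · subst hj1
      refine hE _ ?_
      simp [hm] at hi hj ⊢; omega
    · rw [quad_of_length (by simp at hi hj ⊢; omega), (ML.toL _).map_zero, hDg.ml.map_zero]
  rw [hins, hE _ (by simp [hm]), hE _ (by simp [hm]),
    ins_defect hσ.invol hb hb' hF.good.ml hF.good.nil hF.one hFσ (d := n + 1)
      (fun l hl => hF.defect l (by omega)) a0 x m (by simp [hm])]
  have hd := hDg.deg _ _ (homList_take (p := p) (l := a0 :: (m ++ [x])) (i := n + 1)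
    (fun k hk => hp k (by simpa [hm] using hk)) (by simp [hm]))
  have e2 : (a0 :: (m ++ [x])).take (n + 1) = a0 :: m := by
    rw [← List.cons_append, List.take_append_of_le_length (by simp [hm])]
    exact List.take_of_length_le (by simp [hm])
  rw [e2] at hd
  rw [hσ.apply _ _ hd]
  have s1 : sgn (((n + 1 : ℕ) + (2 - (n + 1 : ℕ)) : ℤ)) = 1 := sgn_eq_one ⟨1, by ring⟩
  have s2 : (((n + 1 : ℕ) + (2 - (n + 1 : ℕ)) - 1 : ℤ)) = 1 := by ring
  have s3 : ∑ k ∈ Finset.range (n + 1), (p k - 1) + 2 - 1 =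
      ∑ k ∈ Finset.range (n + 1), p k + (2 - (n + 1 : ℕ)) - 1 := by
    rw [Finset.sum_sub_distrib]; simp; ring
  rw [s1, s2, s3, sgn_sub_one, one_mul, sgn_sub_one, smul_smul, neg_mul, sgn_mul_self,
    mul_smul_comm]
  simp
  abel

/-- A primitive of the defect, with the correct sign, is added to F in arity n. This cancels the
defect in arity n + 1 and creates none below. -/
lemma IsPartialHom.extend (hσ : IsSign 𝒜 R ρ σ) (hspan : ⨆ p, 𝒜 p = ⊤)
    (hb : IsAInf 𝒜 R ρ σ b) (hb' : IsAInf 𝒜 R ρ σ b') {n : ℕ} (hn : 2 ≤ n)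
    (hF : IsPartialHom 𝒜 R ρ σ b b' F n) {f : Multi A (n + 1)}
    (hf : ∀ l : List A, l.length = n + 1 → app f (seq l) = SeidelQ.defect σ b b' F l)
    (hfm : f ∈ coboundaries 𝒜 R ρ n (2 - (n + 1 : ℕ))) :
    ∃ F', IsPartialHom 𝒜 R ρ σ b b' F' (n + 1) ∧ ∀ l : List A, l.length < n → F' l = F l := by
  -- By `defect_add`, adding g to F adds the differential of g to the defect, so g must be a
  -- primitive of -f.
  obtain ⟨-, g, hg, hgf⟩ := Submodule.neg_mem _ hfm
  set G := toL (Pi.single n g) with hG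
  have hGg : Good 𝒜 R ρ 1 G := by
    refine Good.toL (by rw [Pi.single_eq_of_ne (by omega)]) fun d hd => ?_
    rcases eq_or_ne d n with rfl | h
    · rw [Pi.single_eq_same]
      convert hg using 2; push_cast; ring
    · rw [Pi.single_eq_of_ne h]; exact zero_mem _
  have hG0 : ∀ l : List A, l.length ≠ n → G l = 0 := fun l hl => toL_single_of_ne g hl
  have hF'g : Good 𝒜 R ρ 1 fun l => F l + G l := hF.good.add hGg
  have hda := defect_add (d := n) (b := b) hb' hF.good.nil hF.one (g := G)
    (fun x => hG0 _ (by simp; omega)) (fun l hl => hG0 l (by omega)) (by omega)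
  refine ⟨fun l => F l + G l, ⟨hF'g, fun x => ?_, fun l hl => ?_⟩, fun l hl => ?_⟩
  · rw [hG0 _ (by simp; omega), add_zero, hF.one]
  · rcases Nat.lt_or_ge n l.length with hl' | hl'
    · refine (Good.defect hσ hb.good hb'.good hF'g).ml.eq_zero_of_homList hspan (n := n + 1)
        (fun l q hlq hl => ?_) l (by omega)
      obtain ⟨p, hp⟩ := hlq.exists_seq
      have key := hgf p (seq l) hp
      obtain ⟨k, rfl⟩ : ∃ k, n = k + 1 := ⟨n - 1, by omega⟩
      obtain ⟨a0, m, x, rfl, hm⟩ := exists_cons_append hl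
      rw [hochschildDifferential_eq hσ g _ p (by simp [hm]) (fun k _ => hp k)] at key
      have e1 : app (-f) (seq (a0 :: (m ++ [x]))) =
          - SeidelQ.defect σ b b' F (a0 :: (m ++ [x])) := by
        rw [← hf _ (by simp [hm])]; rfl
      rw [e1, ← hG, ← ins_eq_ins_quad hb (s := k + 1) (fun l hl => hG0 l (by omega))
        (by simp [hm])] at key
      have hd := hGg.deg _ _ (homList_take (p := p) (l := a0 :: (m ++ [x])) (i := k + 1)
        (fun k hk => hp k) (by simp [hm]))
      have e2 : (a0 :: (m ++ [x])).take (k + 1) = a0 :: m := by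
        rw [← List.cons_append, List.take_append_of_le_length (by simp [hm])]
        exact List.take_of_length_le (by simp [hm])
      rw [e2] at hd
      -- The correction has arity plus degree equal to 1, which fixes the signs in its differential.
      have s1 : sgn (((k + 1 : ℕ) + (2 - (k + 1 + 1 : ℕ)) : ℤ)) = -1 :=
        sgn_eq_neg_one ⟨0, by push_cast; ring⟩
      have s2 : (((k + 1 : ℕ) + (2 - (k + 1 + 1 : ℕ)) - 1 : ℤ)) = 0 := by push_cast; ring
      have s3 : ∑ k ∈ Finset.range (k + 1), (p k - 1) + 1 - 1 =
          ∑ k ∈ Finset.range (k + 1), p k + (2 - (k + 1 + 1 : ℕ)) - 1 := by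
        rw [Finset.sum_sub_distrib]; simp; ring
      have s4 : sgn (0 * (p 0 - 1)) = 1 := by simp [sgn]
      rw [s1, s2, s4, one_smul] at key
      rw [hda.2 a0 x m (by simp [hm]), hσ.apply _ _ hd, s3, hσ.apply _ _ (show a0 ∈ 𝒜 (p 0) from hp 0)]
      rw [sgn_sub_one, sgn_sub_one, ← neg_eq_zero, ← sub_eq_zero.mpr key]
      simp only [neg_smul, one_smul, mul_neg, mul_smul_comm]
      abel
    · rw [hda.1 l hl', hF.defect l hl', zero_sub, neg_eq_zero]
      exact ins_eq_zero hb.one hGg.ml (fun l hl => hG0 l (by omega)) hl'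
  · simp only [hG0 l (by omega), add_zero]

end Gauge

/-! ### Values on a list depend only on components of arity at most its length. -/

section Congr

variable {A : Type*} [Ring A] [Algebra ℂ A] {Z : Type*} [AddCommGroup Z] [Module ℂ Z]

lemma blk_congr {F F' : List A → A} (φ : List A → Z) {β β' : List A → A} (l : List A)
    (hF : ∀ w : List A, w.length ≤ l.length → F w = F' w)
    (hβ : ∀ w : List A, w.length ≤ l.length → β w = β' w) : blk F φ β l = blk F' φ β' l := by
  induction l generalizing φ β β' with
  | nil => simp [blk, hβ [] le_rfl]
  | cons a l ih =>
    rw [blk, blk, hβ [] (Nat.zero_le _)]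
    congr 1
    · exact ih _ (fun w hw => hF w (by simp; omega)) fun w hw => hβ _ (by simpa using hw)
    · exact ih _ (fun w hw => hF w (by simp; omega)) fun w hw => hF _ (by simpa using hw)

lemma com_congr {F F' : List A → A} (φ : List A → Z) (l : List A)
    (hF : ∀ w : List A, w.length ≤ l.length → F w = F' w) : com F φ l = com F' φ l := by
  cases l with
  | nil => rfl
  | cons a l =>
    exact blk_congr φ l (fun w hw => hF w (by simp; omega)) fun w hw => hF _ (by simpa using hw)

lemma ins_congr (σ : A → A) (b : List A → A) {φ φ' : List A → Z} (l : List A)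
    (h : ∀ w : List A, w.length ≤ l.length → φ w = φ' w) : ins σ b φ l = ins σ b φ' l := by
  rw [ins_eq_sum, ins_eq_sum]
  refine Finset.sum_congr rfl fun i hi => Finset.sum_congr rfl fun e he => h _ ?_
  rw [Finset.mem_range] at hi he
  simp
  omega

lemma blk_zero (F : List A → A) {φ : List A → Z} (hφ : ML φ) (l : List A) :
    blk F φ (fun _ => 0) l = 0 := by
  induction l generalizing φ F with
  | nil => exact hφ.map_zero [] []
  | cons a l ih =>
    rw [blk, ih _ hφ, zero_add]
    have : (fun w => φ (0 :: w)) = fun _ => 0 := funext fun w => hφ.map_zero [] w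
    rw [this, blk_of_vanish _ (fun _ _ => rfl)]

lemma com_one_left {φ : List A → Z} (hφ : ML φ) (l : List A) : com one φ l = φ l := by
  cases l with
  | nil => rfl
  | cons a l =>
    rw [com]
    induction l generalizing φ a with
    | nil => rfl
    | cons a' l ih =>
      rw [blk]
      have : (fun l => one (a :: a' :: l)) = fun _ => (0 : A) := rfl
      rw [this, blk_zero _ hφ, zero_add]
      exact ih (hφ.cons a) a'

lemma insertionSum_congr (f g : ∀ d : ℕ, Multi A d) (d : ℕ) (p : ℕ → ℤ) {a a' : ℕ → A}
    (h : ∀ n < d, a n = a' n) : insertionSum f g d p a = insertionSum f g d p a' := by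
  unfold insertionSum
  refine Finset.sum_congr rfl fun e he => Finset.sum_congr rfl fun i hi => ?_
  rw [Finset.mem_Icc] at he
  rw [Finset.mem_range] at hi
  congr 1
  refine app_congr _ fun n hn => ?_
  unfold splice
  split_ifs
  · exact h _ (by omega)
  · exact app_congr _ fun n hn => h _ (by omega)
  · exact h _ (by omega)

lemma partitionSum_congr (g f : ∀ d : ℕ, Multi A d) (d : ℕ) {a a' : ℕ → A}
    (h : ∀ n < d, a n = a' n) : partitionSum g f d a = partitionSum g f d a' := by
  unfold partitionSum
  refine Finset.sum_congr rfl fun c _ => ?_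
  congr 1
  funext k
  congr 1
  funext n
  exact h _ (c.embedding k n).2

end Congr

/-! ### Construction of gauge transformations arity by arity. -/

section GaugeExistence

variable {A : Type*} [Ring A] [Algebra ℂ A] {T : Type*}
  {R : Subalgebra ℂ A} {𝒜 : ℤ → Submodule ℂ A} {ρ : T → A →ₗ[ℂ] A} {σ : A →ₗ[ℂ] A}

lemma Good.one : Good 𝒜 R ρ 1 (one : List A → A) where
  ml u v x y c := by
    rcases u with _ | ⟨u, _ | ⟨u', us⟩⟩ <;> rcases v with _ | ⟨v, vs⟩ <;> simp [SeidelQ.one]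
  bal r hr u v x y := by
    rcases u with _ | ⟨u, us⟩ <;> simp [SeidelQ.one]
  last r hr u x := by
    rcases u with _ | ⟨u, _ | ⟨u', us⟩⟩ <;> simp [SeidelQ.one]
  head r hr x l := by
    rcases l with _ | ⟨u, us⟩ <;> simp [SeidelQ.one]
  deg l q hl := by
    cases hl with
    | nil => exact zero_mem _
    | @cons a l p q ha hl =>
      cases hl with
      | nil => simpa [SeidelQ.one] using ha
      | cons => exact zero_mem _
  eqv t l := by
    rcases l with _ | ⟨u, _ | ⟨u', us⟩⟩ <;> simp [SeidelQ.one]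
  nil := rfl

lemma defect_congr (σ : A → A) (b b' : List A → A) {F F' : List A → A} (l : List A)
    (h : ∀ w : List A, w.length ≤ l.length → F w = F' w) : defect σ b b' F l = defect σ b b' F' l := by
  rw [defect, defect, com_congr _ _ h, ins_congr _ _ _ h]

lemma AInfStructure.isAInf (hσ : IsSign 𝒜 R ρ σ) (hspan : ⨆ p, 𝒜 p = ⊤)
    (M : AInfStructure 𝒜 R ρ) : IsAInf 𝒜 R ρ σ (toL M.μ) := by
  have hg : Good 𝒜 R ρ 2 (toL M.μ) := Good.toL M.μ_zero fun d hd => M.μ_mem d hd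
  refine ⟨hg, fun l => ?_, fun x => ?_, fun x y => ?_, fun l => ?_⟩
  · refine (Good.ins hσ hg hg).ml.eq_zero_of_homList hspan (n := l.length) (fun w q hw _ => ?_) l rfl
    cases w with
    | nil => rfl
    | cons a w =>
      obtain ⟨p, hp⟩ := hw.exists_seq
      rw [← insertionSum_eq hσ _ _ _ p (fun n _ => hp n)]
      exact M.ainfty _ (by simp) p _ hp
  · change app (M.μ 1) _ = 0
    rw [M.μ_one]; rfl
  · let L : A →ₗ[ℂ] A := -((LinearMap.mulLeft ℂ y).comp σ)
    have h : ⨆ p, 𝒜 p ≤ LinearMap.eqLocus (hg.ml.headMap [y]) L := by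
      refine iSup_le fun p a ha => ?_
      change toL M.μ [a, y] = -(y * σ a)
      have e : toL M.μ [a, y] = M.μ 2 ![a, y] := by
        rw [← toL_ofFn M.μ 2 ![a, y]]; rfl
      rw [e, M.μ_two p a y ha, hσ.apply p a ha, sgn_sub_one, neg_smul, mul_neg, neg_neg,
        mul_smul_comm]
    have h' : x ∈ LinearMap.eqLocus (hg.ml.headMap [y]) L := h (hspan ▸ Submodule.mem_top)
    exact h'
  · rw [hg.sign hσ hspan]; simp [sgn]

/-- If the cubic terms of two `A_∞`-structures agree, the quartic terms differ by a cocycle. -/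
theorem AInfStructure.sub_mem_cocycles (hσ : IsSign 𝒜 R ρ σ) (hspan : ⨆ p, 𝒜 p = ⊤)
    (M N : AInfStructure 𝒜 R ρ) (h3 : M.μ 3 = N.μ 3) :
    IsPartialHom 𝒜 R ρ σ (toL M.μ) (toL N.μ) one 3 ∧
    (∀ l : List A, l.length = 4 → app (N.μ 4 - M.μ 4) (seq l) =
      defect σ (toL M.μ) (toL N.μ) one l) ∧
    N.μ 4 - M.μ 4 ∈ cocycles 𝒜 R ρ 4 (2 - (4 : ℕ)) := by
  have hM := M.isAInf hσ hspan
  have hN := N.isAInf hσ hspan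
  have key : ∀ l, defect σ (toL M.μ) (toL N.μ) one l = toL N.μ l - toL M.μ l := fun l => by
    rw [defect, com_one_left hN.good.ml, ins_one _ hM.good.nil]
  have h : IsPartialHom 𝒜 R ρ σ (toL M.μ) (toL N.μ) one 3 := by
    refine ⟨Good.one, fun _ => rfl, fun l hl => ?_⟩
    rw [key]
    rcases l with _ | ⟨x, _ | ⟨y, _ | ⟨z, _ | ⟨w, l⟩⟩⟩⟩
    · rw [hM.good.nil, hN.good.nil, sub_zero]
    · rw [hM.one, hN.one, sub_zero]
    · rw [hM.two, hN.two, sub_self]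
    · change app (N.μ 3) _ - app (M.μ 3) _ = 0
      rw [h3]; exact sub_self _
    · simp at hl; omega
  have h4 : ∀ l : List A, l.length = 4 → app (N.μ 4 - M.μ 4) (seq l) =
      defect σ (toL M.μ) (toL N.μ) one l := fun l hl => by
    rw [key, toL_eq _ hl, toL_eq _ hl]; rfl
  exact ⟨h, h4, h.mem_cocycles hσ hspan hM hN h4
    (sub_mem (N.μ_mem 4 (by norm_num)) (M.μ_mem 4 (by norm_num)))⟩

/-- The agreement in arities below n makes the successive extensions converge. -/
lemma IsPartialHom.exists_succ (hσ : IsSign 𝒜 R ρ σ) (hspan : ⨆ p, 𝒜 p = ⊤)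
    {b b' F : List A → A} (hb : IsAInf 𝒜 R ρ σ b) (hb' : IsAInf 𝒜 R ρ σ b') {n : ℕ} (hn : 2 ≤ n)
    (hF : IsPartialHom 𝒜 R ρ σ b b' F n)
    (hH : cocycles 𝒜 R ρ (n + 1) (2 - (n + 1 : ℕ)) ≤ coboundaries 𝒜 R ρ n (2 - (n + 1 : ℕ))) :
    ∃ F', IsPartialHom 𝒜 R ρ σ b b' F' (n + 1) ∧ ∀ l : List A, l.length < n → F' l = F l := by
  have hD : Good 𝒜 R ρ 2 (SeidelQ.defect σ b b' F) := Good.defect hσ hb.good hb'.good hF.good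
  have hf : ∀ l : List A, l.length = n + 1 →
      app (toMulti (n + 1) _ hD.ml) (seq l) = SeidelQ.defect σ b b' F l := fun l hl => by
    rw [app_toMulti, ← hl, ofFn_seq]
  exact hF.extend hσ hspan hb hb' hn hf
    (hH (hF.mem_cocycles hσ hspan hb hb' hf (hD.toMulti_mem _)))

/-- Two `A_∞`-structures whose difference of lowest order is a coboundary are gauge equivalent, if
the further obstruction groups vanish. -/
theorem AInfStructure.exists_gauge (hσ : IsSign 𝒜 R ρ σ) (hspan : ⨆ p, 𝒜 p = ⊤)
    (M N : AInfStructure 𝒜 R ρ) (h3 : M.μ 3 = N.μ 3)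
    (h4 : N.μ 4 - M.μ 4 ∈ coboundaries 𝒜 R ρ 3 (2 - (4 : ℕ)))
    (hH : ∀ n : ℕ, 4 ≤ n →
      cocycles 𝒜 R ρ (n + 1) (2 - (n + 1 : ℕ)) ≤ coboundaries 𝒜 R ρ n (2 - (n + 1 : ℕ))) :
    ∃ F : AInfHom M N, F.IsGauge := by
  have hM := M.isAInf hσ hspan
  have hN := N.isAInf hσ hspan
  obtain ⟨h0, h0', -⟩ := AInfStructure.sub_mem_cocycles hσ hspan M N h3
  obtain ⟨F4, hF4, -⟩ := h0.extend hσ hspan hM hN (by norm_num) h0' h4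
  choose! nxt hnxt hagree using fun (n : ℕ) (hn : 4 ≤ n) (F : List A → A)
    (hF : IsPartialHom 𝒜 R ρ σ (toL M.μ) (toL N.μ) F n) =>
    hF.exists_succ hσ hspan hM hN (by omega) (hH n hn)
  -- `S n` is a homomorphism up to order n + 4. Later extensions no longer change its values on
  -- lists shorter than n + 4, so taking the arity d component from `S d` gives a well defined
  -- limit.
  let S : ℕ → List A → A := fun n => Nat.rec F4 (fun k F => nxt (k + 4) F) n
  have hS : ∀ n, IsPartialHom 𝒜 R ρ σ (toL M.μ) (toL N.μ) (S n) (n + 4) := by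
    intro n
    induction n with
    | zero => exact hF4
    | succ n ih => exact hnxt (n + 4) (by omega) _ ih
  have hstep : ∀ n (l : List A), l.length < n + 4 → S (n + 1) l = S n l := fun n l hl =>
    hagree (n + 4) (by omega) _ (hS n) l hl
  have hstab : ∀ n k (l : List A), l.length < n + 4 → S (n + k) l = S n l := by
    intro n k l hl
    induction k with
    | zero => rfl
    | succ k ih => rw [← ih]; exact hstep (n + k) l (by omega)
  let F : ∀ d : ℕ, Multi A d := fun d => toMulti d (S d) (hS d).good.ml
  have hFS : ∀ n (l : List A), l.length ≤ n → toL F l = S n l := by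
    intro n l hl
    have e1 : toL F l = S l.length l := by
      change S l.length (List.ofFn fun i : Fin l.length => seq l i) = _
      rw [ofFn_seq]
    obtain ⟨k, rfl⟩ := Nat.exists_eq_add_of_le hl
    rw [e1, hstab _ _ _ (by omega)]
  have hF1 : ∀ x, toL F [x] = x := fun x => by
    rw [hFS 1 _ (by simp), (hS 1).one]
  refine ⟨⟨F, ?_, fun d hd => (hS d).good.toMulti_mem d, fun d hd p a ha => ?_⟩, fun x => ?_⟩
  · ext a
    change S 0 (List.ofFn a) = 0
    rw [List.ofFn_zero, (hS 0).good.nil]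
  · have hlen : (List.ofFn fun i : Fin d => a i).length = d := by simp
    have hcong : ∀ n < d, a n = seq (List.ofFn fun i : Fin d => a i) n := fun n hn =>
      (seq_ofFn a hn).symm
    have hdef : defect σ (toL M.μ) (toL N.μ) (toL F) (List.ofFn fun i : Fin d => a i) = 0 := by
      rw [defect_congr _ _ _ _ (F' := S d) fun w hw => hFS d w (by simpa using hw)]
      exact (hS d).defect _ (by simp)
    rw [partitionSum_congr _ _ _ hcong, insertionSum_congr _ _ _ _ hcong, partitionSum_eq _ _ _ hlen]
    have := insertionSum_eq hσ F M.μ (List.ofFn fun i : Fin d => a i) p fun n hn => by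
      rw [seq_ofFn a (by simpa using hn)]; exact ha n
    rw [hlen] at this
    rw [this, ← sub_eq_zero]
    exact hdef
  · exact hF1 x

end GaugeExistence

/-! ### Bar and Hochschild differentials without signs from gradings. -/

section Bar

variable {B Z Z' : Type*} [Ring B] [Algebra ℂ B] [AddCommGroup Z] [Module ℂ Z]
  [AddCommGroup Z'] [Module ℂ Z']

lemma ML.head_neg {f : List B → Z} (hf : ML f) (x : B) (l : List B) : f ((-x) :: l) = -f (x :: l) :=
  hf.map_neg [] l x

lemma ML.head_zero {f : List B → Z} (hf : ML f) (l : List B) : f (0 :: l) = 0 := hf.map_zero [] l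

lemma ML.head_smul {f : List B → Z} (hf : ML f) (c : ℂ) (x : B) (l : List B) :
    f ((c • x) :: l) = c • f (x :: l) := hf.map_smul [] l c x

lemma ML.head_add {f : List B → Z} (hf : ML f) (x y : B) (l : List B) :
    f ((x + y) :: l) = f (x :: l) + f (y :: l) := hf.map_add [] l x y

/-- The bar differential with values in `Z`, where the last entry acts on the value. -/
def bd (act : B →ₗ[ℂ] Z →ₗ[ℂ] Z) : (List B → Z) → List B → Z
  | _, [] => 0
  | f, [x] => act x (f [])
  | f, x :: y :: l => f ((y * x) :: l) - bd act (fun l => f (x :: l)) (y :: l)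

/-- The Hochschild differential (without gradings) with values in `Z`. -/
def cobd (act ract : B →ₗ[ℂ] Z →ₗ[ℂ] Z) (f : List B → Z) : List B → Z
  | [] => 0
  | x :: l => ract x (f l) - bd act f (x :: l)

variable (act ract : B →ₗ[ℂ] Z →ₗ[ℂ] Z)

@[simp] lemma bd_nil (f : List B → Z) : bd act f [] = 0 := rfl

@[simp] lemma bd_single (f : List B → Z) (x : B) : bd act f [x] = act x (f []) := rfl

lemma bd_cons_cons (f : List B → Z) (x y : B) (l : List B) :
    bd act f (x :: y :: l) = f ((y * x) :: l) - bd act (fun l => f (x :: l)) (y :: l) := rfl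

lemma bd_lin (c : ℂ) (f g : List B → Z) (l : List B) :
    bd act (fun l => c • f l + g l) l = c • bd act f l + bd act g l := by
  induction l generalizing f g with
  | nil => simp
  | cons x l ih =>
    cases l with
    | nil => simp
    | cons y l =>
      rw [bd_cons_cons, bd_cons_cons, bd_cons_cons, ih, smul_sub]
      abel

lemma bd_sub (f g : List B → Z) (l : List B) :
    bd act (fun l => f l - g l) l = bd act f l - bd act g l := by
  have := bd_lin act (-1) g f l
  simpa [neg_add_eq_sub] using this

lemma bd_congr {f g : List B → Z} (l : List B) (h : ∀ w : List B, w.length + 1 = l.length → f w = g w) :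
    bd act f l = bd act g l := by
  induction l generalizing f g with
  | nil => rfl
  | cons x l ih =>
    cases l with
    | nil => simp [h [] rfl]
    | cons y l =>
      rw [bd_cons_cons, bd_cons_cons, h _ (by simp), ih fun w hw => h _ (by simp at hw ⊢; omega)]

/-- It is used both for symmetries, where φ is an automorphism, and for changes of coefficients,
where φ is the identity. -/
lemma bd_comp {act : B →ₗ[ℂ] Z →ₗ[ℂ] Z} {act' : B →ₗ[ℂ] Z' →ₗ[ℂ] Z'} (φ : B →ₐ[ℂ] B)
    (L : Z →ₗ[ℂ] Z') (hL : ∀ x z, act' (φ x) (L z) = L (act x z)) {f : List B → Z}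
    {f' : List B → Z'} (h : ∀ l, f' (l.map φ) = L (f l)) (l : List B) :
    bd act' f' (l.map φ) = L (bd act f l) := by
  induction l generalizing f f' with
  | nil => simp
  | cons x l ih =>
    cases l with
    | nil =>
      have := h []
      simp only [List.map_nil] at this
      simp [this, hL]
    | cons y l =>
      have h1 := ih (f := fun l => f (x :: l)) (f' := fun l => f' (φ x :: l)) fun l => h (x :: l)
      have h2 := h ((y * x) :: l)
      rw [List.map_cons, map_mul] at h2
      rw [List.map_cons] at h1
      rw [List.map_cons, List.map_cons, bd_cons_cons, bd_cons_cons, h1, h2, map_sub]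

lemma cobd_comp {act ract : B →ₗ[ℂ] Z →ₗ[ℂ] Z} {act' ract' : B →ₗ[ℂ] Z' →ₗ[ℂ] Z'}
    (φ : B →ₐ[ℂ] B) (L : Z →ₗ[ℂ] Z') (hL : ∀ x z, act' (φ x) (L z) = L (act x z))
    (hL' : ∀ x z, ract' (φ x) (L z) = L (ract x z)) {f : List B → Z}
    {f' : List B → Z'} (h : ∀ l, f' (l.map φ) = L (f l)) (l : List B) :
    cobd act' ract' f' (l.map φ) = L (cobd act ract f l) := by
  cases l with
  | nil => simp [cobd]
  | cons x l =>
    have := bd_comp φ L hL h (x :: l)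
    rw [List.map_cons] at this ⊢
    rw [cobd, this, h, hL', cobd, map_sub]

lemma ML.bd {f : List B → Z} (hf : ML f) : ML (bd act f) := by
  intro u v x x' c
  induction u generalizing f with
  | nil =>
    cases v with
    | nil => simp
    | cons y v =>
      have h1 : (fun l => f ((c • x + x') :: l)) = fun l => c • f (x :: l) + f (x' :: l) :=
        funext fun l => hf.head c x x' l
      rw [List.nil_append, List.nil_append, List.nil_append, bd_cons_cons, h1]
      simp only [bd_cons_cons, bd_lin, mul_add, mul_smul_comm, hf.head,
        smul_sub]
      abel
  | cons a u ih =>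
    have ih' := ih (hf.cons a)
    cases u with
    | nil =>
      simp only [List.nil_append, List.cons_append] at ih' ⊢
      simp only [bd_cons_cons, ih', add_mul, smul_mul_assoc, hf.head, smul_sub]
      abel
    | cons a' u =>
      simp only [List.cons_append] at ih' ⊢
      have h2 := hf ((a' * a) :: u) v x x' c
      simp only [List.cons_append] at h2
      simp only [bd_cons_cons, ih', h2, smul_sub]
      abel

lemma ML.cobd {f : List B → Z} (hf : ML f) : ML (cobd act ract f) := by
  intro u v x x' c
  have h1 := hf.bd act u v x x' c
  cases u with
  | nil =>
    simp only [List.nil_append] at h1 ⊢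
    simp only [SeidelQ.cobd, h1, smul_sub, _root_.map_add, _root_.map_smul, LinearMap.add_apply,
      LinearMap.smul_apply]
    abel
  | cons a u =>
    simp only [List.cons_append] at h1 ⊢
    simp only [SeidelQ.cobd, h1, hf u v x x' c, smul_sub, _root_.map_add, _root_.map_smul]
    abel

/-- Replace the head `x` of the list by `φ x`. -/
def onHead (φ : B → B) (z : Z) (f : List B → Z) : List B → Z
  | [] => z
  | x :: l => f (φ x :: l)

lemma ML.onHead {f : List B → Z} (hf : ML f) (φ : B →ₗ[ℂ] B) (z : Z) : ML (onHead φ z f) := by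
  intro u v x y c
  cases u with
  | nil => simp [SeidelQ.onHead, hf.head]
  | cons a u => exact hf (φ a :: u) v x y c

variable {act ract}

lemma bd_onHead_mul (hact : ∀ x y z, act (y * x) z = act y (act x z)) (f : List B → Z) (x y : B)
    (l : List B) : bd act (onHead (· * x) (act x (f [])) f) (y :: l) = bd act f ((y * x) :: l) := by
  cases l with
  | nil => simp [onHead, hact]
  | cons z l => rw [bd_cons_cons, bd_cons_cons, onHead, ← mul_assoc]; rfl

/-- With x fixed as head, the function `bd act f` is f with its next entry multiplied by x, minus
the differential of f with head x. The latter is killed by induction; the differential of the former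
cancels the face which merges x and y. -/
lemma bd_bd (hact : ∀ x y z, act (y * x) z = act y (act x z)) (f : List B → Z) (l : List B) :
    bd act (bd act f) l = 0 := by
  induction l generalizing f with
  | nil => rfl
  | cons x l ih =>
    cases l with
    | nil => simp
    | cons y l =>
      have h : (fun w => bd act f (x :: w)) =
          fun w => onHead (· * x) (act x (f [])) f w - bd act (fun w => f (x :: w)) w := by
        funext w
        cases w with
        | nil => simp [onHead]
        | cons y w => rfl
      rw [bd_cons_cons, h, bd_sub, ih, bd_onHead_mul hact, sub_zero, sub_self]

lemma cobd_cobd (hact : ∀ x y z, act (y * x) z = act y (act x z))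
    (hract : ∀ x y z, ract (y * x) z = ract x (ract y z))
    (hcomm : ∀ x y z, act x (ract y z) = ract y (act x z)) (f : List B → Z) (l : List B) :
    cobd act ract (cobd act ract f) l = 0 := by
  cases l with
  | nil => rfl
  | cons x l =>
    cases l with
    | nil => simp [cobd]
    | cons y l =>
      have h : cobd act ract f = fun l => (match l with | [] => 0 | x :: l => ract x (f l)) -
          bd act f l := by
        funext l
        cases l <;> simp [cobd]
      have h2 : bd act (fun l => ract x (f l)) (y :: l) = ract x (bd act f (y :: l)) := by
        have := bd_comp (act := act) (act' := act) (AlgHom.id ℂ B) (ract x)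
          (fun y z => hcomm y x z) (f := f) (f' := fun l => ract x (f l)) (by simp) (y :: l)
        simpa using this
      rw [cobd]
      conv_lhs => enter [2]; rw [h]
      rw [bd_sub, bd_bd hact, bd_cons_cons]
      simp only [h2, cobd, hract, map_sub]
      abel

end Bar

/-! ### Polynomial cocycles with trivial coefficients. -/

section Koszul

variable {B Z : Type*} [Ring B] [Algebra ℂ B] [AddCommGroup Z] [Module ℂ Z] {N : ℕ}

/-- The action of `B` on `Z` through a character. -/
def charAct (ε : B →ₐ[ℂ] ℂ) : B →ₗ[ℂ] Z →ₗ[ℂ] Z :=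
  LinearMap.lsmul ℂ Z ∘ₗ ε.toLinearMap

@[simp] lemma charAct_apply (ε : B →ₐ[ℂ] ℂ) (x : B) (z : Z) : charAct ε x z = ε x • z := rfl

/-- The function on lists given by a polynomial in the functionals `lam k`, with monomials ordered
decreasingly. -/
def ev (lam : Fin N → B →ₗ[ℂ] ℂ) : ℕ → (List (Fin N) → Z) → List B → Z
  | _, c, [] => c []
  | n, c, y :: l => ∑ k : Fin N, if (k : ℕ) < n then
      lam k y • ev lam (k + 1) (fun I => c (k :: I)) l else 0

lemma ML.ev (lam : Fin N → B →ₗ[ℂ] ℂ) (n : ℕ) (c : List (Fin N) → Z) : ML (ev lam n c) := by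
  intro u v x y a
  induction u generalizing n c with
  | nil =>
    simp only [List.nil_append, SeidelQ.ev, Finset.smul_sum, ← Finset.sum_add_distrib]
    refine Finset.sum_congr rfl fun k _ => ?_
    split_ifs
    · simp [add_smul, mul_smul]
    · simp
  | cons b u ih =>
    simp only [List.cons_append, SeidelQ.ev, Finset.smul_sum, ← Finset.sum_add_distrib]
    refine Finset.sum_congr rfl fun k _ => ?_
    split_ifs
    · rw [ih, smul_add, smul_comm]
    · simp

/-- Each functional is a derivation over the character ε, so neighbouring faces cancel in a
telescope and only ε of the head remains. Hence polynomials are cocycles for trivial coefficients on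
both sides. -/
lemma bd_ev {ε : B →ₐ[ℂ] ℂ} {lam : Fin N → B →ₗ[ℂ] ℂ}
    (hlam : ∀ k x y, lam k (y * x) = lam k y * ε x + ε y * lam k x) (n : ℕ)
    (c : List (Fin N) → Z) (y : B) (l : List B) :
    bd (charAct ε) (ev lam n c) (y :: l) = ε y • ev lam n c l := by
  induction l generalizing n c y with
  | nil => simp
  | cons z l ih =>
    rw [bd_cons_cons]
    have h : (fun l => ev lam n c (y :: l)) = fun l => ∑ k : Fin N, if (k : ℕ) < n then
      lam k y • ev lam (k + 1) (fun I => c (k :: I)) l else 0 := rfl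
    have h2 : ∀ s : Finset (Fin N), bd (charAct ε) (fun l => ∑ k ∈ s, if (k : ℕ) < n then
        lam k y • ev lam (k + 1) (fun I => c (k :: I)) l else 0) (z :: l) =
        ∑ k ∈ s, if (k : ℕ) < n then
          lam k y • ε z • ev lam (k + 1) (fun I => c (k :: I)) l else 0 := by
      intro s
      induction s using Finset.induction_on with
      | empty =>
        have := bd_sub (charAct ε) (fun _ => (0 : Z)) (fun _ => 0) (z :: l)
        simpa using this
      | insert k s hk ihs =>
        simp only [Finset.sum_insert hk]
        split_ifs with hkn
        · rw [bd_lin, ih, ihs]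
        · simp only [zero_add, ihs]
    rw [h, h2, ev, ev, Finset.smul_sum, ← Finset.sum_sub_distrib]
    refine Finset.sum_congr rfl fun k _ => ?_
    split_ifs
    · rw [hlam, add_smul, smul_smul, smul_smul, mul_comm (lam k z), mul_comm (ε z), add_sub_cancel_right]
    · simp

/-- The map L has to vary in the induction: after removal of a leading index k, the remaining
coefficients are equivariant for (w k)⁻¹ • L. -/
lemma ev_map {lam : Fin N → B →ₗ[ℂ] ℂ} {φ : B →ₐ[ℂ] B} {w : Fin N → ℂ} (hw : ∀ k, w k ≠ 0)
    (hφ : ∀ k x, lam k (φ x) = w k * lam k x) (L : Z →ₗ[ℂ] Z) (n : ℕ)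
    {c : List (Fin N) → Z} (hc : ∀ I : List (Fin N), L (c I) = (I.map w).prod • c I)
    (l : List B) : ev lam n c (l.map φ) = L (ev lam n c l) := by
  induction l generalizing n c L with
  | nil => have := hc []; simp [ev, this]
  | cons y l ih =>
    rw [List.map_cons, ev, ev, map_sum]
    refine Finset.sum_congr rfl fun k _ => ?_
    split_ifs
    · rw [ih ((w k)⁻¹ • L) (k + 1) (fun I => ?_), hφ, LinearMap.smul_apply,
        smul_smul, map_smul]
      · congr 1
        field_simp [hw k]
      · rw [LinearMap.smul_apply, hc, List.map_cons, List.prod_cons,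
          smul_smul, ← mul_assoc, inv_mul_cancel₀ (hw k), one_mul]
    · simp

end Koszul

/-! ### The Koszul resolution over the exterior algebra. -/

section Exterior

variable {V : Type*} [AddCommGroup V] [Module ℂ V] {N : ℕ} (b : Module.Basis (Fin N) ℂ V)

/-- The automorphism of `V` which is diagonal in the basis `b`. -/
def diagEquiv (h : Fin N → ℂˣ) : V ≃ₗ[ℂ] V :=
  b.equivFun.trans ((LinearEquiv.piCongrRight fun i => LinearEquiv.smulOfUnit (h i)).trans
    b.equivFun.symm)

lemma coord_diagEquiv (h : Fin N → ℂˣ) (i : Fin N) (v : V) :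
    b.coord i (diagEquiv b h v) = h i * b.coord i v := by
  rw [b.coord_apply, b.coord_apply, ← b.equivFun_apply, ← b.equivFun_apply, diagEquiv]
  simp only [LinearEquiv.trans_apply, LinearEquiv.apply_symm_apply]
  rfl

lemma diagEquiv_basis (h : Fin N → ℂˣ) (i : Fin N) : diagEquiv b h (b i) = (h i : ℂ) • b i := by
  refine b.ext_elem fun j => ?_
  have := coord_diagEquiv b h j (b i)
  rw [b.coord_apply] at this
  rw [this]
  by_cases hij : i = j
  · subst hij; simp
  · simp [hij]

/-- The action of diagonal automorphisms on the exterior algebra. -/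
def extDiag (h : Fin N → ℂˣ) : ExteriorAlgebra ℂ V →ₐ[ℂ] ExteriorAlgebra ℂ V :=
  ExteriorAlgebra.map (diagEquiv b h : V →ₗ[ℂ] V)

/-- The augmentation of the exterior algebra. -/
abbrev aug : ExteriorAlgebra ℂ V →ₐ[ℂ] ℂ := ExteriorAlgebra.algebraMapInv

@[simp] lemma aug_ι (v : V) : aug (ExteriorAlgebra.ι ℂ v) = 0 := by
  simp [aug, ExteriorAlgebra.algebraMapInv]

lemma aug_map (f : V →ₗ[ℂ] V) (x : ExteriorAlgebra ℂ V) : aug (ExteriorAlgebra.map f x) = aug x := by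
  have : (aug.comp (ExteriorAlgebra.map f)) = (aug : ExteriorAlgebra ℂ V →ₐ[ℂ] ℂ) := by
    ext v; simp
  exact DFunLike.congr_fun this x

/-- Contraction from the right with a dual basis vector. -/
def contr (k : Fin N) : ExteriorAlgebra ℂ V →ₗ[ℂ] ExteriorAlgebra ℂ V :=
  (CliffordAlgebra.contractRight (Q := (0 : QuadraticForm ℂ V))).flip (b.coord k)

lemma contr_mul_ι (k : Fin N) (x : ExteriorAlgebra ℂ V) (v : V) :
    contr b k (x * ExteriorAlgebra.ι ℂ v) =
      b.coord k v • x - contr b k x * ExteriorAlgebra.ι ℂ v :=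
  CliffordAlgebra.contractRight_mul_ι (Q := (0 : QuadraticForm ℂ V)) (b.coord k) v x

lemma contr_algebraMap (k : Fin N) (c : ℂ) :
    contr b k (algebraMap ℂ (ExteriorAlgebra ℂ V) c) = 0 :=
  CliffordAlgebra.contractRight_algebraMap (Q := (0 : QuadraticForm ℂ V)) (b.coord k) c

lemma contr_extDiag (h : Fin N → ℂˣ) (k : Fin N) (x : ExteriorAlgebra ℂ V) :
    contr b k (extDiag b h x) = (h k : ℂ) • extDiag b h (contr b k x) := by
  induction x using CliffordAlgebra.right_induction with
  | algebraMap r =>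
    have h1 : extDiag b h (algebraMap ℂ (ExteriorAlgebra ℂ V) r) = algebraMap ℂ _ r :=
      AlgHom.commutes _ _
    have h2 := contr_algebraMap b k r
    change contr b k (extDiag b h (algebraMap ℂ (ExteriorAlgebra ℂ V) r)) =
      (h k : ℂ) • extDiag b h (contr b k (algebraMap ℂ (ExteriorAlgebra ℂ V) r))
    rw [h1, h2, map_zero, smul_zero]
  | add x y hx hy => simp only [map_add, hx, hy, smul_add]
  | mul_ι v x hx =>
    change contr b k (extDiag b h (x * ExteriorAlgebra.ι ℂ v)) =
      (h k : ℂ) • extDiag b h (contr b k (x * ExteriorAlgebra.ι ℂ v))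
    have h1 : extDiag b h (ExteriorAlgebra.ι ℂ v) = ExteriorAlgebra.ι ℂ (diagEquiv b h v) := by
      simp [extDiag]
    rw [map_mul, h1, contr_mul_ι, contr_mul_ι, hx, coord_diagEquiv, map_sub, map_mul, h1, map_smul,
      smul_sub, smul_smul, smul_mul_assoc]

/-- The coefficient of a basis vector. -/
def lam (k : Fin N) : ExteriorAlgebra ℂ V →ₗ[ℂ] ℂ := aug.toLinearMap ∘ₗ contr b k

lemma lam_mul_ι (k : Fin N) (x : ExteriorAlgebra ℂ V) (v : V) :
    lam b k (x * ExteriorAlgebra.ι ℂ v) = b.coord k v * aug x := by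
  simp [lam, contr_mul_ι]

lemma lam_mul (k : Fin N) (x y : ExteriorAlgebra ℂ V) :
    lam b k (y * x) = lam b k y * aug x + aug y * lam b k x := by
  induction x using CliffordAlgebra.right_induction with
  | algebraMap r =>
    change lam b k (y * algebraMap ℂ (ExteriorAlgebra ℂ V) r) = lam b k y *
      aug (algebraMap ℂ (ExteriorAlgebra ℂ V) r) +
      aug y * lam b k (algebraMap ℂ (ExteriorAlgebra ℂ V) r)
    have h2 : lam b k (algebraMap ℂ (ExteriorAlgebra ℂ V) r) = 0 := by
      simp [lam, contr_algebraMap]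
    rw [h2, ← Algebra.commutes, ← Algebra.smul_def, map_smul, AlgHom.commutes]
    simp [mul_comm]
  | add x x' hx hy => simp only [mul_add, map_add, hx, hy]; ring
  | mul_ι v x hx =>
    change lam b k (y * (x * ExteriorAlgebra.ι ℂ v)) = lam b k y * aug (x * ExteriorAlgebra.ι ℂ v)
      + aug y * lam b k (x * ExteriorAlgebra.ι ℂ v)
    rw [← mul_assoc, lam_mul_ι, lam_mul_ι]
    simp
    ring

lemma lam_extDiag (h : Fin N → ℂˣ) (k : Fin N) (x : ExteriorAlgebra ℂ V) :
    lam b k (extDiag b h x) = h k * lam b k x := by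
  change aug (contr b k (extDiag b h x)) = h k * aug (contr b k x)
  rw [contr_extDiag, map_smul, extDiag, aug_map, smul_eq_mul]

lemma lam_ι (k : Fin N) (v : V) : lam b k (ExteriorAlgebra.ι ℂ v) = b.coord k v := by
  simpa using lam_mul_ι b k 1 v

variable {Z : Type*} [AddCommGroup Z] [Module ℂ Z]

/-- The Koszul resolution: cocycles with values in a trivial module, on lists whose head is taken
modulo the right ideal generated by the first `n` basis vectors, are polynomials up to
coboundaries. -/
theorem exists_koszul (s n : ℕ) (hn : n ≤ N) (ρ : (Fin N → ℂˣ) → Z →ₗ[ℂ] Z)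
    {f : List (ExteriorAlgebra ℂ V) → Z} (hf : ML f)
    (hρ : ∀ h l, f (l.map (extDiag b h)) = ρ h (f l))
    (hcoc : ∀ x y l, List.length l = s → bd (charAct aug) f (x :: y :: l) = 0)
    (hv : ∀ k : Fin N, (k : ℕ) < n → ∀ x l, List.length l = s →
      f ((x * ExteriorAlgebra.ι ℂ (b k)) :: l) = 0) :
    ∃ (g : List (ExteriorAlgebra ℂ V) → Z) (c : List (Fin N) → Z), ML g ∧
      (∀ h l, g (l.map (extDiag b h)) = ρ h (g l)) ∧
      (∀ h I, ρ h (c I) = (I.map fun k => (h k : ℂ)).prod • c I) ∧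
      (s = 0 → g [] = 0) ∧
      (∀ k : Fin N, (k : ℕ) < n → ∀ x l, List.length l + 1 = s →
        g ((x * ExteriorAlgebra.ι ℂ (b k)) :: l) = 0) ∧
      ∀ x l, List.length l = s →
        f (x :: l) = bd (charAct aug) g (x :: l) + aug x • ev (lam b) n c l := by
  have hact : ∀ (x y : ExteriorAlgebra ℂ V) (z : Z),
      charAct aug (y * x) z = charAct aug y (charAct aug x z) := fun x y z => by
    simp only [charAct_apply, map_mul, mul_smul]
  -- Double induction, on the arity and on the number of basis vectors killed in the head. Let B be
  -- the exterior algebra and I_i the ideal generated by e_0, …, e_{i-1}. The passage from i to i +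
  -- 1 is dévissage along the exact sequence 0 → B/I_{i+1} → B/I_i → B/I_{i+1} → 0, whose first map
  -- is right multiplication by e_i.
  induction s generalizing n f ρ with
  | zero =>
    refine ⟨fun _ => 0, fun I => if I = [] then f [1] else 0, fun u v x y c => by simp, fun h l => by simp,
      fun h I => ?_, fun _ => rfl, fun _ _ _ _ _ => rfl, fun x l hl => ?_⟩
    · rcases I with _ | ⟨k, I⟩
      swap
      · simp
      have := hρ h [1]
      rw [List.map_cons, map_one] at this
      simpa using this.symm
    · rw [List.length_eq_zero_iff] at hl
      subst hl
      have := hcoc 1 x [] rfl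
      rw [bd_cons_cons, bd_single, sub_eq_zero] at this
      simpa [ev] using this
  | succ s ih =>
    induction n with
    | zero =>
      -- For n = 0 the head ranges over the free module B, and inserting 1 as head is a contracting
      -- homotopy.
      refine ⟨fun l => f (1 :: l), fun _ => 0, hf.cons 1, fun h l => ?_, fun h I => by simp,
        fun h => by omega, fun k hk => by omega, fun x l hl => ?_⟩
      · have := hρ h (1 :: l)
        rwa [List.map_cons, map_one] at this
      · obtain ⟨y, l, rfl⟩ := List.exists_cons_of_length_eq_add_one hl
        have := hcoc 1 x (y :: l) hl
        rw [bd_cons_cons, mul_one, sub_eq_zero] at this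
        simp [this, ev]
    | succ i ihn =>
      obtain ⟨g, c, hg, hgρ, hcρ, -, hgv, hfg⟩ := ihn (by omega) fun k hk => hv k (by omega)
      let i' : Fin N := ⟨i, by omega⟩
      set e : Fin N → ExteriorAlgebra ℂ V := fun k => ExteriorAlgebra.ι ℂ (b k) with he
      have hee : ∀ k j, e k * e j = - (e j * e k) := fun k j =>
        eq_neg_of_add_eq_zero_left (ExteriorAlgebra.ι_add_mul_swap (b k) (b j))
      have hphi : ∀ h : Fin N → ℂˣ, extDiag b h (e i') = (h i' : ℂ) • e i' := fun h => by
        simp [extDiag, he, diagEquiv_basis]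
      have hctr : ∀ k x, contr b i' (x * e k) = (if k = i' then x else 0) - contr b i' x * e k := by
        intro k x
        rw [he, contr_mul_ι]
        by_cases hk : k = i' <;> simp [hk]
      let mulE : ExteriorAlgebra ℂ V →ₗ[ℂ] ExteriorAlgebra ℂ V := LinearMap.mulRight ℂ (e i')
      -- The function `g1` measures the failure of g to kill e_i. It is a cocycle of lower arity
      -- since f kills e_i and the augmentation of e_i is zero, and it kills e_0, …, e_i because
      -- these anticommute and e_i has square zero.
      set g1 := onHead mulE 0 g with hg1
      have hbdg1 : ∀ x y l, bd (charAct aug) g1 (x :: y :: l) =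
          bd (charAct aug) g ((x * e i') :: y :: l) := fun x y l => by
        rw [bd_cons_cons, bd_cons_cons, ← mul_assoc]; rfl
      have hg1ρ : ∀ t l, g1 (l.map (extDiag b t)) = ((t i' : ℂ)⁻¹ • ρ t) (g1 l) := by
        intro t l
        cases l with
        | nil => simp [hg1, onHead]
        | cons x l =>
          have h1 := hgρ t ((x * e i') :: l)
          rw [List.map_cons, map_mul, hphi, mul_smul_comm, hg.head_smul] at h1
          change g ((extDiag b t x * e i') :: l.map (extDiag b t)) = (t i' : ℂ)⁻¹ • ρ t (g ((x * e i') :: l))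
          rw [← h1, smul_smul, inv_mul_cancel₀ (t i').ne_zero, one_smul]
      have hg1coc : ∀ x y l, List.length l = s → bd (charAct aug) g1 (x :: y :: l) = 0 := by
        intro x y l hl
        have h1 := hfg (x * e i') (y :: l) (by simpa using hl)
        rw [hv i' (by simp [i']) x (y :: l) (by simpa using hl)] at h1
        rw [map_mul, he, aug_ι, mul_zero, zero_smul, add_zero] at h1
        rw [hbdg1]; exact h1.symm
      have hg1v : ∀ k : Fin N, (k : ℕ) < i + 1 → ∀ x l, List.length l = s →
          g1 ((x * e k) :: l) = 0 := by
        intro k hk x l hl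
        change g ((x * e k * e i') :: l) = 0
        rw [mul_assoc]
        rcases Nat.lt_succ_iff_lt_or_eq.mp hk with hk' | hk'
        · rw [hee, mul_neg, ← mul_assoc, hg.head_neg, neg_eq_zero]
          exact hgv k hk' _ _ (by omega)
        · obtain rfl : k = i' := Fin.ext hk'
          rw [he, ExteriorAlgebra.ι_sq_zero, mul_zero]
          exact hg.head_zero l
      -- Multiplication by e_i carries the weight of e_i, so the inductive hypothesis is applied
      -- with ρ divided by this weight.
      obtain ⟨h, c1, hh, hhρ, hc1ρ, hh0, hhv, hgh⟩ :=
        ih (i + 1) hn _ (hg.onHead mulE 0) hg1ρ hg1coc hg1v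
      -- Contraction undoes multiplication by e_i modulo elements killed by h. Therefore `ht` lifts
      -- h through this multiplication, and w does the same for the polynomial part by means of `lam
      -- b i'`.
      set ht := onHead (contr b i') 0 h with hht
      let w : List (ExteriorAlgebra ℂ V) → Z := fun l => match l with
        | [] => 0
        | x :: l => lam b i' x • ev (lam b) (i + 1) c1 l
      have hwML : ML w := by
        intro u v x y a
        cases u with
        | nil => simp [w, add_smul, mul_smul]
        | cons z u =>
          have := ML.ev (lam b) (i + 1) c1 u v x y a
          simp only [List.cons_append, w, this, smul_add, smul_comm a]
      have hht1 : ∀ k : Fin N, (k : ℕ) < i + 1 → ∀ x l, List.length l + 1 = s →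
          ht ((x * e k) :: l) = if k = i' then h (x :: l) else 0 := by
        intro k hk x l hl
        change h (contr b i' (x * e k) :: l) = _
        have h1 := hhv k hk (contr b i' x) l hl
        rw [hctr, sub_eq_add_neg, hh.head_add, hh.head_neg]
        rw [h1, neg_zero, add_zero]
        split_ifs
        · rfl
        · exact hh.head_zero l
      have hbdht : ∀ k : Fin N, (k : ℕ) < i + 1 → ∀ x l, List.length l = s →
          bd (charAct aug) ht ((x * e k) :: l) =
            if k = i' then bd (charAct aug) h (x :: l) else 0 := by
        intro k hk x l hl
        cases l with
        | nil =>
          have := hh0 hl.symm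
          simp [hht, onHead, this]
        | cons y l =>
          simp only [List.length_cons] at hl
          rw [bd_cons_cons, ← mul_assoc, hht1 k hk _ _ hl,
            bd_congr (g := fun w => if k = i' then h (x :: w) else 0) _ _
              fun w hw => hht1 k hk x w (by simpa [hl] using hw)]
          split_ifs
          · rfl
          · have := bd_sub (charAct aug) (fun _ => (0 : Z)) (fun _ => 0) (y :: l)
            simp only [sub_self] at this
            rw [this, sub_zero]
      -- The corrected primitive kills e_i as well. The differential of w is a polynomial whose
      -- monomials have leading variable i; moved to the other side, it supplies the new
      -- coefficients `c1`.
      refine ⟨fun l => g l - bd (charAct aug) ht l - w l,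
        fun I => match I with | [] => 0 | k :: I => if k = i' then c1 I else c (k :: I),
        (hg.sub ((hh.onHead _ 0).bd _)).sub hwML, fun t l => ?_, fun t I => ?_,
        fun h => by omega, fun k hk x l hl => ?_, fun x l hl => ?_⟩
      · beta_reduce
        rw [map_sub, map_sub, hgρ]
        congr 1
        · congr 1
          refine bd_comp (extDiag b t) (ρ t) (fun x z => ?_) (fun l => ?_) l
          · simp [extDiag, aug_map]
          · cases l with
            | nil => simp [hht, onHead]
            | cons x l =>
              have h1 := hhρ t (contr b i' x :: l)
              change h (contr b i' (extDiag b t x) :: l.map (extDiag b t)) =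
                ρ t (h (contr b i' x :: l))
              rw [contr_extDiag, hh.head_smul]
              rw [List.map_cons] at h1
              rw [h1, LinearMap.smul_apply, smul_smul, mul_inv_cancel₀ (t i').ne_zero, one_smul]
        · cases l with
          | nil => simp [w]
          | cons x l =>
            have h1 := ev_map (fun k => (t k).ne_zero) (fun k x => lam_extDiag b t k x)
              ((t i' : ℂ)⁻¹ • ρ t) (i + 1) (hc1ρ t) l
            change lam b i' (extDiag b t x) • ev (lam b) (i + 1) c1 (l.map (extDiag b t)) =
              ρ t (lam b i' x • ev (lam b) (i + 1) c1 l)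
            rw [h1, lam_extDiag, map_smul, LinearMap.smul_apply, smul_smul, mul_right_comm,
              mul_inv_cancel₀ (t i').ne_zero, one_mul]
      · rcases I with _ | ⟨k, I⟩
        · simp
        · by_cases hk : k = i'
          · have h1 := hc1ρ t I
            rw [LinearMap.smul_apply] at h1
            simp only [hk, if_true, List.map_cons, List.prod_cons, mul_smul]
            rw [← h1, smul_smul, mul_inv_cancel₀ (t i').ne_zero, one_smul]
          · simpa only [hk, if_false] using hcρ t (k :: I)
      · have hl' : l.length = s := by omega
        have hw : w ((x * e k) :: l) = (if k = i' then aug x • ev (lam b) (i + 1) c1 l else 0) := by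
          change lam b i' (x * e k) • _ = _
          rw [he, lam_mul_ι]
          by_cases hk' : k = i'
          · simp [hk']
          · simp [hk']
        change g ((x * e k) :: l) - bd (charAct aug) ht ((x * e k) :: l) - w ((x * e k) :: l) = 0
        rw [hbdht k hk x l hl', hw]
        by_cases hk' : k = i'
        · subst hk'
          have h1 := hgh x l hl'
          simp only [if_true]
          change g ((x * e i') :: l) = _ at h1
          rw [h1]; abel
        · have : (k : ℕ) ≠ i := fun h => hk' (Fin.ext h)
          simp only [hk', if_false, sub_zero]
          exact hgv k (by omega) x l (by omega)
      · obtain ⟨y, l, rfl⟩ := List.exists_cons_of_length_eq_add_one hl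
        rw [hfg x _ hl, bd_sub, bd_sub, bd_bd hact, sub_zero]
        have h1 : bd (charAct aug) w (x :: y :: l) =
            aug x • lam b i' y • ev (lam b) (i + 1) c1 l := by
          have h2 : (fun l => w (x :: l)) = fun l => lam b i' x • ev (lam b) (i + 1) c1 l + 0 := by
            funext l; simp [w]
          rw [bd_cons_cons, h2, bd_lin _ _ _ (fun _ => (0 : Z)), bd_ev (lam_mul b)]
          have h3 := bd_sub (charAct aug) (fun _ => (0 : Z)) (fun _ => 0) (y :: l)
          simp only [sub_self] at h3
          rw [h3]
          simp only [w, lam_mul, add_smul, mul_smul, add_zero]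
          rw [smul_comm (aug y), add_sub_cancel_right, smul_comm]
        have h4 : ev (lam b) (i + 1) (fun I => match I with
            | [] => 0
            | k :: I => if k = i' then c1 I else c (k :: I)) (y :: l) =
            lam b i' y • ev (lam b) (i + 1) c1 l + ev (lam b) i c (y :: l) := by
          rw [ev, ev, ← Finset.sum_erase_add _ _ (Finset.mem_univ i'), add_comm]
          have h5 : (i' : ℕ) = i := rfl
          congr 1
          · simp [h5]
          · rw [← Finset.sum_erase_add (a := i') Finset.univ _ (Finset.mem_univ i')]
            simp only [h5, lt_irrefl, if_false, add_zero]
            refine Finset.sum_congr rfl fun k hk => ?_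
            have hk1 : k ≠ i' := (Finset.mem_erase.mp hk).1
            have hk2 : (k : ℕ) ≠ i := fun h => hk1 (Fin.ext h)
            simp only [hk1, if_false]
            by_cases hk3 : (k : ℕ) < i
            · rw [if_pos hk3, if_pos (by omega)]
            · rw [if_neg hk3, if_neg (by omega)]
        rw [h4, h1, smul_add]
        abel

end Exterior

/-! ### The exterior algebra inside Q_4. -/

section Entries

variable {V : Type*} [AddCommGroup V] [Module ℂ V]

/-- The `(k, j)` entry of an element of `Q_4`. -/
def entry (k j : Fin 4) : Q4 V →ₗ[ℂ] ExteriorAlgebra ℂ V where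
  toFun a := (a : Matrix (Fin 4) (Fin 4) (ExteriorAlgebra ℂ V)) k j
  map_add' _ _ := rfl
  map_smul' _ _ := rfl

lemma entry_mem (a : Q4 V) (k j : Fin 4) : entry k j a ∈ homSpace V j k := a.2 j k

lemma Q4.ext_entry {a a' : Q4 V} (h : ∀ k j, entry k j a = entry k j a') : a = a' :=
  Subtype.ext (Matrix.ext h)

lemma entry_mul (a a' : Q4 V) (k j : Fin 4) :
    entry k j (a * a') = ∑ l, entry k l a * entry l j a' := by
  change ((a : Matrix (Fin 4) (Fin 4) (ExteriorAlgebra ℂ V)) *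
    (a' : Matrix (Fin 4) (Fin 4) (ExteriorAlgebra ℂ V))) k j = _
  rw [Matrix.mul_apply]
  rfl

lemma entry_one (k j : Fin 4) : entry k j (1 : Q4 V) = if k = j then 1 else 0 := Matrix.one_apply

lemma entry_idem (i k j : Fin 4) : entry k j (idem i : Q4 V) = if i = k ∧ i = j then 1 else 0 :=
  Matrix.single_apply _ _ _ _ _

lemma entry_idem_mul (i k j : Fin 4) (a : Q4 V) :
    entry k j (idem i * a) = if i = k then entry k j a else 0 := by
  rw [entry_mul]
  by_cases h : i = k
  · subst h
    rw [Finset.sum_eq_single i (fun l _ hl => by simp [entry_idem, hl.symm]) (by simp)]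
    simp [entry_idem]
  · simp [entry_idem, h]

lemma entry_mul_idem (i k j : Fin 4) (a : Q4 V) :
    entry k j (a * idem i) = if i = j then entry k j a else 0 := by
  rw [entry_mul]
  by_cases h : i = j
  · subst h
    rw [Finset.sum_eq_single i (fun l _ hl => by simp [entry_idem, hl.symm]) (by simp)]
    simp [entry_idem]
  · simp [entry_idem, h]

lemma sum_idem : ∑ j, (idem j : Q4 V) = 1 := by
  refine Q4.ext_entry fun k j => ?_
  rw [map_sum, entry_one]
  simp_rw [entry_idem]
  by_cases h : k = j
  · subst h; simp
  · rw [if_neg h]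
    refine Finset.sum_eq_zero fun i _ => if_neg fun hi => h (hi.1.symm.trans hi.2)

/-- The element of `R_4` with given diagonal entries. -/
def diagR (r : Fin 4 → ℂ) : Q4 V := ∑ j, r j • idem j

lemma entry_diagR (r : Fin 4 → ℂ) (k j : Fin 4) :
    entry k j (diagR r : Q4 V) = if k = j then algebraMap ℂ _ (r k) else 0 := by
  simp_rw [diagR, map_sum, map_smul, entry_idem]
  by_cases h : k = j
  · subst h
    simp [Algebra.algebraMap_eq_smul_one]
  · rw [if_neg h]
    refine Finset.sum_eq_zero fun i _ => ?_
    rw [if_neg fun hi => h (hi.1.symm.trans hi.2), smul_zero]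

lemma mem_R4_iff {a : Q4 V} : a ∈ R4 V ↔ ∃ r, a = diagR r := by
  constructor
  · rintro ⟨r, hr⟩
    refine ⟨r, Q4.ext_entry fun k j => ?_⟩
    rw [entry_diagR]
    change (a : Matrix (Fin 4) (Fin 4) (ExteriorAlgebra ℂ V)) k j = _
    rw [hr, Matrix.diagonal_apply]
  · rintro ⟨r, rfl⟩
    refine ⟨r, Matrix.ext fun k j => ?_⟩
    rw [Matrix.diagonal_apply]
    exact entry_diagR r k j

lemma diagR_mem (r : Fin 4 → ℂ) : (diagR r : Q4 V) ∈ R4 V := mem_R4_iff.mpr ⟨r, rfl⟩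

lemma idem_mem (j : Fin 4) : (idem j : Q4 V) ∈ R4 V :=
  mem_R4_iff.mpr ⟨Pi.single j 1, by simp [diagR, Pi.single_apply]⟩

lemma entry_diagR_mul (r : Fin 4 → ℂ) (a : Q4 V) (k j : Fin 4) :
    entry k j (diagR r * a) = r k • entry k j a := by
  rw [entry_mul, Finset.sum_eq_single k (fun l _ hl => by simp [entry_diagR, hl.symm]) (by simp)]
  simp [entry_diagR, Algebra.smul_def]

lemma entry_mul_diagR (r : Fin 4 → ℂ) (a : Q4 V) (k j : Fin 4) :
    entry k j (a * diagR r) = r j • entry k j a := by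
  rw [entry_mul, Finset.sum_eq_single j (fun l _ hl => by simp [entry_diagR, hl]) (by simp)]
  simp [entry_diagR, Algebra.smul_def, Algebra.commutes]

lemma diagR_one : (diagR 1 : Q4 V) = 1 := by simp [diagR, sum_idem]

lemma diagR_mul (r r' : Fin 4 → ℂ) : (diagR r * diagR r' : Q4 V) = diagR (r * r') := by
  refine Q4.ext_entry fun k j => ?_
  rw [entry_diagR_mul, entry_diagR, entry_diagR]
  split_ifs <;> simp [Algebra.smul_def]

lemma idem_mul_diagR (r : Fin 4 → ℂ) (j : Fin 4) : (idem j * diagR r : Q4 V) = r j • idem j := by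
  refine Q4.ext_entry fun k i => ?_
  rw [entry_mul_diagR, map_smul, entry_idem]
  split_ifs with h
  · rw [h.2]
  · simp

lemma diagR_mul_idem (r : Fin 4 → ℂ) (j : Fin 4) : (diagR r * idem j : Q4 V) = r j • idem j := by
  refine Q4.ext_entry fun k i => ?_
  rw [entry_diagR_mul, map_smul, entry_idem]
  split_ifs with h
  · rw [h.1]
  · simp

lemma entry_arrow (v : V) (i k j : Fin 4) :
    entry k j (arrow v i) = if i + 1 = k ∧ i = j then ExteriorAlgebra.ι ℂ v else 0 :=
  Matrix.single_apply _ _ _ _ _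

/-- The sum of all the morphisms given by a vector. -/
def arrowSum : V →ₗ[ℂ] Q4 V where
  toFun v := ∑ j, arrow v j
  map_add' v w := by
    refine Q4.ext_entry fun k j => ?_
    simp only [map_sum, map_add, entry_arrow, ← Finset.sum_add_distrib]
    exact Finset.sum_congr rfl fun i _ => by split_ifs <;> simp
  map_smul' c v := by
    refine Q4.ext_entry fun k j => ?_
    simp only [map_sum, map_smul, entry_arrow, Finset.smul_sum, RingHom.id_apply]
    exact Finset.sum_congr rfl fun i _ => by split_ifs <;> simp

lemma entry_arrowSum (v : V) (k j : Fin 4) :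
    entry k j (arrowSum v) = if j + 1 = k then ExteriorAlgebra.ι ℂ v else 0 := by
  change entry k j (∑ i, arrow v i) = _
  rw [map_sum, Finset.sum_eq_single j (fun i _ hi => by simp [entry_arrow, hi]) (by simp),
    entry_arrow]
  simp

/-- The exterior algebra as a subalgebra of `Q_4`. -/
def emb : ExteriorAlgebra ℂ V →ₐ[ℂ] Q4 V :=
  ExteriorAlgebra.lift ℂ ⟨arrowSum, fun v => by
    refine Q4.ext_entry fun k j => ?_
    rw [entry_mul, map_zero]
    refine Finset.sum_eq_zero fun l _ => ?_
    rw [entry_arrowSum, entry_arrowSum]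
    split_ifs <;> simp⟩

lemma emb_ι (v : V) : emb (ExteriorAlgebra.ι ℂ v) = arrowSum v := ExteriorAlgebra.lift_ι_apply _ _ _ _

lemma entry_emb_ι_mul (v : V) (a : Q4 V) (k j : Fin 4) :
    entry (k + 1) j (emb (ExteriorAlgebra.ι ℂ v) * a) = ExteriorAlgebra.ι ℂ v * entry k j a := by
  rw [entry_mul, emb_ι, Finset.sum_eq_single k (fun l _ hl => ?_) (by simp), entry_arrowSum,
    if_pos rfl]
  rw [entry_arrowSum, if_neg, zero_mul]
  exact fun h => hl (add_right_cancel h)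

lemma entry_mul_emb_ι (v : V) (a : Q4 V) (k j : Fin 4) :
    entry k j (a * emb (ExteriorAlgebra.ι ℂ v)) = entry k (j + 1) a * ExteriorAlgebra.ι ℂ v := by
  rw [entry_mul, emb_ι, Finset.sum_eq_single (j + 1) (fun l _ hl => ?_) (by simp), entry_arrowSum,
    if_pos rfl]
  rw [entry_arrowSum, if_neg (fun h => hl h.symm), mul_zero]

lemma modEq_succ_iff (p : ℕ) (j k : Fin 4) :
    p + 1 + (j : ℕ) ≡ ((k + 1 : Fin 4) : ℕ) [MOD 4] ↔ p + (j : ℕ) ≡ k [MOD 4] := by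
  rw [Fin.val_add]
  have := k.2
  simp only [Nat.ModEq, Fin.isValue, Fin.val_one]
  omega

lemma entry_emb {p : ℕ} {x : ExteriorAlgebra ℂ V} (hx : x ∈ ⋀[ℂ]^p V) (k j : Fin 4) :
    entry k j (emb x) = if p + (j : ℕ) ≡ k [MOD 4] then x else 0 := by
  induction p generalizing x k with
  | zero =>
    obtain ⟨c, rfl⟩ : ∃ c, algebraMap ℂ (ExteriorAlgebra ℂ V) c = x := by
      simpa using hx
    have : (0 + (j : ℕ) ≡ k [MOD 4]) ↔ k = j := by
      rw [Fin.ext_iff]; simp only [Nat.ModEq]; omega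
    rw [AlgHom.commutes, Algebra.algebraMap_eq_smul_one, map_smul, entry_one]
    simp only [this]
    split_ifs <;> simp [Algebra.algebraMap_eq_smul_one]
  | succ p ih =>
    change x ∈ LinearMap.range (ExteriorAlgebra.ι ℂ) ^ (p + 1) at hx
    rw [pow_succ'] at hx
    induction hx using Submodule.mul_induction_on' with
    | mem_mul_mem v hv y hy =>
      obtain ⟨v, rfl⟩ := hv
      obtain ⟨k, rfl⟩ : ∃ k', k = k' + 1 := ⟨k - 1, by simp⟩
      rw [map_mul, entry_emb_ι_mul, ih hy]
      simp only [modEq_succ_iff]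
      split_ifs <;> simp
    | add x _ y _ hx hy =>
      rw [map_add, map_add, hx, hy]
      split_ifs <;> simp

/-- A morphism in `Hom(X_j, X_k)` as an element of `Q_4`. -/
lemma entry_idem_mul_emb_mul_idem {j k : Fin 4} {x : ExteriorAlgebra ℂ V} (hx : x ∈ homSpace V j k) :
    entry k j (emb x) = x ∧ idem k * emb x = idem k * emb x * idem j := by
  have key : homSpace V j k ≤
      LinearMap.ker ((entry k j).comp emb.toLinearMap - LinearMap.id) ⊓
      LinearMap.ker ((LinearMap.mulLeft ℂ (idem k)).comp emb.toLinearMap -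
        (LinearMap.mulRight ℂ (idem j)).comp
          ((LinearMap.mulLeft ℂ (idem k)).comp emb.toLinearMap)) := by
    refine iSup₂_le fun p hp y hy => ⟨?_, ?_⟩
    · simp [entry_emb hy, hp]
    · change idem k * emb y - idem k * emb y * idem j = 0
      rw [sub_eq_zero]
      refine Q4.ext_entry fun k' j' => ?_
      rw [entry_mul_idem, entry_idem_mul, entry_emb hy]
      by_cases hk : k = k'
      · subst hk
        by_cases hj : j = j'
        · simp [hj]
        · have : ¬ (p + (j' : ℕ) ≡ k [MOD 4]) := fun h => hj (Fin.ext (by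
            have := j.2; have := j'.2
            simp only [Nat.ModEq] at h hp; omega))
          simp [this]
      · simp [hk]
  exact ⟨sub_eq_zero.mp (key hx).1, sub_eq_zero.mp (key hx).2⟩

/-- Every component of an element of Q_4 is an idempotent times an element of the embedded exterior
algebra; R_4 and ΛV together generate Q_4. -/
lemma idem_mul_emb_entry (a : Q4 V) (k j : Fin 4) :
    idem k * emb (entry k j a) = idem k * a * idem j := by
  obtain ⟨h1, h2⟩ := entry_idem_mul_emb_mul_idem (entry_mem a k j)
  rw [h2]
  refine Q4.ext_entry fun k' j' => ?_
  rw [entry_mul_idem, entry_mul_idem, entry_idem_mul, entry_idem_mul]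
  split_ifs with hj hk
  · subst hj hk; exact h1
  · rfl
  · rfl

lemma sum_idem_mul_emb_entry (a : Q4 V) (j : Fin 4) :
    ∑ k, idem k * emb (entry k j a) = a * idem j := by
  simp_rw [idem_mul_emb_entry, ← Finset.sum_mul, sum_idem, one_mul]

lemma entry_rhoG (g : V ≃ₗ[ℂ] V) (a : Q4 V) (k j : Fin 4) :
    entry k j (rhoG g a) = ExteriorAlgebra.map (g : V →ₗ[ℂ] V) (entry k j a) := rfl

lemma rhoG_mul (g : V ≃ₗ[ℂ] V) (a a' : Q4 V) : rhoG g (a * a') = rhoG g a * rhoG g a' := by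
  refine Q4.ext_entry fun k j => ?_
  simp only [entry_rhoG, entry_mul, map_sum, map_mul]

lemma rhoG_diagR (g : V ≃ₗ[ℂ] V) (r : Fin 4 → ℂ) : rhoG g (diagR r) = diagR r := by
  refine Q4.ext_entry fun k j => ?_
  rw [entry_rhoG, entry_diagR]
  split_ifs <;> simp

lemma rhoG_of_mem_R4 (g : V ≃ₗ[ℂ] V) {r : Q4 V} (hr : r ∈ R4 V) : rhoG g r = r := by
  obtain ⟨r, rfl⟩ := mem_R4_iff.mp hr; exact rhoG_diagR g r

lemma rhoG_one (g : V ≃ₗ[ℂ] V) : rhoG g (1 : Q4 V) = 1 := by rw [← diagR_one, rhoG_diagR]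

lemma rhoG_trans (g g' : V ≃ₗ[ℂ] V) (a : Q4 V) : rhoG (g.trans g') a = rhoG g' (rhoG g a) := by
  refine Q4.ext_entry fun k j => ?_
  simp only [entry_rhoG]
  have : ExteriorAlgebra.map (g.trans g' : V →ₗ[ℂ] V) =
      (ExteriorAlgebra.map (g' : V →ₗ[ℂ] V)).comp (ExteriorAlgebra.map (g : V →ₗ[ℂ] V)) := by
    rw [ExteriorAlgebra.map_comp_map]; rfl
  rw [this]; rfl

lemma rhoG_refl (a : Q4 V) : rhoG (LinearEquiv.refl ℂ V) a = a := by
  refine Q4.ext_entry fun k j => ?_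
  rw [entry_rhoG, LinearEquiv.refl_toLinearMap, ExteriorAlgebra.map_id]; rfl

lemma rhoG_emb (g : V ≃ₗ[ℂ] V) (x : ExteriorAlgebra ℂ V) :
    rhoG g (emb x) = emb (ExteriorAlgebra.map (g : V →ₗ[ℂ] V) x) := by
  let G : Q4 V →ₐ[ℂ] Q4 V := AlgHom.ofLinearMap (rhoG g) (rhoG_one g) (rhoG_mul g)
  have : G.comp emb = emb.comp (ExteriorAlgebra.map (g : V →ₗ[ℂ] V)) := by
    refine ExteriorAlgebra.hom_ext (LinearMap.ext fun v => ?_)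
    change rhoG g (emb (ExteriorAlgebra.ι ℂ v)) =
      emb (ExteriorAlgebra.map (g : V →ₗ[ℂ] V) (ExteriorAlgebra.ι ℂ v))
    rw [ExteriorAlgebra.map_apply_ι, emb_ι, emb_ι]
    refine Q4.ext_entry fun k j => ?_
    rw [entry_rhoG, entry_arrowSum, entry_arrowSum]
    split_ifs <;> simp
  exact DFunLike.congr_fun this x

/-- Multiplication by a nonzero scalar. -/
def scal (c : ℂˣ) : V ≃ₗ[ℂ] V := LinearEquiv.smulOfUnit c

lemma map_scal (c : ℂˣ) {p : ℕ} {x : ExteriorAlgebra ℂ V} (hx : x ∈ ⋀[ℂ]^p V) :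
    ExteriorAlgebra.map ((scal c : V ≃ₗ[ℂ] V) : V →ₗ[ℂ] V) x = (c : ℂ) ^ p • x := by
  induction p generalizing x with
  | zero =>
    obtain ⟨c, rfl⟩ : ∃ c, algebraMap ℂ (ExteriorAlgebra ℂ V) c = x := by
      simpa using hx
    simp
  | succ p ih =>
    change x ∈ LinearMap.range (ExteriorAlgebra.ι ℂ) ^ (p + 1) at hx
    rw [pow_succ'] at hx
    induction hx using Submodule.mul_induction_on' with
    | mem_mul_mem v hv y hy =>
      obtain ⟨v, rfl⟩ := hv
      have : ((scal c : V ≃ₗ[ℂ] V) : V →ₗ[ℂ] V) v = (c : ℂ) • v := rfl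
      rw [map_mul, ih hy, ExteriorAlgebra.map_apply_ι, this, map_smul, smul_mul_smul_comm, pow_succ']
    | add x _ y _ hx hy => rw [map_add, hx, hy, smul_add]

end Entries

/-! ### The filtration by exterior degree. -/

section Projections

variable {V : Type*} [AddCommGroup V] [Module ℂ V]

/-- The projection of the exterior algebra to its degree `p` part. -/
def extProj (p : ℕ) : ExteriorAlgebra ℂ V →ₗ[ℂ] ExteriorAlgebra ℂ V :=
  GradedAlgebra.proj (fun i : ℕ => ⋀[ℂ]^i V) p

lemma extProj_mem (p : ℕ) (x : ExteriorAlgebra ℂ V) : extProj p x ∈ ⋀[ℂ]^p V :=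
  SetLike.coe_mem _

lemma extProj_of_mem {p : ℕ} {x : ExteriorAlgebra ℂ V} (hx : x ∈ ⋀[ℂ]^p V) (q : ℕ) :
    extProj q x = if p = q then x else 0 := by
  split_ifs with h
  · subst h; exact DirectSum.decompose_of_mem_same (fun i : ℕ => ⋀[ℂ]^i V) hx
  · exact DirectSum.decompose_of_mem_ne (fun i : ℕ => ⋀[ℂ]^i V) hx h

lemma sum_extProj (x : ExteriorAlgebra ℂ V) : ∃ s : Finset ℕ, ∑ p ∈ s, extProj p x = x := by
  classical
  exact ⟨_, DirectSum.sum_support_decompose (fun i : ℕ => ⋀[ℂ]^i V) x⟩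

lemma ext_extProj {x y : ExteriorAlgebra ℂ V} (h : ∀ p, extProj p x = extProj p y) : x = y := by
  rw [← sub_eq_zero]
  obtain ⟨s, hs⟩ := sum_extProj (x - y)
  rw [← hs]
  exact Finset.sum_eq_zero fun p _ => by rw [map_sub, h, sub_self]

lemma ext_on_exteriorPower {Z : Type*} [AddCommGroup Z] [Module ℂ Z]
    {f g : ExteriorAlgebra ℂ V →ₗ[ℂ] Z} (h : ∀ p, ∀ x ∈ ⋀[ℂ]^p V, f x = g x) : f = g := by
  refine LinearMap.ext fun x => ?_
  obtain ⟨s, hs⟩ := sum_extProj x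
  rw [← hs, map_sum, map_sum]
  exact Finset.sum_congr rfl fun p _ => h p _ (extProj_mem p x)

lemma extProj_zero (x : ExteriorAlgebra ℂ V) : extProj 0 x = algebraMap ℂ _ (aug x) := by
  have : (extProj 0 : ExteriorAlgebra ℂ V →ₗ[ℂ] _) =
      (Algebra.linearMap ℂ (ExteriorAlgebra ℂ V)).comp aug.toLinearMap := by
    refine ext_on_exteriorPower fun p x hx => ?_
    rw [extProj_of_mem hx]
    cases p with
    | zero =>
      obtain ⟨c, rfl⟩ : ∃ c, algebraMap ℂ (ExteriorAlgebra ℂ V) c = x := by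
        simpa using hx
      simp
    | succ p =>
      rw [if_neg (by omega)]
      change x ∈ LinearMap.range (ExteriorAlgebra.ι ℂ) ^ (p + 1) at hx
      rw [pow_succ'] at hx
      induction hx using Submodule.mul_induction_on' with
      | mem_mul_mem v hv y hy =>
        obtain ⟨v, rfl⟩ := hv
        simp
      | add x _ y _ hx hy => rw [map_add, ← hx, ← hy, add_zero]
  exact DFunLike.congr_fun this x

lemma map_mem_exteriorPower (f : V →ₗ[ℂ] V) {p : ℕ} {x : ExteriorAlgebra ℂ V} (hx : x ∈ ⋀[ℂ]^p V) :
    ExteriorAlgebra.map f x ∈ ⋀[ℂ]^p V := by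
  induction p generalizing x with
  | zero =>
    obtain ⟨c, rfl⟩ : ∃ c, algebraMap ℂ (ExteriorAlgebra ℂ V) c = x := by
      simpa using hx
    simp
  | succ p ih =>
    change x ∈ LinearMap.range (ExteriorAlgebra.ι ℂ) ^ (p + 1) at hx
    change _ ∈ LinearMap.range (ExteriorAlgebra.ι ℂ) ^ (p + 1)
    rw [pow_succ'] at hx ⊢
    induction hx using Submodule.mul_induction_on' with
    | mem_mul_mem v hv y hy =>
      obtain ⟨v, rfl⟩ := hv
      rw [map_mul, ExteriorAlgebra.map_apply_ι]
      exact Submodule.mul_mem_mul ⟨_, rfl⟩ (ih hy)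
    | add x _ y _ hx hy => rw [map_add]; exact add_mem hx hy

lemma extProj_map (f : V →ₗ[ℂ] V) (p : ℕ) (x : ExteriorAlgebra ℂ V) :
    extProj p (ExteriorAlgebra.map f x) = ExteriorAlgebra.map f (extProj p x) := by
  have : (extProj p).comp (ExteriorAlgebra.map f).toLinearMap =
      (ExteriorAlgebra.map f).toLinearMap.comp (extProj p) := by
    refine ext_on_exteriorPower fun q x hx => ?_
    simp only [LinearMap.comp_apply, AlgHom.toLinearMap_apply]
    rw [extProj_of_mem hx, extProj_of_mem (map_mem_exteriorPower f hx)]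
    split_ifs <;> simp
  exact DFunLike.congr_fun this x

lemma extProj_ι_mul (v : V) (p : ℕ) (x : ExteriorAlgebra ℂ V) :
    extProj (p + 1) (ExteriorAlgebra.ι ℂ v * x) = ExteriorAlgebra.ι ℂ v * extProj p x := by
  have : (extProj (p + 1)).comp (LinearMap.mulLeft ℂ (ExteriorAlgebra.ι ℂ v)) =
      (LinearMap.mulLeft ℂ (ExteriorAlgebra.ι ℂ v)).comp (extProj p) := by
    refine ext_on_exteriorPower fun q x hx => ?_
    have h : ExteriorAlgebra.ι ℂ v * x ∈ ⋀[ℂ]^(q + 1) V := by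
      change _ ∈ LinearMap.range (ExteriorAlgebra.ι ℂ) ^ (q + 1)
      rw [pow_succ']
      exact Submodule.mul_mem_mul ⟨_, rfl⟩ hx
    simp only [LinearMap.comp_apply, LinearMap.mulLeft_apply]
    rw [extProj_of_mem hx, extProj_of_mem h]
    simp
  exact DFunLike.congr_fun this x

lemma extProj_mul_ι (v : V) (p : ℕ) (x : ExteriorAlgebra ℂ V) :
    extProj (p + 1) (x * ExteriorAlgebra.ι ℂ v) = extProj p x * ExteriorAlgebra.ι ℂ v := by
  have : (extProj (p + 1)).comp (LinearMap.mulRight ℂ (ExteriorAlgebra.ι ℂ v)) =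
      (LinearMap.mulRight ℂ (ExteriorAlgebra.ι ℂ v)).comp (extProj p) := by
    refine ext_on_exteriorPower fun q x hx => ?_
    have h : x * ExteriorAlgebra.ι ℂ v ∈ ⋀[ℂ]^(q + 1) V := by
      change _ ∈ LinearMap.range (ExteriorAlgebra.ι ℂ) ^ (q + 1)
      rw [pow_succ]
      exact Submodule.mul_mem_mul hx ⟨_, rfl⟩
    simp only [LinearMap.comp_apply, LinearMap.mulRight_apply]
    rw [extProj_of_mem hx, extProj_of_mem h]
    simp
  exact DFunLike.congr_fun this x

lemma extProj_eq_zero (b : Module.Basis (Fin 4) ℂ V) {p : ℕ} (hp : 4 < p)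
    (x : ExteriorAlgebra ℂ V) : extProj p x = 0 := by
  have := Module.Finite.of_basis b
  have h0 : Module.finrank ℂ (⋀[ℂ]^p V) = 0 := by
    rw [exteriorPower.finrank_eq, Module.finrank_eq_card_basis b, Fintype.card_fin]
    exact Nat.choose_eq_zero_of_lt hp
  have := Module.finrank_zero_iff.mp h0
  have h := Subsingleton.elim (⟨extProj p x, extProj_mem p x⟩ : ⋀[ℂ]^p V) 0
  exact congrArg Subtype.val h

lemma extProj_of_mem_homSpace {j k : Fin 4} {x : ExteriorAlgebra ℂ V} (hx : x ∈ homSpace V j k)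
    (p : ℕ) : extProj p x = if p + (j : ℕ) ≡ k [MOD 4] then extProj p x else 0 := by
  split_ifs with h
  · rfl
  · have key : homSpace V j k ≤ LinearMap.ker (extProj p : ExteriorAlgebra ℂ V →ₗ[ℂ] _) := by
      refine iSup₂_le fun q hq y hy => ?_
      rw [LinearMap.mem_ker, extProj_of_mem hy, if_neg]
      rintro rfl; exact h hq
    exact key hx

/-- The projection of `Q_4` to the part of exterior degree `p`. -/
def qProj (p : ℕ) : Q4 V →ₗ[ℂ] Q4 V where
  toFun a := ⟨(a : Matrix (Fin 4) (Fin 4) (ExteriorAlgebra ℂ V)).map (extProj p), fun j k => by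
    change extProj p (entry k j a) ∈ _
    rw [extProj_of_mem_homSpace (entry_mem a k j)]
    split_ifs with h
    · exact mem_homSpace h (extProj_mem p _)
    · exact zero_mem _⟩
  map_add' a a' := by ext; simp
  map_smul' c a := by ext; simp

lemma entry_qProj (p : ℕ) (a : Q4 V) (k j : Fin 4) : entry k j (qProj p a) = extProj p (entry k j a) :=
  rfl

lemma qProj_qProj (p q : ℕ) (a : Q4 V) : qProj q (qProj p a) = if p = q then qProj p a else 0 := by
  refine Q4.ext_entry fun k j => ?_
  rw [entry_qProj, entry_qProj, extProj_of_mem (extProj_mem p _)]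
  split_ifs <;> simp [entry_qProj]

lemma qProj_rhoG (p : ℕ) (g : V ≃ₗ[ℂ] V) (a : Q4 V) : qProj p (rhoG g a) = rhoG g (qProj p a) :=
  Q4.ext_entry fun _ _ => extProj_map _ _ _

lemma ext_qProj (b : Module.Basis (Fin 4) ℂ V) {a : Q4 V} (h : ∀ p, p ≤ 4 → qProj p a = 0) : a = 0 := by
  refine Q4.ext_entry fun k j => ext_extProj fun p => ?_
  rw [map_zero, map_zero]
  by_cases hp : p ≤ 4
  · have := congrArg (entry k j) (h p hp)
    simpa [entry_qProj] using this
  · exact extProj_eq_zero b (by omega) _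

lemma qProj_emb_ι_mul (v : V) (p : ℕ) (a : Q4 V) :
    qProj (p + 1) (emb (ExteriorAlgebra.ι ℂ v) * a) = emb (ExteriorAlgebra.ι ℂ v) * qProj p a := by
  refine Q4.ext_entry fun k j => ?_
  obtain ⟨k, rfl⟩ : ∃ k', k = k' + 1 := ⟨k - 1, by simp⟩
  rw [entry_qProj, entry_emb_ι_mul, entry_emb_ι_mul, extProj_ι_mul, entry_qProj]

lemma qProj_mul_emb_ι (v : V) (p : ℕ) (a : Q4 V) :
    qProj (p + 1) (a * emb (ExteriorAlgebra.ι ℂ v)) = qProj p a * emb (ExteriorAlgebra.ι ℂ v) := by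
  refine Q4.ext_entry fun k j => ?_
  rw [entry_qProj, entry_mul_emb_ι, entry_mul_emb_ι, extProj_mul_ι, entry_qProj]

lemma qProj_zero_emb_ι_mul (v : V) (a : Q4 V) :
    qProj 0 (emb (ExteriorAlgebra.ι ℂ v) * a) = 0 := by
  refine Q4.ext_entry fun k j => ?_
  obtain ⟨k, rfl⟩ : ∃ k', k = k' + 1 := ⟨k - 1, by simp⟩
  rw [entry_qProj, entry_emb_ι_mul, extProj_zero]
  simp

lemma qProj_zero_mul_emb_ι (v : V) (a : Q4 V) :
    qProj 0 (a * emb (ExteriorAlgebra.ι ℂ v)) = 0 := by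
  refine Q4.ext_entry fun k j => ?_
  rw [entry_qProj, entry_mul_emb_ι, extProj_zero]
  simp

/-- Multiplication acts through the augmentation on the lowest degree part. -/
lemma qProj_emb_mul (x : ExteriorAlgebra ℂ V) {q : ℕ} {a : Q4 V} (ha : ∀ p < q, qProj p a = 0) :
    (∀ p < q, qProj p (emb x * a) = 0) ∧ qProj q (emb x * a) = aug x • qProj q a := by
  induction x using CliffordAlgebra.left_induction with
  | algebraMap r =>
    change (∀ p < q, qProj p (emb (algebraMap ℂ (ExteriorAlgebra ℂ V) r) * a) = 0) ∧
      qProj q (emb (algebraMap ℂ (ExteriorAlgebra ℂ V) r) * a) =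
        aug (algebraMap ℂ (ExteriorAlgebra ℂ V) r) • qProj q a
    rw [AlgHom.commutes, AlgHom.commutes, ← Algebra.smul_def]
    refine ⟨fun p hp => ?_, ?_⟩
    · rw [map_smul, ha p hp, smul_zero]
    · rw [map_smul]; rfl
  | add x y hx hy =>
    simp only [map_add, add_mul, add_smul]
    exact ⟨fun p hp => by rw [hx.1 p hp, hy.1 p hp, add_zero], by rw [hx.2, hy.2]⟩
  | ι_mul x v hx =>
    change (∀ p < q, qProj p (emb (ExteriorAlgebra.ι ℂ v * x) * a) = 0) ∧
      qProj q (emb (ExteriorAlgebra.ι ℂ v * x) * a) = aug (ExteriorAlgebra.ι ℂ v * x) • qProj q a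
    have key : ∀ p ≤ q, qProj p (emb (ExteriorAlgebra.ι ℂ v * x) * a) = 0 := by
      intro p hp
      rw [map_mul emb, mul_assoc]
      cases p with
      | zero => exact qProj_zero_emb_ι_mul v _
      | succ p => rw [qProj_emb_ι_mul, hx.1 p hp, mul_zero]
    exact ⟨fun p hp => key p hp.le, by rw [key q le_rfl]; simp⟩

lemma qProj_mul_emb (x : ExteriorAlgebra ℂ V) {q : ℕ} {a : Q4 V} (ha : ∀ p < q, qProj p a = 0) :
    (∀ p < q, qProj p (a * emb x) = 0) ∧ qProj q (a * emb x) = aug x • qProj q a := by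
  induction x using CliffordAlgebra.right_induction with
  | algebraMap r =>
    change (∀ p < q, qProj p (a * emb (algebraMap ℂ (ExteriorAlgebra ℂ V) r)) = 0) ∧
      qProj q (a * emb (algebraMap ℂ (ExteriorAlgebra ℂ V) r)) =
        aug (algebraMap ℂ (ExteriorAlgebra ℂ V) r) • qProj q a
    rw [AlgHom.commutes, AlgHom.commutes, ← Algebra.commutes, ← Algebra.smul_def]
    refine ⟨fun p hp => ?_, ?_⟩
    · rw [map_smul, ha p hp, smul_zero]
    · rw [map_smul]; rfl
  | add x y hx hy =>
    simp only [map_add, mul_add, add_smul]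
    exact ⟨fun p hp => by rw [hx.1 p hp, hy.1 p hp, add_zero], by rw [hx.2, hy.2]⟩
  | mul_ι v x hx =>
    change (∀ p < q, qProj p (a * emb (x * ExteriorAlgebra.ι ℂ v)) = 0) ∧
      qProj q (a * emb (x * ExteriorAlgebra.ι ℂ v)) = aug (x * ExteriorAlgebra.ι ℂ v) • qProj q a
    have key : ∀ p ≤ q, qProj p (a * emb (x * ExteriorAlgebra.ι ℂ v)) = 0 := by
      intro p hp
      rw [map_mul emb, ← mul_assoc]
      cases p with
      | zero => exact qProj_zero_mul_emb_ι v _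
      | succ p => rw [qProj_mul_emb_ι, hx.1 p hp, zero_mul]
    exact ⟨fun p hp => key p hp.le, by rw [key q le_rfl]; simp⟩

end Projections

/-! ### The grading of Q_4 expressed through scalings. -/

section Degrees

variable {V : Type*} [AddCommGroup V] [Module ℂ V]

lemma mem_degree_iff {a : Q4 V} {n : ℤ} :
    a ∈ Q4.degree V n ↔ ∀ j k, entry k j a ∈ homDegree V j k n := Iff.rfl

lemma eq_smul_of_mem_homDegree {j k : Fin 4} {n : ℤ} {f : ExteriorAlgebra ℂ V →ₗ[ℂ] ExteriorAlgebra ℂ V}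
    {c : ℂ} (h : ∀ p : ℕ, p + (j : ℕ) ≡ k [MOD 4] → (p : ℤ) + (k : ℕ) = 2 * n + (j : ℕ) →
      ∀ x ∈ ⋀[ℂ]^p V, f x = c • x)
    {x : ExteriorAlgebra ℂ V} (hx : x ∈ homDegree V j k n) : f x = c • x := by
  have key : homDegree V j k n ≤ LinearMap.ker (f - c • LinearMap.id) := by
    refine iSup₂_le fun p hp y hy => ?_
    simp [h p hp.1 hp.2 y hy]
  simpa [sub_eq_zero] using key hx

/-- The automorphism acting by `c ^ (2 n)` on the degree `n` part. -/
def psi (c : ℂˣ) : Q4 V →ₗ[ℂ] Q4 V :=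
  (LinearMap.mulLeft ℂ (diagR fun k => (c : ℂ) ^ (k : ℕ))).comp
    ((LinearMap.mulRight ℂ (diagR fun k => ((c : ℂ) ^ (k : ℕ))⁻¹)).comp (rhoG (scal c)))

lemma entry_psi (c : ℂˣ) (a : Q4 V) (k j : Fin 4) : entry k j (psi c a) =
    ((c : ℂ) ^ (k : ℕ) * ((c : ℂ) ^ (j : ℕ))⁻¹) •
      ExteriorAlgebra.map ((scal c : V ≃ₗ[ℂ] V) : V →ₗ[ℂ] V) (entry k j a) := by
  simp [psi, entry_diagR_mul, entry_mul_diagR, entry_rhoG, smul_smul]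

lemma zpow_aux {c : ℂ} (hc : c ≠ 0) {p j k : ℕ} {n : ℤ} (h : (p : ℤ) + k = 2 * n + j) :
    c ^ k * (c ^ j)⁻¹ * c ^ p = c ^ (2 * n) := by
  rw [← zpow_natCast c k, ← zpow_natCast c j, ← zpow_natCast c p, ← zpow_neg, ← zpow_add₀ hc,
    ← zpow_add₀ hc]
  congr 1
  omega

lemma psi_of_mem (c : ℂˣ) {n : ℤ} {a : Q4 V} (ha : a ∈ Q4.degree V n) :
    psi c a = (c : ℂ) ^ (2 * n) • a := by
  refine Q4.ext_entry fun k j => ?_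
  rw [map_smul, entry_psi]
  refine eq_smul_of_mem_homDegree (f := ((c : ℂ) ^ (k : ℕ) * ((c : ℂ) ^ (j : ℕ))⁻¹) •
    (ExteriorAlgebra.map ((scal c : V ≃ₗ[ℂ] V) : V →ₗ[ℂ] V)).toLinearMap)
    (fun p _ hp x hx => ?_) (mem_degree_iff.mp ha j k)
  rw [LinearMap.smul_apply, AlgHom.toLinearMap_apply, map_scal c hx, smul_smul,
    zpow_aux c.ne_zero hp]

/-- If c is not a root of unity, its powers separate exterior degrees, so being homogeneous becomes
an eigenvalue condition. -/
lemma mem_of_psi {c : ℂˣ} (hc : ∀ m : ℤ, (c : ℂ) ^ m = 1 → m = 0) {n : ℤ} {a : Q4 V}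
    (ha : psi c a = (c : ℂ) ^ (2 * n) • a) : a ∈ Q4.degree V n := by
  refine mem_degree_iff.mpr fun j k => ?_
  have h := congrArg (entry k j) ha
  rw [map_smul, entry_psi] at h
  have hx := entry_mem a k j
  obtain ⟨s, hs⟩ := sum_extProj (entry k j a)
  rw [← hs]
  refine sum_mem fun p _ => ?_
  by_cases h0 : extProj p (entry k j a) = 0
  · rw [h0]; exact zero_mem _
  have h1 : p + (j : ℕ) ≡ k [MOD 4] := by
    by_contra h1
    rw [extProj_of_mem_homSpace hx, if_neg h1] at h0
    exact h0 rfl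
  refine Submodule.mem_iSup_of_mem p (Submodule.mem_iSup_of_mem ⟨h1, ?_⟩ (extProj_mem p _))
  have h2 := congrArg (extProj p) h
  rw [map_smul, map_smul, extProj_map, map_scal c (extProj_mem p _), smul_smul] at h2
  have h3 := smul_left_injective ℂ h0 h2
  have hc0 := c.ne_zero
  rw [← zpow_natCast (c : ℂ) k, ← zpow_natCast (c : ℂ) j, ← zpow_natCast (c : ℂ) p, ← zpow_neg,
    ← zpow_add₀ hc0, ← zpow_add₀ hc0] at h3
  have h4 : (c : ℂ) ^ ((k : ℕ) + -((j : ℕ) : ℤ) + (p : ℤ) - 2 * n) = 1 := by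
    rw [zpow_sub₀ hc0, h3, div_self (zpow_ne_zero _ hc0)]
  have := hc _ h4
  omega

lemma idem_mul_mul_idem_mem {p : ℕ} {x : ExteriorAlgebra ℂ V} (hx : x ∈ ⋀[ℂ]^p V) {j k : Fin 4}
    (h : p + (j : ℕ) ≡ k [MOD 4]) :
    idem k * emb x * idem j ∈ Q4.degree V (((p : ℤ) + (k : ℕ) - (j : ℕ)) / 2) := by
  refine mem_degree_iff.mpr fun j' k' => ?_
  rw [entry_mul_idem, entry_idem_mul]
  split_ifs with hj hk
  · subst hj hk
    rw [entry_emb hx, if_pos h]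
    refine Submodule.mem_iSup_of_mem p (Submodule.mem_iSup_of_mem ⟨h, ?_⟩ hx)
    have := j.2; have := k.2
    simp only [Nat.ModEq] at h
    omega
  · exact zero_mem _
  · exact zero_mem _

lemma iSup_degree : ⨆ n, Q4.degree V n = ⊤ := by
  rw [eq_top_iff]
  intro a _
  have h1 : a = ∑ j, ∑ k, idem k * emb (entry k j a) * idem j := by
    have : ∀ j, ∑ k, idem k * emb (entry k j a) * idem j = a * idem j := fun j => by
      rw [← Finset.sum_mul, sum_idem_mul_emb_entry]
      refine Q4.ext_entry fun k' j' => ?_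
      rw [entry_mul_idem]
      split_ifs with h
      · rfl
      · rw [entry_mul_idem, if_neg h]
    rw [Finset.sum_congr rfl fun j _ => this j, ← Finset.mul_sum, sum_idem, mul_one]
  rw [h1]
  refine sum_mem fun j _ => sum_mem fun k _ => ?_
  have key : homSpace V j k ≤ (⨆ n, Q4.degree V n).comap
      ((LinearMap.mulRight ℂ (idem j)).comp ((LinearMap.mulLeft ℂ (idem k)).comp emb.toLinearMap)) :=
    iSup₂_le fun p hp x hx => Submodule.mem_iSup_of_mem _ (idem_mul_mul_idem_mem hx hp)
  exact key (entry_mem a k j)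

/-- The operator `a ↦ (-1)^{|a|} a`. -/
def parity : Q4 V →ₗ[ℂ] Q4 V := rhoG (scal (-1))

/-- A component of exterior degree p = k - j + 4m has degree k - j + 2m, so the two degrees have the
same parity. -/
lemma parity_of_mem {n : ℤ} {a : Q4 V} (ha : a ∈ Q4.degree V n) : parity a = sgn n • a := by
  refine Q4.ext_entry fun k j => ?_
  rw [map_zsmul, ← Int.cast_smul_eq_zsmul ℂ]
  refine eq_smul_of_mem_homDegree
    (f := (ExteriorAlgebra.map ((scal (-1) : V ≃ₗ[ℂ] V) : V →ₗ[ℂ] V)).toLinearMap)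
    (fun p h1 h2 x hx => ?_) (mem_degree_iff.mp ha j k)
  rw [AlgHom.toLinearMap_apply, map_scal _ hx]
  congr 1
  have h : Even ((p : ℤ) - n) := by
    have := j.2; have := k.2
    simp only [Nat.ModEq] at h1
    rw [Int.even_iff]
    omega
  have : sgn n = sgn p := by
    rw [show (p : ℤ) = n + (p - n) by ring, sgn_add, sgn_eq_one h, mul_one]
  rw [this]
  rcases Nat.even_or_odd p with hp | hp
  · rw [sgn_eq_one (by exact_mod_cast hp)]; simp [hp.neg_one_pow]
  · rw [sgn_eq_neg_one (by exact_mod_cast hp)]; simp [hp.neg_one_pow]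

lemma parity_parity (a : Q4 V) : parity (parity a) = a := by
  have h : (scal (-1) : V ≃ₗ[ℂ] V).trans (scal (-1)) = LinearEquiv.refl ℂ V := by
    ext v
    change (-1 : ℂˣ) • ((-1 : ℂˣ) • v) = v
    simp
  rw [parity, ← rhoG_trans, h, rhoG_refl]

lemma rhoG_scal_comm (c : ℂˣ) (g : V ≃ₗ[ℂ] V) (a : Q4 V) :
    rhoG (scal c) (rhoG g a) = rhoG g (rhoG (scal c) a) := by
  have h : g.trans (scal c : V ≃ₗ[ℂ] V) = (scal c : V ≃ₗ[ℂ] V).trans g := by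
    ext v
    change (c : ℂ) • g v = g ((c : ℂ) • v)
    rw [map_smul]
  rw [← rhoG_trans, ← rhoG_trans, h]

lemma isSign_parity (b : Module.Basis (Fin 4) ℂ V) (lift : projTorus b → torus b) :
    IsSign (Q4.degree V) (R4 V) (rhoT b lift) (-parity) where
  apply p a ha := by rw [LinearMap.neg_apply, parity_of_mem ha, sgn_sub_one, neg_smul]
  mul_left r hr a := by
    rw [LinearMap.neg_apply, LinearMap.neg_apply, parity, rhoG_mul, rhoG_of_mem_R4 _ hr]
    exact (mul_neg r _).symm
  mul_right r hr a := by
    rw [LinearMap.neg_apply, LinearMap.neg_apply, parity, rhoG_mul, rhoG_of_mem_R4 _ hr]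
    exact (neg_mul _ r).symm
  rho t a := by
    rw [LinearMap.neg_apply, LinearMap.neg_apply, map_neg]
    exact congrArg _ (rhoG_scal_comm _ _ _)
  invol a := by rw [LinearMap.neg_apply, LinearMap.neg_apply, map_neg, neg_neg, parity_parity]

end Degrees

/-! ### Conjugation with elements of R_4. -/

section Symmetry

variable {V : Type*} [AddCommGroup V] [Module ℂ V]

/-- Conjugation with an invertible element of `R`. -/
lemma conj_cons {A : Type*} [Ring A] [Algebra ℂ A] {R : Subalgebra ℂ A} {f : List A → A}
    (hb : Bal R f) (hl : LastLin R f) {r r' : A} (hr : r ∈ R) (h : r' * r = 1) (x : A) (l : List A) :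
    f ((r * x) :: l.map fun a => r * (a * r')) = r * f (x :: l) := by
  induction l generalizing f x with
  | nil => exact hl r hr [] x
  | cons y l ih =>
    have h1 := hb r hr [] (l.map fun a => r * (a * r')) x (r * (y * r'))
    simp only [List.nil_append] at h1
    rw [List.map_cons, ← h1, mul_assoc, mul_assoc, h, mul_one]
    exact ih (f := fun l => f (x :: l)) (fun r hr u v => hb r hr (x :: u) v)
      (fun r hr u => hl r hr (x :: u)) y

lemma conj_eq {A : Type*} [Ring A] [Algebra ℂ A] {R : Subalgebra ℂ A} {f : List A → A}
    (hb : Bal R f) (hl : LastLin R f) (hh : HeadLin R f) {r r' : A} (hr : r ∈ R) (hr' : r' ∈ R)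
    (h : r' * r = 1) (x : A) (l : List A) :
    f ((x :: l).map fun a => r * (a * r')) = r * (f (x :: l) * r') := by
  rw [List.map_cons, conj_cons hb hl hr h, hh r' hr']

lemma conj_diagR_mul (c : ℂˣ) (a : Q4 V) : psi c a =
    diagR (fun k => (c : ℂ) ^ (k : ℕ)) * (rhoG (scal c) a * diagR fun k => ((c : ℂ) ^ (k : ℕ))⁻¹) :=
  rfl

lemma diagR_pow_inv (c : ℂˣ) : (diagR (fun k => ((c : ℂ) ^ (k : ℕ))⁻¹) *
    diagR (fun k => (c : ℂ) ^ (k : ℕ)) : Q4 V) = 1 := by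
  rw [diagR_mul, ← diagR_one]
  congr 1
  funext k
  simp

/-- For bimodule maps, scaling by the degree is the same as the action of scalars. -/
lemma psi_eq_iff {f : List (Q4 V) → Q4 V} (hb : Bal (R4 V) f) (hl : LastLin (R4 V) f)
    (hh : HeadLin (R4 V) f) (c : ℂˣ) (k : ℂ) (x : Q4 V) (l : List (Q4 V)) :
    f ((x :: l).map (psi c)) = k • psi c (f (x :: l)) ↔
      f ((x :: l).map (rhoG (scal c))) = k • rhoG (scal c) (f (x :: l)) := by
  have h1 : (x :: l).map (psi c) = ((x :: l).map (rhoG (scal c))).map fun a =>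
      diagR (fun k => (c : ℂ) ^ (k : ℕ)) * (a * diagR fun k => ((c : ℂ) ^ (k : ℕ))⁻¹) := by
    simp [conj_diagR_mul]
  rw [h1, List.map_cons (f := rhoG (scal c)), conj_eq hb hl hh (diagR_mem _) (diagR_mem _)
    (diagR_pow_inv c), conj_diagR_mul, ← mul_smul_comm, ← smul_mul_assoc]
  constructor
  · intro h
    have e : ∀ z : Q4 V, diagR (fun k => ((c : ℂ) ^ (k : ℕ))⁻¹) * (diagR (fun k => (c : ℂ) ^ (k : ℕ)) *
        (z * diagR fun k => ((c : ℂ) ^ (k : ℕ))⁻¹)) * diagR (fun k => (c : ℂ) ^ (k : ℕ)) = z := by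
      intro z
      rw [← mul_assoc, ← mul_assoc, diagR_pow_inv, one_mul, mul_assoc, diagR_pow_inv, mul_one]
    rw [← e (f _), h, e]
  · intro h; rw [h]

/-- Scalar fourth roots of unity act by conjugation. -/
lemma rhoG_scal_of_pow {c : ℂˣ} (hc : (c : ℂ) ^ 4 = 1) (a : Q4 V) : rhoG (scal c) a =
    diagR (fun k => (c : ℂ) ^ (k : ℕ)) * (a * diagR fun k => ((c : ℂ) ^ (k : ℕ))⁻¹) := by
  refine Q4.ext_entry fun k j => ?_
  rw [entry_diagR_mul, entry_mul_diagR, smul_smul, entry_rhoG]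
  have key : homSpace V j k ≤ LinearMap.ker
      ((ExteriorAlgebra.map ((scal c : V ≃ₗ[ℂ] V) : V →ₗ[ℂ] V)).toLinearMap -
        ((c : ℂ) ^ (k : ℕ) * ((c : ℂ) ^ (j : ℕ))⁻¹) • LinearMap.id) := by
    refine iSup₂_le fun p hp x hx => ?_
    have h1 : (c : ℂ) ^ p = (c : ℂ) ^ (k : ℕ) * ((c : ℂ) ^ (j : ℕ))⁻¹ := by
      rw [eq_mul_inv_iff_mul_eq₀ (pow_ne_zero _ c.ne_zero), ← pow_add,
        ← Nat.div_add_mod (p + j) 4, ← Nat.div_add_mod k 4, pow_add, pow_add, pow_mul, pow_mul, hc,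
        one_pow, one_pow, hp]
    rw [LinearMap.mem_ker, LinearMap.sub_apply, AlgHom.toLinearMap_apply, map_scal c hx, h1]
    simp
  have := key (entry_mem a k j)
  rw [LinearMap.mem_ker, LinearMap.sub_apply, sub_eq_zero] at this
  simpa using this

end Symmetry

/-! ### Equivariance under all diagonal automorphisms. -/

section Torus

variable {V : Type*} [AddCommGroup V] [Module ℂ V] (b : Module.Basis (Fin 4) ℂ V)

lemma det_diagEquiv (h : Fin 4 → ℂˣ) :
    (LinearEquiv.det (diagEquiv b h) : ℂ) = ∏ i, (h i : ℂ) := by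
  rw [LinearEquiv.coe_det, ← LinearMap.det_toMatrix b]
  have : LinearMap.toMatrix b b (diagEquiv b h : V →ₗ[ℂ] V) =
      Matrix.diagonal fun i => (h i : ℂ) := by
    ext i j
    rw [LinearMap.toMatrix_apply, LinearEquiv.coe_coe, diagEquiv_basis, map_smul,
      Module.Basis.repr_self, Matrix.diagonal_apply]
    by_cases hij : i = j
    · subst hij; simp
    · simp [hij]
  rw [this, Matrix.det_diagonal]

lemma exists_torus_eq {h : Fin 4 → ℂˣ} (hh : ∏ i, (h i : ℂ) = 1) :
    ∃ g : torus b, (g : SpecialLinearGroup ℂ V).1 = diagEquiv b h :=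
  ⟨⟨⟨diagEquiv b h, Units.ext ((det_diagEquiv b h).trans hh)⟩, fun i => ⟨h i, diagEquiv_basis b h i⟩⟩,
    rfl⟩

lemma exists_eq_diagEquiv (g : torus b) :
    ∃ h : Fin 4 → ℂˣ, (g : SpecialLinearGroup ℂ V).1 = diagEquiv b h ∧ ∏ i, (h i : ℂ) = 1 := by
  have hg := g.2
  choose c hc using hg
  have hc0 : ∀ i, c i ≠ 0 := by
    intro i hi
    have h1 := hc i
    rw [hi, zero_smul] at h1
    exact b.ne_zero i ((g : SpecialLinearGroup ℂ V).1.map_eq_zero_iff.mp h1)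
  have h1 : (g : SpecialLinearGroup ℂ V).1 = diagEquiv b fun i => Units.mk0 (c i) (hc0 i) := by
    refine LinearEquiv.toLinearMap_injective (b.ext fun i => ?_)
    exact (hc i).trans (diagEquiv_basis b (fun i => Units.mk0 (c i) (hc0 i)) i).symm
  refine ⟨_, h1, ?_⟩
  rw [← det_diagEquiv b, ← h1, (g : SpecialLinearGroup ℂ V).2]
  rfl

lemma diagEquiv_const (c : ℂˣ) : diagEquiv b (fun _ => c) = scal c := by
  refine LinearEquiv.toLinearMap_injective (b.ext fun i => ?_)
  exact diagEquiv_basis b _ i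

lemma diagEquiv_mul_const (c : ℂˣ) (h : Fin 4 → ℂˣ) :
    diagEquiv b (fun i => c * h i) = (diagEquiv b h).trans (scal c) := by
  refine LinearEquiv.toLinearMap_injective (b.ext fun i => ?_)
  change diagEquiv b _ (b i) = (c : ℂ) • diagEquiv b h (b i)
  rw [diagEquiv_basis, diagEquiv_basis, smul_smul]
  simp

variable {b} {lift : projTorus b → torus b}
  (hlift : ∀ t : projTorus b, (QuotientGroup.mk (lift t) : projTorus b) = t)

-- An element of the torus and the chosen representative of its class differ by a central element,
-- which in dimension four is a scalar whose fourth power is one.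
include hlift in
lemma exists_lift_mul (g : torus b) : ∃ (t : projTorus b) (c : ℂˣ), (c : ℂ) ^ 4 = 1 ∧
    (g : SpecialLinearGroup ℂ V).1 = (scal c : V ≃ₗ[ℂ] V).trans (lift t : SpecialLinearGroup ℂ V).1 := by
  have := Module.Finite.of_basis b
  have := Module.Free.of_basis b
  refine ⟨QuotientGroup.mk g, ?_⟩
  have h1 := QuotientGroup.eq.mp (hlift (QuotientGroup.mk g))
  rw [Subgroup.mem_subgroupOf] at h1
  obtain ⟨r, hr, hz⟩ := SpecialLinearGroup.mem_center_iff.mp h1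
  rw [Module.finrank_eq_card_basis b, Fintype.card_fin] at hr
  have hr0 : r ≠ 0 := by rintro rfl; norm_num at hr
  refine ⟨Units.mk0 r hr0, hr, ?_⟩
  have h2 : (g : SpecialLinearGroup ℂ V) = (lift (QuotientGroup.mk g) : SpecialLinearGroup ℂ V) *
      (((lift (QuotientGroup.mk g))⁻¹ * g : torus b) : SpecialLinearGroup ℂ V) := by
    rw [← Subgroup.coe_mul, mul_inv_cancel_left]
  ext v
  have h3 := DFunLike.congr_fun hz v
  rw [h2]
  exact congrArg ((lift (QuotientGroup.mk g) : SpecialLinearGroup ℂ V).1) h3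

variable {c : ℤ} {f : List (Q4 V) → Q4 V}

/-- Scalar fourth roots of unity act by conjugation with elements of R_4, which commutes with every
bimodule map. Equivariance therefore does not depend on the choice of representatives. -/
lemma Good.scal_root (hf : Good (Q4.degree V) (R4 V) (rhoT b lift) c f) {r : ℂˣ} (hr : (r : ℂ) ^ 4 = 1)
    (l : List (Q4 V)) : f (l.map (rhoG (scal r))) = rhoG (scal r) (f l) := by
  cases l with
  | nil => simp [hf.nil]
  | cons x l =>
    rw [rhoG_scal_of_pow hr (f _), ← conj_eq hf.bal hf.last hf.head (diagR_mem _) (diagR_mem _)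
      (diagR_pow_inv r)]
    congr 1
    exact List.map_congr_left fun a _ => rhoG_scal_of_pow hr a

include hlift in
lemma Good.map_torus (hf : Good (Q4.degree V) (R4 V) (rhoT b lift) c f) (g : torus b) (l : List (Q4 V)) :
    f (l.map (rhoG (g : SpecialLinearGroup ℂ V).1)) = rhoG (g : SpecialLinearGroup ℂ V).1 (f l) := by
  obtain ⟨t, r, hr, hg⟩ := exists_lift_mul hlift g
  have h1 : ∀ a : Q4 V, rhoG (g : SpecialLinearGroup ℂ V).1 a = rhoT b lift t (rhoG (scal r) a) :=
    fun a => by rw [hg, rhoG_trans]; rfl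
  have h2 : l.map (rhoG (g : SpecialLinearGroup ℂ V).1) =
      (l.map (rhoG (scal r))).map (rhoT b lift t) := by
    rw [List.map_map]; exact List.map_congr_left fun a _ => h1 a
  rw [h2, hf.eqv, hf.scal_root hr, h1]

lemma ML.map_psi {Z : Type*} [AddCommGroup Z] [Module ℂ Z] {f : List (Q4 V) → Z} (hf : ML f) (r : ℂˣ)
    {l : List (Q4 V)} {q : ℤ} (hl : HomList (Q4.degree V) l q) :
    f (l.map (psi r)) = (r : ℂ) ^ (2 * (q + l.length)) • f l := by
  induction hl generalizing f with
  | nil => simp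
  | @cons a l p q ha hl ih =>
    rw [List.map_cons, psi_of_mem r ha, hf.head_smul, ih (hf.cons a), smul_smul,
      ← zpow_add₀ r.ne_zero, List.length_cons]
    congr 2
    push_cast
    ring

lemma Good.map_psi (hf : Good (Q4.degree V) (R4 V) (rhoT b lift) c f) (r : ℂˣ) (l : List (Q4 V)) :
    f (l.map (psi r)) = (r : ℂ) ^ (2 * (l.length - c)) • psi r (f l) := by
  have h : ML fun w => f (w.map (psi r)) - (r : ℂ) ^ (2 * (l.length - c)) • psi r (f w) :=
    (hf.ml.map (psi r)).sub ((hf.ml.comp (psi r)).smul _)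
  refine sub_eq_zero.mp (h.eq_zero_of_homList iSup_degree (n := l.length) (fun w q hw hn => ?_) l rfl)
  rw [hf.ml.map_psi r hw, psi_of_mem r (hf.deg w q hw), smul_smul, ← zpow_add₀ r.ne_zero, hn,
    sub_eq_zero]
  congr 2
  ring

/-- Having a degree is an eigenvalue condition for `psi`, and `psi` differs from the scaling only by
a conjugation that bimodule maps respect. -/
lemma Good.map_scal (hf : Good (Q4.degree V) (R4 V) (rhoT b lift) c f) (r : ℂˣ) (l : List (Q4 V)) :
    f (l.map (rhoG (scal r))) = (r : ℂ) ^ (2 * (l.length - c)) • rhoG (scal r) (f l) := by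
  cases l with
  | nil => simp [hf.nil]
  | cons x l =>
    exact (psi_eq_iff hf.bal hf.last hf.head r _ x l).mp (hf.map_psi r (x :: l))

include hlift in
/-- Equivariance under all diagonal automorphisms, up to a power of the determinant. -/
lemma Good.map_diag (hf : Good (Q4.degree V) (R4 V) (rhoT b lift) c f) {m : ℕ} (h : Fin 4 → ℂˣ)
    (l : List (Q4 V)) (hl : (l.length : ℤ) - c = 2 * m) :
    f (l.map (rhoG (diagEquiv b h))) = (∏ i, (h i : ℂ)) ^ m • rhoG (diagEquiv b h) (f l) := by
  -- A fourth root r of the determinant splits h into the scalar r, handled through the degree, and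
  -- a diagonal matrix of determinant one, which lies in the torus.
  obtain ⟨r, hr⟩ := IsAlgClosed.exists_pow_nat_eq (∏ i, (h i : ℂ)) (n := 4) (by norm_num)
  have hr0 : r ≠ 0 := by
    rintro rfl
    rw [zero_pow (by norm_num)] at hr
    exact Finset.prod_ne_zero_iff.mpr (fun i _ => (h i).ne_zero) hr.symm
  set r' := Units.mk0 r hr0
  have h1 : ∏ i, ((r'⁻¹ * h i : ℂˣ) : ℂ) = 1 := by
    simp only [Units.val_mul, Finset.prod_mul_distrib, ← hr]
    simp [r', hr0]
  obtain ⟨g, hg⟩ := exists_torus_eq b h1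
  have h2 : diagEquiv b h = (diagEquiv b fun i => r'⁻¹ * h i).trans (scal r') := by
    rw [← diagEquiv_mul_const]; simp
  have h3 : ∀ a : Q4 V, rhoG (diagEquiv b h) a =
      rhoG (scal r') (rhoG (g : SpecialLinearGroup ℂ V).1 a) :=
    fun a => by rw [h2, rhoG_trans, hg]
  have h4 : l.map (rhoG (diagEquiv b h)) =
      (l.map (rhoG (g : SpecialLinearGroup ℂ V).1)).map (rhoG (scal r')) := by
    rw [List.map_map]; exact List.map_congr_left fun a _ => h3 a
  rw [h4, hf.map_scal, List.length_map, hl, hf.map_torus hlift, h3, ← hr]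
  congr 1
  rw [← pow_mul, show (2 : ℤ) * (2 * m) = ((4 * m : ℕ) : ℤ) by push_cast; ring, zpow_natCast]
  rfl

/-- Equivariant cochains of odd degree vanish. -/
lemma Good.eq_zero_of_odd (hf : Good (Q4.degree V) (R4 V) (rhoT b lift) c f) (l : List (Q4 V))
    (hl : Odd ((l.length : ℤ) - c)) : f l = 0 := by
  -- The scalar i acts by conjugation and so commutes with f; on the other hand the odd degree
  -- produces a factor -1.
  set r : ℂˣ := Units.mk0 Complex.I Complex.I_ne_zero with hr
  have h1 := hf.map_scal r l
  have h4 : (r : ℂ) ^ 4 = 1 := Complex.I_pow_four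
  rw [hf.scal_root h4] at h1
  have h2 : (r : ℂ) ^ (2 * ((l.length : ℤ) - c)) = -1 := by
    rw [zpow_mul]
    have : (r : ℂ) ^ (2 : ℤ) = -1 := by
      rw [show (2 : ℤ) = ((2 : ℕ) : ℤ) by rfl, zpow_natCast]; exact Complex.I_sq
    rw [this, hl.neg_one_zpow]
  rw [h2, neg_one_smul, eq_neg_iff_add_eq_zero, ← two_smul ℂ, smul_eq_zero] at h1
  have h5 := h1.resolve_left two_ne_zero
  have h6 : rhoG (scal r).symm (rhoG (scal r) (f l)) = f l := by
    rw [← rhoG_trans, LinearEquiv.self_trans_symm, rhoG_refl]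
  rw [← h6, h5, map_zero]

lemma two_zpow_eq_one {m : ℤ} (h : (2 : ℂ) ^ m = 1) : m = 0 := by
  have h1 := congrArg (fun z : ℂ => ‖z‖) h
  simp only [norm_zpow, Complex.norm_ofNat, norm_one] at h1
  exact (zpow_eq_one_iff_right₀ (by norm_num) (by norm_num)).mp h1

/-- A criterion for list functions to be cochains. -/
lemma Good.of_diag {s m : ℕ} (hs : 1 ≤ s) (hml : ML f) (hbal : Bal (R4 V) f) (hlast : LastLin (R4 V) f)
    (hhead : HeadLin (R4 V) f) (h0 : ∀ l : List (Q4 V), l.length ≠ s → f l = 0)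
    (hf : ∀ (h : Fin 4 → ℂˣ) (l : List (Q4 V)), l.length = s →
      f (l.map (rhoG (diagEquiv b h))) = (∏ i, (h i : ℂ)) ^ m • rhoG (diagEquiv b h) (f l)) :
    Good (Q4.degree V) (R4 V) (rhoT b lift) (s - 2 * m) f where
  ml := hml
  bal := hbal
  last := hlast
  head := hhead
  nil := h0 [] (by simp; omega)
  eqv t l := by
    by_cases hl : l.length = s
    · obtain ⟨h, h1, h2⟩ := exists_eq_diagEquiv b (lift t)
      have h3 : rhoT b lift t = rhoG (diagEquiv b h) := by rw [rhoT, h1]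
      rw [h3, hf h l hl, h2, one_pow, one_smul]
    · rw [h0 _ hl, map_zero, h0 _ (by simpa using hl)]
  deg l q hq := by
    by_cases hl : l.length = s
    swap
    · rw [h0 _ hl]; exact zero_mem _
    -- The scalar 2 is not a root of unity, so equivariance under it recovers the degree.
    set r : ℂˣ := Units.mk0 2 two_ne_zero with hr
    have h1 := hf (fun _ => r) l hl
    rw [diagEquiv_const, Finset.prod_const, Finset.card_univ, Fintype.card_fin] at h1
    obtain ⟨x, l, rfl⟩ : ∃ x l', l = x :: l' := by
      cases l with
      | nil => simp at hl; omega
      | cons x l => exact ⟨x, l, rfl⟩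
    have h2 := (psi_eq_iff hbal hlast hhead r _ x l).mpr h1
    rw [hml.map_psi r hq] at h2
    refine mem_of_psi (c := r) (fun k hk => two_zpow_eq_one hk) ?_
    have h3 : ((r : ℂ) ^ 4) ^ m ≠ 0 := pow_ne_zero _ (pow_ne_zero _ r.ne_zero)
    refine smul_right_injective (Q4 V) h3 ?_
    change ((r : ℂ) ^ 4) ^ m • psi r (f (x :: l)) = ((r : ℂ) ^ 4) ^ m • _
    rw [← h2, smul_smul, hl, ← pow_mul, ← zpow_natCast, ← zpow_add₀ r.ne_zero]
    congr 2
    push_cast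
    ring

end Torus

/-! ### Equivariant cohomology of the exterior algebra with coefficients in Q_4. -/

section Obstruction

variable {V : Type*} [AddCommGroup V] [Module ℂ V]

/-- The left action of the exterior algebra on `Q_4`. -/
def actL : ExteriorAlgebra ℂ V →ₗ[ℂ] Q4 V →ₗ[ℂ] Q4 V := (LinearMap.mul ℂ (Q4 V)).comp emb.toLinearMap

/-- The right action of the exterior algebra on `Q_4`. -/
def actR : ExteriorAlgebra ℂ V →ₗ[ℂ] Q4 V →ₗ[ℂ] Q4 V :=
  (LinearMap.mul ℂ (Q4 V)).flip.comp emb.toLinearMap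

@[simp] lemma actL_apply (x : ExteriorAlgebra ℂ V) (z : Q4 V) : actL x z = emb x * z := rfl

@[simp] lemma actR_apply (x : ExteriorAlgebra ℂ V) (z : Q4 V) : actR x z = z * emb x := rfl

lemma cobd_actL_cobd (f : List (ExteriorAlgebra ℂ V) → Q4 V) (l : List (ExteriorAlgebra ℂ V)) :
    cobd actL actR (cobd actL actR f) l = 0 := by
  refine cobd_cobd (fun x y z => ?_) (fun x y z => ?_) (fun x y z => ?_) f l
  · simp [mul_assoc]
  · simp [mul_assoc]
  · simp [mul_assoc]

lemma cobd_lin {B Z : Type*} [Ring B] [Algebra ℂ B] [AddCommGroup Z] [Module ℂ Z]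
    (act ract : B →ₗ[ℂ] Z →ₗ[ℂ] Z) (c : ℂ) (f g : List B → Z) (l : List B) :
    cobd act ract (fun l => c • f l + g l) l = c • cobd act ract f l + cobd act ract g l := by
  cases l with
  | nil => simp [cobd]
  | cons x l => rw [cobd, bd_lin, cobd, cobd, map_add, map_smul, smul_sub]; abel

/-- The lowest order part of the bar differential. -/
lemma qProj_bd {q n : ℕ} {f : List (ExteriorAlgebra ℂ V) → Q4 V}
    (hf : ∀ l, List.length l = n → ∀ p < q, qProj p (f l) = 0) (l : List (ExteriorAlgebra ℂ V))
    (hl : l.length = n + 1) :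
    (∀ p < q, qProj p (bd actL f l) = 0) ∧
      qProj q (bd actL f l) = bd (charAct aug) (fun l => qProj q (f l)) l := by
  induction l generalizing f n with
  | nil => simp at hl
  | cons x l ih =>
    cases l with
    | nil =>
      obtain rfl : n = 0 := by simpa using hl.symm
      exact qProj_emb_mul x (hf [] rfl)
    | cons y l =>
      simp only [List.length_cons, add_left_inj] at hl
      have h1 := ih (n := l.length) (f := fun l => f (x :: l))
        (fun w hw => hf _ (by simpa [hw] using hl)) rfl
      rw [bd_cons_cons, bd_cons_cons]
      refine ⟨fun p hp => ?_, ?_⟩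
      · rw [map_sub, h1.1 p hp, hf _ (by simpa using hl) p hp, sub_zero]
      · rw [map_sub, h1.2]

lemma qProj_cobd {q n : ℕ} {f : List (ExteriorAlgebra ℂ V) → Q4 V}
    (hf : ∀ l, List.length l = n → ∀ p < q, qProj p (f l) = 0) (l : List (ExteriorAlgebra ℂ V))
    (hl : l.length = n + 1) :
    (∀ p < q, qProj p (cobd actL actR f l) = 0) ∧ qProj q (cobd actL actR f l) =
      cobd (charAct aug) (charAct aug) (fun l => qProj q (f l)) l := by
  cases l with
  | nil => simp at hl
  | cons x l =>
    have h1 := qProj_bd hf (x :: l) hl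
    have h2 := qProj_mul_emb x (hf l (by simpa using hl))
    refine ⟨fun p hp => ?_, ?_⟩
    · rw [cobd, map_sub, h1.1 p hp, sub_zero]; exact h2.1 p hp
    · rw [cobd, map_sub, h1.2, cobd]
      congr 1
      exact h2.2

variable (b : Module.Basis (Fin 4) ℂ V)

lemma eq_aug_smul {Z : Type*} [AddCommGroup Z] [Module ℂ Z] (g : ExteriorAlgebra ℂ V →ₗ[ℂ] Z)
    (hg : ∀ k x, g (x * ExteriorAlgebra.ι ℂ (b k)) = 0) (x : ExteriorAlgebra ℂ V) :
    g x = aug x • g 1 := by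
  induction x using CliffordAlgebra.right_induction with
  | algebraMap r =>
    change g (algebraMap ℂ (ExteriorAlgebra ℂ V) r) = aug (algebraMap ℂ (ExteriorAlgebra ℂ V) r) • g 1
    rw [Algebra.algebraMap_eq_smul_one, map_smul, map_smul, map_one aug, smul_eq_mul, mul_one]
  | add x y hx hy => rw [map_add, map_add, hx, hy, add_smul]
  | mul_ι v x hx =>
    change g (x * ExteriorAlgebra.ι ℂ v) = aug (x * ExteriorAlgebra.ι ℂ v) • g 1
    have h1 : g (x * ExteriorAlgebra.ι ℂ v) = 0 := by
      conv_lhs => rw [← b.sum_repr v]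
      simp only [map_sum, map_smul, Finset.mul_sum, mul_smul_comm, hg, smul_zero,
        Finset.sum_const_zero]
    rw [h1]; simp

lemma ev_eq_zero {B Z : Type*} [Ring B] [Algebra ℂ B] [AddCommGroup Z] [Module ℂ Z] {N : ℕ}
    (lam : Fin N → B →ₗ[ℂ] ℂ) (n : ℕ) {c : List (Fin N) → Z} {l : List B}
    (hc : ∀ I : List (Fin N), I.length = l.length → c I = 0) : ev lam n c l = 0 := by
  induction l generalizing n c with
  | nil => exact hc [] rfl
  | cons x l ih =>
    rw [ev]
    refine Finset.sum_eq_zero fun k _ => ?_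
    rw [ih (k + 1) fun I hI => hc _ (by simpa using hI), smul_zero, ite_self]

lemma ev_comp {B Z Z' : Type*} [Ring B] [Algebra ℂ B] [AddCommGroup Z] [Module ℂ Z]
    [AddCommGroup Z'] [Module ℂ Z'] {N : ℕ} (lam : Fin N → B →ₗ[ℂ] ℂ) (n : ℕ)
    (L : Z →ₗ[ℂ] Z') (c : List (Fin N) → Z) (l : List B) :
    ev lam n (fun I => L (c I)) l = L (ev lam n c l) := by
  induction l generalizing n c with
  | nil => rfl
  | cons x l ih =>
    rw [ev, ev, map_sum]
    refine Finset.sum_congr rfl fun k _ => ?_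
    split_ifs
    · rw [ih, map_smul]
    · rw [map_zero]

lemma rhoG_scal_qProj (r : ℂˣ) (q : ℕ) (a : Q4 V) :
    rhoG (scal r) (qProj q a) = (r : ℂ) ^ q • qProj q a := by
  refine Q4.ext_entry fun k j => ?_
  rw [entry_rhoG, entry_qProj, map_scal _ (extProj_mem _ _), map_smul, entry_qProj]

lemma rhoG_qProj_zero (g : V ≃ₗ[ℂ] V) (a : Q4 V) : rhoG g (qProj 0 a) = qProj 0 a := by
  refine Q4.ext_entry fun k j => ?_
  rw [entry_rhoG, entry_qProj, extProj_zero, AlgHom.commutes]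

/-- The equivariant polynomials with values in `Q_4`. -/
lemma weight_eq_zero {m q : ℕ} (hm : 1 ≤ m) {z : Q4 V} (hz : qProj q z = z) {I : List (Fin 4)}
    (hI : I.length = 2 * m + 2)
    (hw : ∀ h : Fin 4 → ℂˣ, (∏ i, (h i : ℂ)) ^ m • rhoG (diagEquiv b h) z =
      (I.map fun k => (h k : ℂ)).prod • z) (hnd : m = 1 → q = 0 → ¬ I.Nodup) : z = 0 := by
  by_contra hz0
  set r : ℂˣ := Units.mk0 2 two_ne_zero with hr
  have hr2 : (r : ℂ) = 2 := rfl
  have hpow : ∀ i j : ℕ, (2 : ℂ) ^ i = 2 ^ j → i = j := fun i j h => by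
    have h1 : ((2 ^ i : ℕ) : ℂ) = ((2 ^ j : ℕ) : ℂ) := by push_cast; exact h
    exact Nat.pow_right_injective le_rfl (Nat.cast_injective h1)
  have h1 := hw fun _ => r
  rw [diagEquiv_const, ← hz, rhoG_scal_qProj, hz, smul_smul] at h1
  have h2 := smul_left_injective ℂ hz0 h1
  simp only [Finset.prod_const, Finset.card_univ, Fintype.card_fin, List.map_const',
    List.prod_replicate, hI, hr2, ← pow_mul, ← pow_add] at h2
  -- Comparing powers of 2 gives 4m + q = 2m + 2, so m = 1 and q = 0.
  have h3 := hpow _ _ h2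
  obtain rfl : m = 1 := by omega
  obtain rfl : q = 0 := by omega
  refine hnd rfl rfl (List.nodup_iff_count_le_one.mpr fun i => ?_)
  -- Scaling only the i-th coordinate shows that the i-th variable occurs exactly once.
  have h4 := hw (Function.update 1 i r)
  rw [← hz, rhoG_qProj_zero, hz] at h4
  have h5 := smul_left_injective ℂ hz0 h4
  have h6 : ∀ J : List (Fin 4), (J.map fun k => ((Function.update 1 i r : Fin 4 → ℂˣ) k : ℂ)).prod =
      2 ^ J.count i := by
    intro J
    induction J with
    | nil => simp
    | cons k J ih =>
      rw [List.map_cons, List.prod_cons, ih, List.count_cons]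
      by_cases hk : k = i
      · subst hk; simp [hr2, pow_succ']
      · simp [hk]
  simp only [h6, pow_one] at h5
  have h7 : ∏ k, ((Function.update 1 i r : Fin 4 → ℂˣ) k : ℂ) = 2 ^ 1 := by
    rw [Finset.prod_eq_single i (fun k _ hk => by simp [hk]) (by simp)]
    simp [hr2]
  rw [h7] at h5
  exact (hpow _ _ h5).ge

/-- All inner faces vanish because v * v = 0; only the action of the last entry remains. -/
lemma bd_const {Z : Type*} [AddCommGroup Z] [Module ℂ Z] (act : ExteriorAlgebra ℂ V →ₗ[ℂ] Z →ₗ[ℂ] Z)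
    {f : List (ExteriorAlgebra ℂ V) → Z} (hf : ML f) {v : ExteriorAlgebra ℂ V} (hv : v * v = 0) (n : ℕ) :
    bd act f (List.replicate (n + 1) v) =
      (-1 : ℂ) ^ n • act v (f (List.replicate n v)) := by
  induction n generalizing f with
  | zero => simp
  | succ n ih =>
    have h1 := ih (hf.cons v)
    rw [List.replicate_succ] at h1 ⊢
    rw [List.replicate_succ, bd_cons_cons, hv, hf.head_zero, h1, pow_succ]
    simp

set_option maxHeartbeats 1000000 in
/-- Equivariant cocycles are coboundaries, except for a scalar obstruction. -/
theorem exists_primitive {m : ℕ} (hm : 1 ≤ m) {G : List (ExteriorAlgebra ℂ V) → Q4 V} (hG : ML G)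
    (hGρ : ∀ (h : Fin 4 → ℂˣ) l,
      G (l.map (extDiag b h)) = ((∏ i, (h i : ℂ)) ^ m • rhoG (diagEquiv b h)) (G l))
    (hcoc : ∀ l, List.length l = 2 * m + 2 + 1 → cobd actL actR G l = 0)
    (hχ : m = 1 → qProj 0 (G (List.replicate 4 (ExteriorAlgebra.ι ℂ (∑ i, b i)))) = 0) :
    ∃ g : List (ExteriorAlgebra ℂ V) → Q4 V, ML g ∧
      (∀ (h : Fin 4 → ℂˣ) l,
        g (l.map (extDiag b h)) = ((∏ i, (h i : ℂ)) ^ m • rhoG (diagEquiv b h)) (g l)) ∧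
      ∀ l, List.length l = 2 * m + 2 → G l = cobd actL actR g l := by
  -- Induction along the filtration: the values of G lie in exterior degrees at least q. Each step
  -- subtracts a coboundary to raise q by one, and at q = 5 nothing is left.
  suffices H : ∀ k q : ℕ, q + k = 5 → ∀ G : List (ExteriorAlgebra ℂ V) → Q4 V, ML G →
      (∀ (h : Fin 4 → ℂˣ) l,
        G (l.map (extDiag b h)) = ((∏ i, (h i : ℂ)) ^ m • rhoG (diagEquiv b h)) (G l)) →
      (∀ l, List.length l = 2 * m + 2 + 1 → cobd actL actR G l = 0) →
      (m = 1 → qProj 0 (G (List.replicate 4 (ExteriorAlgebra.ι ℂ (∑ i, b i)))) = 0) →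
      (∀ l, List.length l = 2 * m + 2 → ∀ p < q, qProj p (G l) = 0) →
      ∃ g : List (ExteriorAlgebra ℂ V) → Q4 V, ML g ∧
        (∀ (h : Fin 4 → ℂˣ) l,
          g (l.map (extDiag b h)) = ((∏ i, (h i : ℂ)) ^ m • rhoG (diagEquiv b h)) (g l)) ∧
        ∀ l, List.length l = 2 * m + 2 → G l = cobd actL actR g l from
    H 5 0 rfl G hG hGρ hcoc hχ (by simp)
  intro k
  induction k with
  | zero =>
    intro q hq G hG hGρ hcoc hχ hfil
    refine ⟨fun _ => 0, fun u v x y c => by simp, fun h l => by simp, fun l hl => ?_⟩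
    have h1 := cobd_lin actL actR (-1) (fun _ : List (ExteriorAlgebra ℂ V) => (0 : Q4 V))
      (fun _ => 0) l
    simp only [smul_zero, add_zero, neg_smul, one_smul, neg_add_cancel] at h1
    rw [h1]
    exact ext_qProj b fun p hp => hfil l hl p (by omega)
  | succ k ih =>
    intro q hq G hG hGρ hcoc hχ hfil
    set s := 2 * m + 2 with hs
    let ρ : (Fin 4 → ℂˣ) → Q4 V →ₗ[ℂ] Q4 V :=
      fun h => (∏ i, (h i : ℂ)) ^ m • rhoG (diagEquiv b h)
    have hρq : ∀ h (p : ℕ) z, qProj p (ρ h z) = ρ h (qProj p z) := fun h p z => by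
      simp only [ρ, LinearMap.smul_apply, map_smul, qProj_rhoG]
    -- An additional head on which f depends only through the augmentation encodes the trivial right
    -- module. The cocycle equation for the leading part of G, on which both outer multiplications
    -- act through the augmentation, becomes the hypothesis of `exists_koszul` with all four basis
    -- vectors killed.
    let f : List (ExteriorAlgebra ℂ V) → Q4 V := fun l => match l with
      | [] => 0
      | x :: l => aug x • qProj q (G l)
    have hfML : ML f := by
      intro u v x y a
      cases u with
      | nil => simp [f, add_smul, mul_smul]
      | cons z u =>
        have := hG u v x y a
        simp only [List.cons_append, f, this, map_add, map_smul, smul_add, smul_comm a]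
    have hfρ : ∀ h l, f (l.map (extDiag b h)) = ρ h (f l) := by
      intro h l
      cases l with
      | nil => simp [f]
      | cons x l =>
        change aug (extDiag b h x) • qProj q (G (l.map (extDiag b h))) = ρ h (aug x • qProj q (G l))
        rw [hGρ, extDiag, aug_map, hρq, map_smul]
    have hfcoc : ∀ x y l, List.length l = s → bd (charAct aug) f (x :: y :: l) = 0 := by
      intro x y l hl
      have h1 := (qProj_cobd hfil (y :: l) (by simp [hl])).2
      rw [hcoc _ (by simp [hl]), map_zero] at h1
      have h2 : (fun l => f (x :: l)) = fun l => aug x • qProj q (G l) + 0 := by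
        funext l; simp [f]
      have h3 := bd_sub (charAct aug) (fun _ : List (ExteriorAlgebra ℂ V) => (0 : Q4 V))
        (fun _ => 0) (y :: l)
      simp only [sub_self] at h3
      rw [bd_cons_cons, h2, bd_lin _ _ _ (fun _ => (0 : Q4 V)), h3, add_zero]
      rw [cobd, charAct_apply, eq_comm, sub_eq_zero] at h1
      rw [← h1]
      simp only [f, map_mul, mul_smul]
      rw [smul_comm, sub_self]
    have hfv : ∀ k : Fin 4, (k : ℕ) < 4 → ∀ x l, List.length l = s →
        f ((x * ExteriorAlgebra.ι ℂ (b k)) :: l) = 0 := fun k _ x l _ => by simp [f]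
    obtain ⟨g, c, hg, hgρ, hcρ, -, hgv, hfg⟩ :=
      exists_koszul b s 4 le_rfl ρ hfML hfρ hfcoc hfv
    let g2 : List (ExteriorAlgebra ℂ V) → Q4 V := fun l => qProj q (g (1 :: l))
    have hg2 : ML g2 := (hg.cons 1).comp (qProj q)
    have hg2ρ : ∀ h l, g2 (l.map (extDiag b h)) = ρ h (g2 l) := by
      intro h l
      have h1 := hgρ h (1 :: l)
      rw [List.map_cons, map_one] at h1
      simp only [g2]
      rw [h1, hρq]
    have hqq : ∀ z : Q4 V, qProj q (qProj q z) = qProj q z := fun z => by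
      rw [qProj_qProj, if_pos rfl]
    have hlead : ∀ l, List.length l = s → qProj q (G l) =
        cobd (charAct aug) (charAct aug) g2 l + ev (lam b) 4 (fun I => qProj q (c I)) l := by
      intro l hl
      have h1 := congrArg (qProj q) (hfg 1 l hl)
      simp only [f, map_one, one_smul, map_add, hqq] at h1
      rw [h1, ev_comp]
      congr 1
      obtain ⟨y, l, rfl⟩ : ∃ y l', l = y :: l' := by
        cases l with
        | nil => simp [hs] at hl
        | cons y l => exact ⟨y, l, rfl⟩
      -- As g kills all basis vectors in its head, it depends on the head only through the
      -- augmentation; the first face thus turns into the right action.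
      have h2 := eq_aug_smul b (hg.headMap l) (fun k x => hgv k k.2 x l (by simpa using hl)) y
      have h3 := bd_comp (act := charAct aug) (act' := charAct aug) (AlgHom.id ℂ _) (qProj q)
        (fun x z => by simp) (f := fun l => g (1 :: l)) (f' := g2) (by simp [g2]) (y :: l)
      simp only [AlgHom.coe_id, List.map_id_fun, id] at h3
      rw [bd_cons_cons, mul_one, cobd, h3, map_sub]
      congr 1
      change qProj q (hg.headMap l y) = _
      rw [h2, map_smul]
      rfl
    have hc : ∀ I : List (Fin 4), I.length = s → (m = 1 → q = 0 → ¬ I.Nodup) → qProj q (c I) = 0 :=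
      fun I hI hnd => weight_eq_zero b hm (hqq _) hI (fun h => by
        have h1 := hcρ h I
        have h2 := congrArg (qProj q) h1
        rw [hρq, map_smul] at h2
        exact h2) hnd
    have hev : ∀ l, List.length l = s → ev (lam b) 4 (fun I => qProj q (c I)) l = 0 := by
      -- By weights all coefficients vanish except possibly that of y_0 y_1 y_2 y_3. The latter is
      -- read off at the sum of the basis vectors, where all coordinates equal one and the
      -- coboundary term vanishes.
      by_cases hmq : m = 1 ∧ q = 0
      · obtain ⟨rfl, rfl⟩ := hmq
        set v := ExteriorAlgebra.ι ℂ (∑ i, b i) with hv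
        have h1 := hlead (List.replicate 4 v) (by simp [hs])
        have h2 : cobd (charAct aug) (charAct aug) g2 (List.replicate 4 v) = 0 := by
          rw [List.replicate_succ, cobd, ← List.replicate_succ, bd_const _ hg2
            (ExteriorAlgebra.ι_sq_zero _)]
          simp [hv]
        have h3 : ∀ k, lam b k v = 1 := fun k => by
          rw [hv, lam_ι, map_sum, Finset.sum_eq_single k (fun i _ hi => by simp [hi]) (by simp)]
          simp
        rw [hχ rfl, h2, zero_add] at h1
        have h4 : ∀ I : List (Fin 4), I.length = 4 → ¬ I.Nodup → qProj 0 (c I) = 0 :=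
          fun I hI hI' => hc I (by simpa [hs] using hI) fun _ _ => hI'
        have h5 : qProj 0 (c [3, 2, 1, 0]) = 0 := by
          rw [h1]
          simp [List.replicate_succ, ev, Fin.sum_univ_four, h3, h4]
        intro l hl
        obtain ⟨x1, x2, x3, x4, rfl⟩ : ∃ x1 x2 x3 x4, l = [x1, x2, x3, x4] := by
          have hl : l.length = 4 := hl
          match l, hl with
          | [x1, x2, x3, x4], _ => exact ⟨x1, x2, x3, x4, rfl⟩
        simp [ev, Fin.sum_univ_four, h4, h5]
      · exact fun l hl => ev_eq_zero _ _ fun I hI =>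
          hc I (hI.trans hl) fun h1 h2 => absurd ⟨h1, h2⟩ hmq
    have hqp : ∀ l, ∀ p < q, qProj p (g2 l) = 0 := fun l p hp => by
      simp only [g2]; rw [qProj_qProj, if_neg (by omega)]
    have hLρ : ∀ h x z, actL (extDiag b h x) (ρ h z) = ρ h (actL x z) := fun h x z => by
      simp only [actL_apply, ρ, LinearMap.smul_apply, rhoG_mul, rhoG_emb, mul_smul_comm]; rfl
    have hRρ : ∀ h x z, actR (extDiag b h x) (ρ h z) = ρ h (actR x z) := fun h x z => by
      simp only [actR_apply, ρ, LinearMap.smul_apply, rhoG_mul, rhoG_emb, smul_mul_assoc]; rfl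
    have hcobdρ : ∀ h l, cobd actL actR g2 (l.map (extDiag b h)) = ρ h (cobd actL actR g2 l) :=
      fun h l => cobd_comp (extDiag b h) (ρ h) (hLρ h) (hRρ h) (hg2ρ h) l
    have hfil' : ∀ l, List.length l = s → ∀ p < q + 1,
        qProj p (G l - cobd actL actR g2 l) = 0 := by
      intro l hl p hp
      have h1 := qProj_cobd (n := 2 * m + 1) (q := q) (f := g2) (fun l _ p hp => hqp l p hp) l hl
      rcases Nat.lt_succ_iff_lt_or_eq.mp hp with hp' | rfl
      · rw [map_sub, hfil l hl p hp', h1.1 p hp', sub_zero]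
      · rw [map_sub, h1.2, hlead l hl, hev l hl, add_zero, sub_eq_zero]
        congr 1
        funext l
        exact (hqq _).symm
    -- Subtracting the differential of `g2` removes the exterior degree q part of G, so the
    -- induction applies to the difference.
    obtain ⟨g3, hg3, hg3ρ, hG3⟩ := ih (q + 1) (by omega) (fun l => G l - cobd actL actR g2 l)
      (hG.sub (hg2.cobd _ _)) (fun h l => by rw [map_sub, hGρ, hcobdρ]) (fun l hl => by
        have h1 := cobd_lin actL actR (-1) (cobd actL actR g2) G l
        rw [cobd_actL_cobd, hcoc l hl, smul_zero, add_zero] at h1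
        rw [← h1]
        congr 1
        funext l
        rw [neg_smul, one_smul, neg_add_eq_sub])
      (fun hm1 => hfil' _ (by simp [hs, hm1]) 0 (by omega)) hfil'
    refine ⟨fun l => (1 : ℂ) • g2 l + g3 l, (hg2.smul 1).add hg3, fun h l => ?_, fun l hl => ?_⟩
    · beta_reduce
      rw [map_add, map_smul, hg2ρ, hg3ρ]
    · rw [cobd_lin, one_smul, ← hG3 l hl]
      abel

end Obstruction

/-! ### Extension of functions from the exterior algebra to Q_4. -/

section PathSum

variable {V : Type*} [AddCommGroup V] [Module ℂ V]

/-- The sum over all paths starting at `X_j` of the values of `G` on the entries of the inputs. -/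
def psum : (List (ExteriorAlgebra ℂ V) → Q4 V) → Fin 4 → List (Q4 V) → Q4 V
  | G, j, [] => idem j * G []
  | G, j, a :: l => ∑ k, psum (fun w => G (entry k j a :: w)) k l

lemma psum_lin (c : ℂ) (f g : List (ExteriorAlgebra ℂ V) → Q4 V) (j : Fin 4) (l : List (Q4 V)) :
    psum (fun w => c • f w + g w) j l = c • psum f j l + psum g j l := by
  induction l generalizing f g j with
  | nil => simp only [psum, mul_add, mul_smul_comm]
  | cons a l ih => simp only [psum, ih (fun w => f (_ :: w)) fun w => g (_ :: w), Finset.smul_sum,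
      Finset.sum_add_distrib]

lemma psum_congr {f g : List (ExteriorAlgebra ℂ V) → Q4 V} (j : Fin 4) (l : List (Q4 V))
    (h : ∀ w : List (ExteriorAlgebra ℂ V), w.length = l.length → f w = g w) :
    psum f j l = psum g j l := by
  induction l generalizing f g j with
  | nil => simp only [psum, h [] rfl]
  | cons a l ih =>
    simp only [psum]
    exact Finset.sum_congr rfl fun k _ => ih k fun w hw => h _ (by simpa using hw)

lemma psum_zero (j : Fin 4) (l : List (Q4 V)) : psum (fun _ => 0) j l = 0 := by
  simpa using psum_lin (-1) (fun _ => 0) (fun _ => 0) j l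

lemma psum_smul (c : ℂ) (f : List (ExteriorAlgebra ℂ V) → Q4 V) (j : Fin 4) (l : List (Q4 V)) :
    psum (fun w => c • f w) j l = c • psum f j l := by
  have h := psum_lin c f (fun _ => 0) j l
  simp only [add_zero, psum_zero] at h
  exact h

lemma ML.psum {G : List (ExteriorAlgebra ℂ V) → Q4 V} (hG : ML G) (j : Fin 4) : ML (psum G j) := by
  intro u v x y c
  induction u generalizing G j with
  | nil =>
    simp only [List.nil_append, SeidelQ.psum, _root_.map_add, _root_.map_smul, hG.head, psum_lin,
      Finset.smul_sum, Finset.sum_add_distrib]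
  | cons z u ih =>
    simp only [List.cons_append, SeidelQ.psum, ih (hG.cons _), Finset.smul_sum,
      Finset.sum_add_distrib]

lemma psum_head_mul {G : List (ExteriorAlgebra ℂ V) → Q4 V} (hG : ML G) (j : Fin 4) (r : Fin 4 → ℂ)
    (x : Q4 V) (l : List (Q4 V)) : psum G j ((x * diagR r) :: l) = r j • psum G j (x :: l) := by
  simp only [psum, entry_mul_diagR, hG.head_smul, psum_smul, Finset.smul_sum]

lemma psum_bal {G : List (ExteriorAlgebra ℂ V) → Q4 V} (hG : ML G) (j : Fin 4) :
    Bal (R4 V) (psum G j) := by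
  intro r hr u v x y
  obtain ⟨r, rfl⟩ := mem_R4_iff.mp hr
  induction u generalizing G j with
  | nil =>
    rw [List.nil_append, List.nil_append, psum, psum]
    refine Finset.sum_congr rfl fun k _ => ?_
    rw [psum_head_mul (hG.cons _), entry_diagR_mul]
    simp only [hG.head_smul, psum_smul]
  | cons z u ih =>
    simp only [List.cons_append, psum]
    exact Finset.sum_congr rfl fun k _ => ih (hG.cons _) k

lemma psum_lastLin {G : List (ExteriorAlgebra ℂ V) → Q4 V} (hG : ML G) (j : Fin 4) :
    LastLin (R4 V) (psum G j) := by
  intro r hr u x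
  obtain ⟨r, rfl⟩ := mem_R4_iff.mp hr
  induction u generalizing G j with
  | nil =>
    simp only [List.nil_append, psum, entry_diagR_mul, hG.head_smul, Finset.mul_sum]
    refine Finset.sum_congr rfl fun k _ => ?_
    rw [mul_smul_comm, ← mul_assoc, diagR_mul_idem, smul_mul_assoc]
  | cons z u ih =>
    simp only [List.cons_append, psum, Finset.mul_sum]
    exact Finset.sum_congr rfl fun k _ => ih (hG.cons _) k

lemma psum_map (g : V ≃ₗ[ℂ] V) (c : ℂ) {G : List (ExteriorAlgebra ℂ V) → Q4 V}
    {G' : List (ExteriorAlgebra ℂ V) → Q4 V} (j : Fin 4) (l : List (Q4 V))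
    (h : ∀ w : List (ExteriorAlgebra ℂ V), w.length = l.length →
      G' (w.map (ExteriorAlgebra.map (g : V →ₗ[ℂ] V))) = c • rhoG g (G w)) :
    psum G' j (l.map (rhoG g)) = c • rhoG g (psum G j l) := by
  induction l generalizing G G' j with
  | nil =>
    have := h [] rfl
    simp only [List.map_nil] at this
    rw [List.map_nil, psum, psum, this, rhoG_mul, rhoG_of_mem_R4 _ (idem_mem j), mul_smul_comm]
  | cons a l ih =>
    rw [List.map_cons, psum, psum, map_sum, Finset.smul_sum]
    refine Finset.sum_congr rfl fun k _ => ih k fun w hw => ?_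
    rw [entry_rhoG, ← h _ (by simpa using hw), List.map_cons]

/-- The `R_4`-multilinear extension of a function on lists of elements of the exterior algebra. -/
def ext4 (G : List (ExteriorAlgebra ℂ V) → Q4 V) (l : List (Q4 V)) : Q4 V :=
  ∑ j, psum G j l * idem j

variable {G : List (ExteriorAlgebra ℂ V) → Q4 V}

lemma ML.ext4 (hG : ML G) : ML (ext4 G) := by
  intro u v x y c
  simp only [SeidelQ.ext4, hG.psum _ u v x y c, add_mul, smul_mul_assoc, Finset.smul_sum,
    Finset.sum_add_distrib]

lemma ext4_bal (hG : ML G) : Bal (R4 V) (ext4 G) := fun r hr u v x y => by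
  simp only [ext4, psum_bal hG _ r hr u v x y]

lemma ext4_lastLin (hG : ML G) : LastLin (R4 V) (ext4 G) := fun r hr u x => by
  simp only [ext4, psum_lastLin hG _ r hr u x, Finset.mul_sum, mul_assoc]

lemma ext4_headLin (hG : ML G) : HeadLin (R4 V) (ext4 G) := fun r hr x l => by
  obtain ⟨r, rfl⟩ := mem_R4_iff.mp hr
  simp only [ext4, psum_head_mul hG, Finset.sum_mul, mul_assoc, idem_mul_diagR]
  exact Finset.sum_congr rfl fun j _ => by rw [smul_mul_assoc, mul_smul_comm]

lemma ext4_map (g : V ≃ₗ[ℂ] V) (c : ℂ) (l : List (Q4 V))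
    (h : ∀ w : List (ExteriorAlgebra ℂ V), w.length = l.length →
      G (w.map (ExteriorAlgebra.map (g : V →ₗ[ℂ] V))) = c • rhoG g (G w)) :
    ext4 G (l.map (rhoG g)) = c • rhoG g (ext4 G l) := by
  simp only [ext4, psum_map g c _ l h, map_sum, Finset.smul_sum]
  exact Finset.sum_congr rfl fun j _ => by
    rw [rhoG_mul, rhoG_of_mem_R4 _ (idem_mem j), smul_mul_assoc]

lemma ext4_congr {G' : List (ExteriorAlgebra ℂ V) → Q4 V} (l : List (Q4 V))
    (h : ∀ w : List (ExteriorAlgebra ℂ V), w.length = l.length → G w = G' w) :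
    ext4 G l = ext4 G' l := by
  simp only [ext4, psum_congr _ l h]

lemma ext4_zero (l : List (Q4 V)) : ext4 (fun _ => 0) l = 0 := by simp [ext4, psum_zero]

/-- A primitive fourth root of unity acts on Hom(X_j, X_k) through its power k - j, so an
eigenvector starting at X_j can only end at one object. -/
lemma idem_mul_mul_idem_of_weight {r : ℂˣ} (hr : IsPrimitiveRoot r 4) {n : ℕ} {k j : Fin 4}
    (hk : n + (j : ℕ) ≡ k [MOD 4]) {z : Q4 V} (hz : (r : ℂ) ^ n • z = rhoG (scal r) z) :
    idem k * z * idem j = z * idem j := by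
  have hr' : IsPrimitiveRoot (r : ℂ) 4 := IsPrimitiveRoot.coe_units_iff.mpr hr
  refine Q4.ext_entry fun k' j' => ?_
  rw [entry_mul_idem, entry_mul_idem, entry_idem_mul]
  split_ifs with hj hk'
  · rfl
  · subst hj
    have h1 := congrArg (entry k' j) hz
    rw [rhoG_scal_of_pow hr'.pow_eq_one, entry_diagR_mul, entry_mul_diagR, smul_smul, map_smul] at h1
    by_contra h0
    have h2 := smul_left_injective ℂ (Ne.symm h0) h1
    rw [eq_mul_inv_iff_mul_eq₀ (pow_ne_zero _ r.ne_zero), ← pow_add] at h2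
    have h3 := pow_inj_mod.mp (Units.ext (by push_cast; exact h2) : r ^ (n + (j : ℕ)) = r ^ (k' : ℕ))
    rw [← hr.eq_orderOf] at h3
    refine hk' (Fin.ext ?_)
    have := k.2; have := k'.2
    simp only [Nat.ModEq] at hk; omega
  · rfl

/-- For entries of fixed exterior degree a single path contributes, and its end is determined by the
total degree. The weight condition says that the value of G has the same target, so the final
idempotent has no effect. The number n records the degree already consumed. -/
lemma psum_map_emb {r : ℂˣ} (hr : IsPrimitiveRoot r 4) (hG : ML G) {n : ℕ} {k j : Fin 4}
    (hk : n + (j : ℕ) ≡ k [MOD 4]) (l : List (ExteriorAlgebra ℂ V))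
    (h : ∀ w : List (ExteriorAlgebra ℂ V), w.length = l.length → (r : ℂ) ^ n •
      G (w.map (ExteriorAlgebra.map ((scal r : V ≃ₗ[ℂ] V) : V →ₗ[ℂ] V))) = rhoG (scal r) (G w)) :
    psum G k (l.map emb) * idem j = G l * idem j := by
  induction l generalizing G n k with
  | nil => exact idem_mul_mul_idem_of_weight hr hk (h [] rfl)
  | cons x l ih =>
    have key : (LinearMap.mulRight ℂ (idem j)).comp
        (((hG.psum k).headMap (l.map emb)).comp emb.toLinearMap) =
        (LinearMap.mulRight ℂ (idem j)).comp (hG.headMap l) := by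
      refine ext_on_exteriorPower fun p x hx => ?_
      change psum G k (emb x :: l.map emb) * idem j = G (x :: l) * idem j
      obtain ⟨k', hk'⟩ : ∃ k' : Fin 4, p + (k : ℕ) ≡ k' [MOD 4] :=
        ⟨⟨(p + k) % 4, Nat.mod_lt _ (by norm_num)⟩, (Nat.mod_modEq _ _).symm⟩
      rw [psum, Finset.sum_eq_single k' (fun i _ hi => ?_) (by simp), entry_emb hx, if_pos hk']
      · refine ih (hG.cons x) (n := n + p) ?_ fun w hw => ?_
        · exact ((by ring_nf; rfl : n + p + (j : ℕ) ≡ p + (n + j) [MOD 4]).trans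
            (Nat.ModEq.add_left p hk)).trans hk'
        · rw [← h _ (by simpa using hw), List.map_cons, map_scal r hx, hG.head_smul, smul_smul,
            pow_add]
      · rw [entry_emb hx, if_neg]
        · simp only [hG.head_zero, psum_zero]
        · intro h'
          have := k'.2; have := i.2
          exact hi (Fin.ext (by simp only [Nat.ModEq] at h' hk'; omega))
    exact LinearMap.congr_fun key x

lemma ext4_map_emb {r : ℂˣ} (hr : IsPrimitiveRoot r 4) (hG : ML G) (l : List (ExteriorAlgebra ℂ V))
    (h : ∀ w : List (ExteriorAlgebra ℂ V), w.length = l.length →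
      G (w.map (ExteriorAlgebra.map ((scal r : V ≃ₗ[ℂ] V) : V →ₗ[ℂ] V))) = rhoG (scal r) (G w)) :
    ext4 G (l.map emb) = G l := by
  have h1 : ∀ j : Fin 4, psum G j (l.map emb) * idem j = G l * idem j := fun j =>
    psum_map_emb hr hG (n := 0) (by rw [zero_add]) l (by simpa using h)
  simp only [ext4, h1, ← Finset.mul_sum, sum_idem, mul_one]

/-- Balancing passes the idempotents from each entry to the next, which reassembles the entries from
their components. -/
lemma psum_comp_emb {f : List (Q4 V) → Q4 V} (hf : ML f) (hb : Bal (R4 V) f) (hl : LastLin (R4 V) f)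
    (a : Q4 V) (k : Fin 4) (l : List (Q4 V)) :
    psum (fun w => f (a :: w.map emb)) k l = f ((idem k * a) :: l) := by
  induction l generalizing f a k with
  | nil => exact (hl _ (idem_mem k) [] a).symm
  | cons a' l ih =>
    have h1 : ∀ k', psum (fun w => f (a :: emb (entry k' k a') :: w.map emb)) k' l =
        f (a :: (idem k' * emb (entry k' k a')) :: l) := fun k' =>
      ih (hf.cons a) (hb.cons a) (hl.cons a) (emb (entry k' k a')) k'
    rw [psum]
    simp only [List.map_cons, h1]
    rw [← List.nil_append ((idem k * a) :: a' :: l), ← hb _ (idem_mem k) [] l a a', List.nil_append,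
      ← sum_idem_mul_emb_entry]
    exact (map_sum ((hf.cons a).headMap l) _ _).symm

/-- Bimodule maps are determined by their values on the exterior algebra. -/
lemma eq_of_comp_emb {f g : List (Q4 V) → Q4 V} (hf : ML f) (hfb : Bal (R4 V) f)
    (hfl : LastLin (R4 V) f) (hg : ML g) (hgb : Bal (R4 V) g) (hgl : LastLin (R4 V) g)
    (hfh : HeadLin (R4 V) f) (hgh : HeadLin (R4 V) g) (l : List (Q4 V)) (hl : l ≠ [])
    (h : ∀ w : List (ExteriorAlgebra ℂ V), w.length = l.length → f (w.map emb) = g (w.map emb)) :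
    f l = g l := by
  cases l with
  | nil => exact absurd rfl hl
  | cons a l =>
    have key : ∀ {f : List (Q4 V) → Q4 V}, ML f → Bal (R4 V) f → LastLin (R4 V) f →
        HeadLin (R4 V) f → f (a :: l) = ∑ j, psum (fun w => f (w.map emb)) j (a :: l) := by
      intro f hf hb hl hh
      have h1 : ∀ j, psum (fun w => f (w.map emb)) j (a :: l) = f (a :: l) * idem j := fun j => by
        rw [psum]
        simp only [List.map_cons, psum_comp_emb hf hb hl]
        rw [← hh _ (idem_mem j), ← sum_idem_mul_emb_entry]
        exact (map_sum (hf.headMap l) _ _).symm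
      simp only [h1, ← Finset.mul_sum, sum_idem, mul_one]
    rw [key hf hfb hfl hfh, key hg hgb hgl hgh]
    exact Finset.sum_congr rfl fun j _ => psum_congr j _ h

end PathSum

/-! ### The ungraded Hochschild differential respects the bimodule conditions. -/

section LinearBar

variable {A : Type*} [Ring A] [Algebra ℂ A] {R : Subalgebra ℂ A}

/-- Left multiplication. -/
abbrev mulL (A : Type*) [Ring A] [Algebra ℂ A] : A →ₗ[ℂ] A →ₗ[ℂ] A := LinearMap.mul ℂ A

/-- Right multiplication. -/
abbrev mulR (A : Type*) [Ring A] [Algebra ℂ A] : A →ₗ[ℂ] A →ₗ[ℂ] A := (LinearMap.mul ℂ A).flip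

/-- With the zero action `bd` consists of the inner faces only, so this isolates the face in which
the last entry acts. -/
lemma bd_mulL_append (act : A →ₗ[ℂ] A →ₗ[ℂ] A) (f : List A → A) (m : List A) (z : A) :
    bd act f (m ++ [z]) = bd 0 f (m ++ [z]) + (-1 : ℂ) ^ m.length • act z (f m) := by
  induction m generalizing f with
  | nil => simp
  | cons x m ih =>
    obtain ⟨y, w, hw⟩ : ∃ y w, m ++ [z] = y :: w := by cases m <;> simp
    have h1 := ih fun l => f (x :: l)
    rw [hw] at h1
    rw [List.cons_append, hw, bd_cons_cons, bd_cons_cons, h1, List.length_cons, pow_succ]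
    simp only [mul_neg, mul_one, neg_smul]
    abel

lemma bd_head_bal {f : List A → A} (hb : Bal R f) (hl : LastLin R f) {r : A} (hr : r ∈ R) (x y : A)
    (v : List A) : bd (mulL A) (fun w => f (x :: w)) ((y * r) :: v) =
      bd (mulL A) (fun w => f ((r * x) :: w)) (y :: v) := by
  cases v with
  | nil =>
    have := hl r hr [] x
    simp only [List.nil_append] at this
    simp [this, mul_assoc]
  | cons z v =>
    rw [bd_cons_cons, bd_cons_cons, ← mul_assoc]
    have h1 := hb r hr [] v x (z * y)
    have h2 : (fun w => f (x :: (y * r) :: w)) = fun w => f ((r * x) :: y :: w) :=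
      funext fun w => hb r hr [] w x y
    simp only [List.nil_append] at h1
    rw [h1, h2]

lemma Bal.bd {f : List A → A} (hb : Bal R f) (hl : LastLin R f) : Bal R (bd (mulL A) f) := by
  intro r hr u v x y
  induction u generalizing f with
  | nil =>
    rw [List.nil_append, List.nil_append, bd_cons_cons, bd_cons_cons, bd_head_bal hb hl hr, mul_assoc]
  | cons z u ih =>
    have h1 := ih (hb.cons z) (hl.cons z)
    cases u with
    | nil =>
      have h2 := hb r hr [] v (x * z) y
      simp only [List.nil_append, List.cons_append] at h1 h2 ⊢
      rw [bd_cons_cons _ f z, bd_cons_cons _ f z, h1, h2, mul_assoc]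
    | cons w u =>
      have h2 := hb r hr ((w * z) :: u) v x y
      simp only [List.cons_append] at h1 h2 ⊢
      rw [bd_cons_cons, bd_cons_cons, h1, h2]

lemma LastLin.bd {f : List A → A} (hl : LastLin R f) : LastLin R (bd (mulL A) f) := by
  intro r hr u x
  induction u generalizing f with
  | nil => simp [mul_assoc]
  | cons z u ih =>
    have h1 := ih (hl.cons z)
    cases u with
    | nil =>
      have h2 := hl r hr [] (x * z)
      simp only [List.nil_append, List.cons_append] at h1 h2 ⊢
      rw [bd_cons_cons, bd_cons_cons, h1, mul_assoc, h2, mul_sub]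
    | cons w u =>
      have h2 := hl r hr ((w * z) :: u) x
      simp only [List.cons_append] at h1 h2 ⊢
      rw [bd_cons_cons, bd_cons_cons, h1, h2, mul_sub]

lemma Bal.cobd {f : List A → A} (hb : Bal R f) (hl : LastLin R f) (hh : HeadLin R f) :
    Bal R (cobd (mulL A) (mulR A) f) := by
  intro r hr u v x y
  have h1 := hb.bd hl r hr u v x y
  cases u with
  | nil =>
    simp only [List.nil_append] at h1 ⊢
    rw [SeidelQ.cobd, SeidelQ.cobd, h1]
    congr 1
    change f ((y * r) :: v) * x = f (y :: v) * (r * x)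
    rw [hh r hr, mul_assoc]
  | cons z u =>
    simp only [List.cons_append] at h1 ⊢
    rw [SeidelQ.cobd, SeidelQ.cobd, h1, hb r hr]

lemma LastLin.cobd {f : List A → A} (hl : LastLin R f) (h0 : f [] = 0) :
    LastLin R (cobd (mulL A) (mulR A) f) := by
  intro r hr u x
  have h1 := hl.bd r hr u x
  cases u with
  | nil =>
    simp only [List.nil_append] at h1 ⊢
    rw [SeidelQ.cobd, SeidelQ.cobd, h1, h0]
    simp
  | cons z u =>
    simp only [List.cons_append] at h1 ⊢
    rw [SeidelQ.cobd, SeidelQ.cobd, h1, hl r hr, mul_sub]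
    congr 1
    exact mul_assoc _ _ _

lemma HeadLin.cobd {f : List A → A} (hh : HeadLin R f) (h0 : f [] = 0) :
    HeadLin R (cobd (mulL A) (mulR A) f) := by
  intro r hr x l
  rw [SeidelQ.cobd, SeidelQ.cobd, sub_mul]
  congr 1
  · exact (mul_assoc _ _ _).symm
  · cases l with
    | nil => simp [h0]
    | cons y l =>
      rw [bd_cons_cons, bd_cons_cons, ← mul_assoc, hh r hr, sub_mul]
      congr 1
      have h1 := bd_comp (act := mulL A) (act' := mulL A) (AlgHom.id ℂ A) (LinearMap.mulRight ℂ r)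
        (fun x z => by simp [mul_assoc]) (f := fun w => f (x :: w)) (f' := fun w => f ((x * r) :: w))
        (fun w => by simp [hh r hr]) (y :: l)
      simpa using h1

end LinearBar

/-! ### Removal of the signs by an alternating twist. -/

section Twist

variable {A : Type*} [Ring A] [Algebra ℂ A] {R : Subalgebra ℂ A} {P : A →ₗ[ℂ] A}

variable (P) in
/-- The alternating twist of a list by an involution. -/
def tw : List A → List A
  | [] => []
  | x :: l => (P ^ l.length) x :: tw l

@[simp] lemma length_tw (l : List A) : (tw P l).length = l.length := by
  induction l with
  | nil => rfl
  | cons x l ih => simp [tw, ih]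

lemma pow_two_eq_one (hP : ∀ a, P (P a) = a) : P ^ 2 = 1 :=
  LinearMap.ext fun a => by rw [pow_two]; exact hP a

lemma pow_apply_pow_apply (hP : ∀ a, P (P a) = a) (n : ℕ) (a : A) : (P ^ n) ((P ^ n) a) = a := by
  rw [← Module.End.mul_apply, ← pow_add, ← two_mul, pow_mul, pow_two_eq_one hP, one_pow]; rfl

lemma pow_apply_mul (hPm : ∀ a a', P (a * a') = P a * P a') (n : ℕ) (a a' : A) :
    (P ^ n) (a * a') = (P ^ n) a * (P ^ n) a' := by
  induction n with
  | zero => rfl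
  | succ n ih => simp only [pow_succ', Module.End.mul_apply, ih, hPm]

lemma pow_apply_of_fixed {r : A} (hr : P r = r) (n : ℕ) : (P ^ n) r = r := by
  induction n with
  | zero => rfl
  | succ n ih => rw [pow_succ', Module.End.mul_apply, ih, hr]

lemma pow_apply_comm {g : A →ₗ[ℂ] A} (hg : ∀ a, P (g a) = g (P a)) (n : ℕ) (a : A) :
    (P ^ n) (g a) = g ((P ^ n) a) := by
  induction n with
  | zero => rfl
  | succ n ih => rw [pow_succ', Module.End.mul_apply, Module.End.mul_apply, ih, hg]

lemma tw_tw (hP : ∀ a, P (P a) = a) (l : List A) : tw P (tw P l) = l := by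
  induction l with
  | nil => rfl
  | cons x l ih => rw [tw, tw, ih, length_tw, pow_apply_pow_apply hP]

lemma tw_map {g : A →ₗ[ℂ] A} (hg : ∀ a, P (g a) = g (P a)) (l : List A) :
    tw P (l.map g) = (tw P l).map g := by
  induction l with
  | nil => rfl
  | cons x l ih => rw [List.map_cons, tw, tw, ih, List.map_cons, List.length_map, pow_apply_comm hg]

lemma exists_tw_append (u v : List A) :
    ∃ u', ∀ v' : List A, v'.length = v.length → tw P (u ++ v') = u' ++ tw P v' := by
  induction u with
  | nil => exact ⟨[], fun _ _ => rfl⟩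
  | cons x u ih =>
    obtain ⟨u', hu⟩ := ih
    refine ⟨(P ^ (u.length + v.length)) x :: u', fun v' hv => ?_⟩
    rw [List.cons_append, tw, hu v' hv, List.length_append, hv, List.cons_append]

lemma ML.tw {Z : Type*} [AddCommGroup Z] [Module ℂ Z] {f : List A → Z} (hf : ML f) :
    ML fun l => f (tw P l) := by
  intro u v x y c
  obtain ⟨u', hu⟩ := exists_tw_append (P := P) u (x :: v)
  have h : ∀ z, SeidelQ.tw P (u ++ z :: v) = u' ++ (P ^ v.length) z :: SeidelQ.tw P v :=
    fun z => hu (z :: v) rfl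
  simp only [h, _root_.map_add, _root_.map_smul, hf u']

variable {f : List A → A}

lemma Bal.tw (hPm : ∀ a a', P (a * a') = P a * P a') (hR : ∀ r ∈ R, P r = r) (hf : Bal R f) :
    Bal R fun l => f (tw P l) := by
  intro r hr u v x y
  obtain ⟨u', hu⟩ := exists_tw_append (P := P) u (x :: y :: v)
  have h : ∀ z w, SeidelQ.tw P (u ++ z :: w :: v) =
      u' ++ (P ^ (v.length + 1)) z :: (P ^ v.length) w :: SeidelQ.tw P v :=
    fun z w => hu (z :: w :: v) rfl
  simp only [h, pow_apply_mul hPm, pow_apply_of_fixed (hR r hr), hf r hr]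

lemma LastLin.tw (hPm : ∀ a a', P (a * a') = P a * P a') (hR : ∀ r ∈ R, P r = r)
    (hf : LastLin R f) : LastLin R fun l => f (tw P l) := by
  intro r hr u x
  obtain ⟨u', hu⟩ := exists_tw_append (P := P) u [x]
  have h : ∀ z, SeidelQ.tw P (u ++ [z]) = u' ++ [(P ^ 0) z] := fun z => hu [z] rfl
  simp only [h, pow_apply_mul hPm, pow_apply_of_fixed (hR r hr), hf r hr]

lemma HeadLin.tw (hPm : ∀ a a', P (a * a') = P a * P a') (hR : ∀ r ∈ R, P r = r)
    (hf : HeadLin R f) : HeadLin R fun l => f (tw P l) := by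
  intro r hr x l
  simp only [SeidelQ.tw, pow_apply_mul hPm, pow_apply_of_fixed (hR r hr), hf r hr]

lemma tw_append_single (m : List A) (z : A) : tw P (m ++ [z]) = (tw P m).map P ++ [z] := by
  induction m with
  | nil => rfl
  | cons x m ih =>
    rw [List.cons_append, tw, ih, tw, List.map_cons, List.cons_append, List.length_append,
      List.length_singleton, pow_succ', Module.End.mul_apply]

/-- In the twisted list an entry followed by n others carries P^n. When two entries merge, each
entry before them needs one power of P less, and the P in the sign operator -P supplies it since P
is an involution. What remains is one minus sign per preceding entry, as in `bd`. -/
lemma ins_quad_tw (hP : ∀ a, P (P a) = a) (hPm : ∀ a a', P (a * a') = P a * P a')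
    {φ : List A → A} (hφ : ML φ) (x : A) (l : List A) :
    ins (-P) (quad (-P : A →ₗ[ℂ] A)) φ (tw P (x :: l)) = bd 0 (fun w => φ (tw P w)) (x :: l) := by
  induction l generalizing φ x with
  | nil =>
    change φ [0] + 0 = 0
    rw [hφ.head_zero, add_zero]
  | cons y l ih =>
    have hpre : ∀ (w : List A) (β : List A → A), (∀ v, β v = 0) → pre φ β w = 0 := by
      intro w β hβ
      induction w generalizing β with
      | nil => rw [pre, hβ, hφ.head_zero]
      | cons z w ih => rw [pre, hβ, hφ.head_zero, zero_add, ih _ fun v => hβ _]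
    have hx : (-P) ((P ^ (l.length + 1)) x) = -(P ^ l.length) x := by
      rw [LinearMap.neg_apply, pow_succ', Module.End.mul_apply, hP]
    have h3 : pre φ (fun w => quad (-P : A →ₗ[ℂ] A) ((P ^ (l.length + 1)) x :: w)) (tw P (y :: l)) =
        φ (tw P ((y * x) :: l)) := by
      rw [tw, pre]
      change φ (0 :: _) + pre φ (fun w => quad (-P : A →ₗ[ℂ] A)
        ((P ^ (l.length + 1)) x :: (P ^ l.length) y :: w)) (tw P l) = _
      have h4 : quad (-P : A →ₗ[ℂ] A) [(P ^ (l.length + 1)) x, (P ^ l.length) y] = (P ^ l.length) (y * x) := by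
        rw [quad, hx, pow_apply_mul hPm, mul_neg, neg_neg]
      rw [hφ.head_zero, zero_add, tw, ← h4]
      cases l with
      | nil => rfl
      | cons z l =>
        exact add_eq_left.mpr (hpre _ _ fun _ => rfl)
    rw [tw, List.length_cons, ins, h3, hx, ih (hφ.cons (-(P ^ l.length) x)) y, bd_cons_cons,
      sub_eq_add_neg]
    congr 1
    have h6 := bd_lin 0 (-1) (fun w => φ (tw P (x :: w))) (fun _ : List A => (0 : A)) (y :: l)
    have h7 := bd_sub 0 (fun _ : List A => (0 : A)) (fun _ => 0) (y :: l)
    simp only [sub_self] at h7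
    rw [h7, add_zero, neg_smul, one_smul] at h6
    rw [← h6]
    refine bd_congr _ _ fun w hw => ?_
    simp only [List.length_cons, add_left_inj] at hw
    rw [hφ.head_neg, tw, hw, neg_smul, one_smul, add_zero]

end Twist

/-! ### Comparison of the signed and unsigned Hochschild differentials. -/

section Bridge

variable {A T : Type*} [Ring A] [Algebra ℂ A] {𝒜 : ℤ → Submodule ℂ A} {R : Subalgebra ℂ A}
  {ρ : T → A →ₗ[ℂ] A} {P : A →ₗ[ℂ] A}

lemma good_single {s : ℕ} (hs : 1 ≤ s) {c t : ℤ} (hc : c - s = t) {f : Multi A s}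
    (hf : f ∈ cochains 𝒜 R ρ s t) : Good 𝒜 R ρ c (toL (Pi.single s f)) := by
  subst hc
  refine Good.toL (by rw [Pi.single_eq_of_ne (by omega)]) fun d hd => ?_
  by_cases h : d = s
  · subst h; rw [Pi.single_eq_same]; exact hf
  · rw [Pi.single_eq_of_ne h]; exact zero_mem _

/-- The cochain `f` as a function on lists, up to an alternating twist. -/
def twL (P : A →ₗ[ℂ] A) {s : ℕ} (f : Multi A s) (l : List A) : A := toL (Pi.single s f) (tw P l)

lemma sgn_congr {m n : ℤ} (h : Even (m - n)) : sgn m = sgn n := by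
  rw [← sub_add_cancel m n, sgn_add, sgn_eq_one h, one_mul]

/-- The Hochschild differential of a cochain of even degree. -/
lemma hochschildDifferential_tw (hσ : IsSign 𝒜 R ρ (-P)) (hP : ∀ a, P (P a) = a)
    (hPm : ∀ a a', P (a * a') = P a * P a') {s : ℕ} (hs : 1 ≤ s) {t : ℤ} (ht : Even t) {f : Multi A s}
    (hf : f ∈ cochains 𝒜 R ρ s t)
    (hPF : ∀ w : List A, toL (Pi.single s f) (w.map P) = P (toL (Pi.single s f) w))
    (p : ℕ → ℤ) {l : List A} (hl : l.length = s + 1)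
    (h : ∀ n < s + 1, seq (tw P l) n ∈ 𝒜 (p n)) :
    hochschildDifferential t f p (seq (tw P l)) =
      (-1 : ℂ) ^ (s - 1) • cobd (mulL A) (mulR A) (twL P f) l := by
  obtain ⟨n, rfl⟩ := Nat.exists_eq_add_of_le' hs
  obtain ⟨x, m, z, rfl, hm⟩ := exists_cons_append hl
  have hPmem : ∀ (q : ℤ) (a : A), a ∈ 𝒜 q → P a = sgn q • a := fun q a ha => by
    have h1 := hσ.apply q a ha
    rw [LinearMap.neg_apply, sgn_sub_one, neg_smul, neg_inj] at h1
    exact h1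
  set F := toL (Pi.single (n + 1) f) with hF
  have hFML : ML F := ML.toL _
  have hgood : Good 𝒜 R ρ (t + (n + 1 : ℕ)) F := good_single hs (by ring) hf
  have e1 : tw P (x :: (m ++ [z])) = (P ^ (n + 1)) x :: ((tw P m).map P ++ [z]) := by
    rw [tw, tw_append_single]; simp [hm]
  have e2 : tw P (m ++ [z]) = (tw P m).map P ++ [z] := tw_append_single m z
  have e3 : tw P (x :: m) = (P ^ n) x :: tw P m := by rw [tw, hm]
  have hlen : ((P ^ (n + 1)) x :: (tw P m).map P).length = n + 1 := by simp [hm]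
  rw [e1] at h
  rw [e1, hochschildDifferential_eq hσ f t p hlen h, ← hF]
  have hhom : HomList 𝒜 ((P ^ (n + 1)) x :: (tw P m).map P)
      (∑ k ∈ Finset.range (n + 1), (p k - 1)) := by
    have := homList_seq (𝒜 := 𝒜) (l := (P ^ (n + 1)) x :: (tw P m).map P) (p := p) fun k hk => by
      have h2 := h k (by omega)
      rwa [← List.cons_append, seq, List.getD_append _ _ _ _ hk] at h2
    rwa [hlen] at this
  have hpow : ∀ (k : ℕ) (q : ℤ) (a : A), a ∈ 𝒜 q → (P ^ k) a = sgn (k * q) • a := by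
    intro k q a ha
    induction k with
    | zero => simp [sgn]
    | succ k ih =>
      rw [pow_succ', Module.End.mul_apply, ih, map_zsmul, hPmem q a ha, smul_smul, ← sgn_add]
      congr 2; push_cast; ring
  have ea := hpow (n + 1) _ _ (h 0 (by omega))
  have ex : (P ^ (n + 1)) ((P ^ (n + 1)) x) = x := pow_apply_pow_apply hP _ _
  have ew : ((P ^ (n + 1)) x :: (tw P m).map P).map P = tw P (x :: m) := by
    rw [e3, List.map_cons, List.map_map, pow_succ', Module.End.mul_apply, hP]
    congr 1
    exact (List.map_congr_left fun a _ => hP a).trans (List.map_id _)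
  have hd := hgood.deg _ _ hhom
  -- The sign of the left multiplication is the parity of the value of f. Since f commutes with P,
  -- it can be moved onto the inputs, where it adjusts the twist.
  have t1 : sgn ((∑ k ∈ Finset.range (n + 1), p k) + t) •
      (z * F ((P ^ (n + 1)) x :: (tw P m).map P)) = z * twL P f (x :: m) := by
    have e7 : twL P f (x :: m) = P (F ((P ^ (n + 1)) x :: (tw P m).map P)) := by
      rw [twL, ← ew]; exact hPF _
    rw [e7, hPmem _ _ hd, mul_smul_comm]
    congr 2
    rw [Finset.sum_sub_distrib]; simp
  have t2 : sgn (((n + 1 : ℕ) + t - 1) * (p 0 - 1)) • sgn (p 0) •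
      (F ((tw P m).map P ++ [z]) * (P ^ (n + 1)) x) =
      (-1 : ℂ) ^ n • (twL P f (m ++ [z]) * x) := by
    have h0 : (P ^ (n + 1)) x ∈ 𝒜 (p 0) := h 0 (by omega)
    have e4 : x = sgn ((n + 1 : ℕ) * p 0) • (P ^ (n + 1)) x := by
      rw [← hpow _ _ _ h0, ex]
    have e5 : twL P f (m ++ [z]) = F ((tw P m).map P ++ [z]) := by rw [twL, e2]
    have e6 : ((-1 : ℂ) ^ n) = ((sgn n : ℤ) : ℂ) := by
      rcases Nat.even_or_odd n with hn | hn
      · rw [hn.neg_one_pow, sgn_eq_one (by exact_mod_cast hn)]; simp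
      · rw [hn.neg_one_pow, sgn_eq_neg_one (by exact_mod_cast hn)]; simp
    conv_rhs => rw [e4, e5, e6, Int.cast_smul_eq_zsmul, mul_smul_comm, smul_smul, ← sgn_add]
    rw [smul_smul, ← sgn_add]
    congr 1
    -- For even t the exponent (n + t)(p 0 - 1) + p 0 is congruent to n + (n + 1) p 0 modulo 2.
    refine sgn_congr ?_
    obtain ⟨t', rfl⟩ := ht
    exact ⟨t' * (p 0 - 1) - n, by push_cast; ring⟩
  have t3 : sgn ((n + 1 : ℕ) + t) • ins (-P) (quad (-P : A →ₗ[ℂ] A)) F ((P ^ (n + 1)) x :: ((tw P m).map P ++ [z])) =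
      -(-1 : ℂ) ^ n • bd 0 (twL P f) (x :: (m ++ [z])) := by
    rw [← e1, ins_quad_tw hP hPm hFML]
    have e6 : (-(-1 : ℂ) ^ n) = ((sgn ((n + 1 : ℕ) + t) : ℤ) : ℂ) := by
      rcases Nat.even_or_odd n with hn | hn
      · rw [hn.neg_one_pow, sgn_eq_neg_one (Odd.add_even (by exact_mod_cast hn.add_one) ht)]; simp
      · rw [hn.neg_one_pow, sgn_eq_one (Even.add (by exact_mod_cast hn.add_one) ht)]; simp
    rw [e6, Int.cast_smul_eq_zsmul]
    rfl
  rw [t1, t2, t3, cobd, ← List.cons_append, bd_mulL_append (mulL A), List.length_cons, hm]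
  change _ = (-1 : ℂ) ^ n • (twL P f (m ++ [z]) * x - (_ + (-1 : ℂ) ^ (n + 1) • (z * twL P f (x :: m))))
  rw [smul_sub, smul_add, smul_smul, pow_succ, mul_neg, mul_one, mul_neg, ← pow_add, ← two_mul,
    pow_mul, neg_one_sq, one_pow, neg_smul, neg_smul, one_smul]
  abel

lemma app_eq_zero_of_forall {s : ℕ} {f : Multi A s} (h : ∀ l : List A, l.length = s →
    toL (Pi.single s f) l = 0) : f = 0 := by
  ext a
  have h1 := toL_ofFn (Pi.single s f) s a
  rw [Pi.single_eq_same, h _ (by simp)] at h1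
  exact h1.symm

end Bridge

/-! ### Cocycles and coboundaries on Q_4. -/

section Cohomology

variable {V : Type*} [AddCommGroup V] [Module ℂ V]

lemma bd_map_emb (f : List (Q4 V) → Q4 V) (l : List (ExteriorAlgebra ℂ V)) :
    bd (mulL (Q4 V)) f (l.map emb) = bd actL (fun w => f (w.map emb)) l := by
  induction l generalizing f with
  | nil => rfl
  | cons x l ih =>
    cases l with
    | nil => rfl
    | cons y l =>
      have h1 := ih fun w => f (emb x :: w)
      rw [List.map_cons] at h1
      rw [List.map_cons, List.map_cons, bd_cons_cons, bd_cons_cons, h1, List.map_cons,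
        map_mul emb]
      rfl

/-- The Hochschild differential on `Q_4`, without signs from gradings. -/
def dQ (f : List (Q4 V) → Q4 V) (l : List (Q4 V)) : Q4 V := cobd (mulL (Q4 V)) (mulR (Q4 V)) f l

lemma ML.dQ {f : List (Q4 V) → Q4 V} (hf : ML f) : ML (dQ f) := hf.cobd _ _

lemma parity_mul (a a' : Q4 V) : parity (a * a') = parity a * parity a' := rhoG_mul _ _ _

lemma parity_of_mem_R4 (r : Q4 V) (hr : r ∈ R4 V) : parity r = r := rhoG_of_mem_R4 _ hr

/-- The alternating twist of a list by the parity. -/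
def twQ (l : List (Q4 V)) : List (Q4 V) := tw parity l

lemma twQ_twQ (l : List (Q4 V)) : twQ (twQ l) = l := tw_tw parity_parity l

@[simp] lemma length_twQ (l : List (Q4 V)) : (twQ l).length = l.length := length_tw l

lemma twQ_map (g : V ≃ₗ[ℂ] V) (l : List (Q4 V)) :
    twQ (l.map (rhoG g)) = (twQ l).map (rhoG g) :=
  tw_map (g := rhoG g) (fun a => rhoG_scal_comm _ _ a) l

lemma ML.twQ {f : List (Q4 V) → Q4 V} (hf : ML f) : ML fun l => f (twQ l) := hf.tw

/-- The cochain `f` as a function on lists, up to an alternating twist. -/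
def twF {s : ℕ} (f : Multi (Q4 V) s) (l : List (Q4 V)) : Q4 V := toL (Pi.single s f) (twQ l)

lemma ML.twF {s : ℕ} (f : Multi (Q4 V) s) : ML (twF f) := (ML.toL _).twQ

lemma dQ_map_emb (f : List (Q4 V) → Q4 V) (l : List (ExteriorAlgebra ℂ V)) :
    dQ f (l.map emb) = cobd actL actR (fun w => f (w.map emb)) l := by
  cases l with
  | nil => rfl
  | cons x l => rw [List.map_cons, dQ, cobd, cobd, ← bd_map_emb, List.map_cons]; rfl

lemma cobd_congr {B Z : Type*} [Ring B] [Algebra ℂ B] [AddCommGroup Z] [Module ℂ Z]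
    (act ract : B →ₗ[ℂ] Z →ₗ[ℂ] Z) {f g : List B → Z} (l : List B)
    (h : ∀ w : List B, w.length + 1 = l.length → f w = g w) :
    cobd act ract f l = cobd act ract g l := by
  cases l with
  | nil => rfl
  | cons x l => rw [cobd, cobd, bd_congr _ _ h, h l rfl]

lemma dQ_congr {f g : List (Q4 V) → Q4 V} (l : List (Q4 V))
    (h : ∀ w : List (Q4 V), w.length + 1 = l.length → f w = g w) : dQ f l = dQ g l :=
  cobd_congr _ _ l h

variable {b : Module.Basis (Fin 4) ℂ V} {lift : projTorus b → torus b}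

lemma twF_of_length_ne {s : ℕ} (f : Multi (Q4 V) s) {l : List (Q4 V)} (hl : l.length ≠ s) :
    twF f l = 0 := toL_single_of_ne f (by simpa using hl)

section

variable {s : ℕ} {t : ℤ} {f : Multi (Q4 V) s}
  (hf : f ∈ cochains (Q4.degree V) (R4 V) (rhoT b lift) s t) (hs : 1 ≤ s)

include hf hs

lemma twF_bal : Bal (R4 V) (twF f) :=
  Bal.tw parity_mul parity_of_mem_R4 (good_single hs (add_sub_cancel_right t (s : ℤ)) hf).bal

lemma twF_lastLin : LastLin (R4 V) (twF f) :=
  LastLin.tw parity_mul parity_of_mem_R4 (good_single hs (add_sub_cancel_right t (s : ℤ)) hf).last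

lemma twF_headLin : HeadLin (R4 V) (twF f) :=
  HeadLin.tw parity_mul parity_of_mem_R4 (good_single hs (add_sub_cancel_right t (s : ℤ)) hf).head

lemma twF_nil : twF f [] = 0 :=
  (good_single hs (add_sub_cancel_right t (s : ℤ)) hf).nil

lemma twF_map_diag (hlift : ∀ t : projTorus b, (QuotientGroup.mk (lift t) : projTorus b) = t)
    {m : ℕ} (hm : t = -(2 * m)) (h : Fin 4 → ℂˣ) (l : List (Q4 V)) :
    twF f (l.map (rhoG (diagEquiv b h))) =
      (∏ i, (h i : ℂ)) ^ m • rhoG (diagEquiv b h) (twF f l) := by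
  by_cases hl : l.length = s
  · rw [twF, twF, twQ_map]
    refine (good_single hs (add_sub_cancel_right t (s : ℤ)) hf).map_diag hlift h _ ?_
    rw [length_twQ, hl, hm]; ring
  · rw [twF_of_length_ne f hl, twF_of_length_ne f (by simpa using hl), map_zero, smul_zero]

lemma cochain_parity (w : List (Q4 V)) :
    toL (Pi.single s f) (w.map parity) = parity (toL (Pi.single s f) w) :=
  (good_single hs (add_sub_cancel_right t (s : ℤ)) hf).scal_root (r := -1) (by norm_num) w

lemma cochain_eq_zero_of_odd (ht : Odd t) : f = 0 :=
  app_eq_zero_of_forall fun l hl =>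
    (good_single hs (add_sub_cancel_right t (s : ℤ)) hf).eq_zero_of_odd l
      (by rw [hl, sub_add_cancel_right]; exact ht.neg)

lemma differential_tw (ht : Even t) (p : ℕ → ℤ) {l : List (Q4 V)} (hl : l.length = s + 1)
    (h : ∀ n < s + 1, seq (twQ l) n ∈ Q4.degree V (p n)) :
    hochschildDifferential t f p (seq (twQ l)) =
      (-1 : ℂ) ^ (s - 1) • dQ (twF f) l :=
  hochschildDifferential_tw (isSign_parity b lift) parity_parity parity_mul hs ht hf
    (cochain_parity hf hs) p hl h

lemma dQ_twF_of_mem_cocycles (ht : Even t)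
    (hc : f ∈ cocycles (Q4.degree V) (R4 V) (rhoT b lift) s t) (l : List (Q4 V))
    (hl : l.length = s + 1) : dQ (twF f) l = 0 := by
  have hML : ML fun l => dQ (twF f) (twQ l) :=
    ((ML.twF f).dQ).twQ
  have h1 := hML.eq_zero_of_homList iSup_degree (n := s + 1) (fun w q hw hn => ?_) (twQ l)
    (by simpa using hl)
  · rwa [twQ_twQ] at h1
  · obtain ⟨p, hp⟩ := hw.exists_seq
    have h2 := differential_tw hf hs ht p (l := twQ w) (by simpa using hn)
      (fun n _ => by rw [twQ_twQ]; exact hp n)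
    rw [twQ_twQ, hc.2 p _ hp, eq_comm, smul_eq_zero] at h2
    exact h2.resolve_left (pow_ne_zero _ (by norm_num))

lemma mem_cocycles_of_dQ_twF (ht : Even t)
    (h : ∀ l : List (Q4 V), l.length = s + 1 →
      dQ (twF f) l = 0) :
    f ∈ cocycles (Q4.degree V) (R4 V) (rhoT b lift) s t := by
  refine ⟨hf, fun p a ha => ?_⟩
  rw [hochschildDifferential_congr (a' := seq (List.ofFn fun i : Fin (s + 1) => a i))
    _ _ _ fun n hn => (seq_ofFn a hn).symm,
    ← twQ_twQ (List.ofFn fun i : Fin (s + 1) => a i),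
    differential_tw hf hs ht p (by simp) (fun n hn => by
      rw [twQ_twQ, seq_ofFn a hn]; exact ha n), h _ (by simp), smul_zero]

end

section

variable {s : ℕ} {t : ℤ} (hs : 1 ≤ s) (ht : Even t) {f : Multi (Q4 V) (s + 1)} {g : Multi (Q4 V) s}
  (hf : f ∈ cochains (Q4.degree V) (R4 V) (rhoT b lift) (s + 1) t)
  (hg : g ∈ cochains (Q4.degree V) (R4 V) (rhoT b lift) s t)

include hs ht hf hg

lemma mem_coboundaries_of_dQ_twF (h : ∀ l : List (Q4 V), l.length = s + 1 → twF f l =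
      (-1 : ℂ) ^ (s - 1) • dQ (twF g) l) :
    f ∈ coboundaries (Q4.degree V) (R4 V) (rhoT b lift) s t := by
  refine ⟨hf, g, hg, fun p a ha => ?_⟩
  rw [hochschildDifferential_congr (a' := seq (List.ofFn fun i : Fin (s + 1) => a i))
    _ _ _ fun n hn => (seq_ofFn a hn).symm,
    app_congr f (a' := seq (List.ofFn fun i : Fin (s + 1) => a i))
    fun n hn => (seq_ofFn a hn).symm, ← toL_single f (by simp),
    ← twQ_twQ (List.ofFn fun i : Fin (s + 1) => a i),
    differential_tw hg hs ht p (by simp) (fun n hn => by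
      rw [twQ_twQ, seq_ofFn a hn]; exact ha n), ← h _ (by simp)]
  rfl

lemma twF_eq_dQ_twF (h : ∀ (p : ℕ → ℤ) (a : ℕ → Q4 V), (∀ n, a n ∈ Q4.degree V (p n)) →
      app f a = hochschildDifferential t g p a) (l : List (Q4 V)) (hl : l.length = s + 1) :
    twF f l = (-1 : ℂ) ^ (s - 1) • dQ (twF g) l := by
  have hML : ML fun l => twF f (twQ l) -
      (-1 : ℂ) ^ (s - 1) • dQ (twF g) (twQ l) :=
    (ML.twF f).twQ.sub (((ML.twF g).dQ).twQ.smul _)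
  have h1 := hML.eq_zero_of_homList iSup_degree (n := s + 1) (fun w q hw hn => ?_) (twQ l)
    (by simpa using hl)
  · rwa [twQ_twQ, sub_eq_zero] at h1
  · obtain ⟨p, hp⟩ := hw.exists_seq
    have h2 := differential_tw hg hs ht p (l := twQ w) (by simpa using hn)
      (fun n _ => by rw [twQ_twQ]; exact hp n)
    rw [← h2, twQ_twQ, ← h p _ hp, twF, twQ_twQ, toL_single f hn, sub_self]

end

/-- Equivariant functions on lists of elements of the exterior algebra extend to cochains. -/
lemma exists_cochain {s m : ℕ} (hs : 1 ≤ s) {t : ℤ} (ht : t = -(2 * m))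
    {G : List (ExteriorAlgebra ℂ V) → Q4 V} (hG : ML G)
    (hG0 : ∀ l : List (ExteriorAlgebra ℂ V), l.length ≠ s → G l = 0)
    (hGρ : ∀ (h : Fin 4 → ℂˣ) l, G (l.map (extDiag b h)) =
      (∏ i, (h i : ℂ)) ^ m • rhoG (diagEquiv b h) (G l)) :
    (∀ l, ext4 G (l.map emb) = G l) ∧
    ∃ γ ∈ cochains (Q4.degree V) (R4 V) (rhoT b lift) s t, ∀ w, twF γ w = ext4 G w := by
  set E := ext4 G with hE
  have hEML : ML E := hG.ext4
  have hE0 : ∀ l : List (Q4 V), l.length ≠ s → E l = 0 := fun l hl => by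
    rw [hE, ← ext4_zero l]
    exact ext4_congr l fun w hw => hG0 w (by rwa [hw])
  have hEρ : ∀ (h : Fin 4 → ℂˣ) (l : List (Q4 V)), E (l.map (rhoG (diagEquiv b h))) =
      (∏ i, (h i : ℂ)) ^ m • rhoG (diagEquiv b h) (E l) := fun h l =>
    ext4_map _ _ l fun w _ => hGρ h w
  refine ⟨fun l => ?_, ?_⟩
  -- The scalar i has determinant one in dimension four, so G commutes with it without a factor;
  -- this is the weight condition needed to recover G from its extension.
  · set r : ℂˣ := Units.mk0 Complex.I Complex.I_ne_zero with hr
    have hr4 : IsPrimitiveRoot r 4 := by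
      refine IsPrimitiveRoot.coe_units_iff.mp ?_
      exact Complex.isPrimitiveRoot_I
    refine ext4_map_emb hr4 hG l fun w _ => ?_
    have h1 := hGρ (fun _ => r) w
    rw [extDiag, diagEquiv_const] at h1
    rw [h1]
    simp [hr]
  have hgood : Good (Q4.degree V) (R4 V) (rhoT b lift) (s - 2 * m)
      (fun l => E (twQ l)) :=
    Good.of_diag hs hEML.twQ ((ext4_bal hG).tw parity_mul parity_of_mem_R4)
      ((ext4_lastLin hG).tw parity_mul parity_of_mem_R4)
      ((ext4_headLin hG).tw parity_mul parity_of_mem_R4)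
      (fun l hl => hE0 _ (by simpa using hl))
      (fun h l _ => by rw [twQ_map, hEρ])
  refine ⟨toMulti s _ hgood.ml, ?_, fun w => ?_⟩
  · have := hgood.toMulti_mem s
    rwa [show (s - 2 * m - s : ℤ) = t by rw [ht]; ring] at this
  · by_cases hw : w.length = s
    · rw [twF, toL_single _ (by simpa using hw), app_toMulti, ← hw, ← length_twQ, ofFn_seq, twQ_twQ]
    · rw [twF_of_length_ne _ hw, hE0 w hw]

/-- Equivariant cocycles are coboundaries, except for a scalar obstruction. -/
theorem mem_coboundaries (hlift : ∀ t : projTorus b, (QuotientGroup.mk (lift t) : projTorus b) = t)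
    {m : ℕ} (hm : 1 ≤ m) {t : ℤ} (ht : t = -(2 * m)) {f : Multi (Q4 V) (2 * m + 1 + 1)}
    (hc : f ∈ cocycles (Q4.degree V) (R4 V) (rhoT b lift) (2 * m + 1 + 1) t)
    (hχ : m = 1 →
      qProj 0 (twF f (List.replicate 4 (emb (ExteriorAlgebra.ι ℂ (∑ i, b i))))) = 0) :
    f ∈ coboundaries (Q4.degree V) (R4 V) (rhoT b lift) (2 * m + 1) t := by
  have hte : Even t := ⟨-m, by rw [ht]; ring⟩
  have hf := hc.1
  have hs : 1 ≤ 2 * m + 1 + 1 := by omega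
  set F := twF f with hF
  have hmap : ∀ (h : Fin 4 → ℂˣ) (l : List (ExteriorAlgebra ℂ V)),
      (l.map (extDiag b h)).map emb = (l.map emb).map (rhoG (diagEquiv b h)) := fun h l => by
    rw [List.map_map, List.map_map]
    exact List.map_congr_left fun x _ => (rhoG_emb _ _).symm
  -- Restriction to the exterior algebra gives a cocycle with coefficients in Q_4. Its primitive is
  -- then extended R_4-multilinearly.
  obtain ⟨g, hg, hgρ, hGg⟩ := exists_primitive b hm (G := fun l => F (l.map emb))
    ((fun u v x y c => by
      simpa using ML.twF f (u.map emb) (v.map emb) (emb x) (emb y) c))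
    (fun h l => by
      rw [hmap, hF, twF_map_diag hf hs hlift ht]; rfl)
    (fun l hl => by
      rw [← dQ_map_emb]
      exact dQ_twF_of_mem_cocycles hf hs hte hc _ (by simpa using hl))
    (fun h1 => by simpa using hχ h1)
  -- Only the component of arity 2m + 1 matters; the others are set to zero so that the extension is
  -- a cochain of one arity.
  let g1 : List (ExteriorAlgebra ℂ V) → Q4 V := fun l => if l.length = 2 * m + 1 then g l else 0
  have hg1 : ML g1 := by
    intro u v x y c
    have e : ∀ z, (u ++ z :: v).length = (u ++ x :: v).length := fun z => by simp
    simp only [g1, e (c • x + y), e y]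
    split_ifs
    · exact hg u v x y c
    · simp
  have hg1ρ : ∀ (h : Fin 4 → ℂˣ) l, g1 (l.map (extDiag b h)) =
      (∏ i, (h i : ℂ)) ^ m • rhoG (diagEquiv b h) (g1 l) := by
    intro h l
    simp only [g1, List.length_map]
    split_ifs
    · exact hgρ h l
    · simp
  obtain ⟨hEemb, γ, hγm, hγE⟩ := exists_cochain (lift := lift) (by omega) ht hg1
    (fun l hl => if_neg hl) hg1ρ
  set E := ext4 g1 with hE
  have hEML : ML E := hg1.ext4
  have hEnil : E [] = 0 := by rw [← hγE]; exact twF_nil hγm (by omega)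
  refine mem_coboundaries_of_dQ_twF (by omega) hte hf hγm fun l hl => ?_
  rw [show 2 * m + 1 - 1 = 2 * m by omega, pow_mul, neg_one_sq, one_pow, one_smul,
    dQ_congr (g := E) l fun w _ => hγE w]
  -- Both sides are bimodule maps, so it is enough to compare them on the exterior algebra.
  refine eq_of_comp_emb (ML.twF f) (twF_bal hf hs) (twF_lastLin hf hs) (hEML.dQ)
    ((ext4_bal hg1).cobd (ext4_lastLin hg1) (ext4_headLin hg1)) ((ext4_lastLin hg1).cobd hEnil)
    (twF_headLin hf hs) ((ext4_headLin hg1).cobd hEnil) l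
    (by rintro rfl; simp at hl) fun w hw => ?_
  rw [dQ_map_emb]
  refine (hGg w (by omega)).trans (cobd_congr _ _ w fun w' hw' => ?_)
  rw [hEemb]
  exact (if_pos (by omega)).symm

end Cohomology

/-! ### The cocycle of y_0 y_1 y_2 y_3 as a cup product of derivations. -/

section Cup

variable {V : Type*} [AddCommGroup V] [Module ℂ V]

/-- The cup product of a list of linear maps from the exterior algebra to `Q_4`. -/
def cup : List (ExteriorAlgebra ℂ V →ₗ[ℂ] Q4 V) → List (ExteriorAlgebra ℂ V) → Q4 V
  | [], [] => 1
  | d :: ds, x :: l => cup ds l * d x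
  | [], _ :: _ => 0
  | _ :: _, [] => 0

lemma cup_of_length_ne {ds : List (ExteriorAlgebra ℂ V →ₗ[ℂ] Q4 V)} {l : List (ExteriorAlgebra ℂ V)}
    (h : l.length ≠ ds.length) : cup ds l = 0 := by
  induction ds generalizing l with
  | nil => cases l with
    | nil => simp at h
    | cons x l => rfl
  | cons d ds ih => cases l with
    | nil => rfl
    | cons x l => rw [cup, ih (by simpa using h), zero_mul]

lemma ML.cup (ds : List (ExteriorAlgebra ℂ V →ₗ[ℂ] Q4 V)) : ML (cup ds) := by
  intro u v x y c
  induction ds generalizing u with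
  | nil => cases u <;> simp [SeidelQ.cup]
  | cons d ds ih =>
    cases u with
    | nil => simp [SeidelQ.cup, mul_add]
    | cons z u => simp only [List.cons_append, SeidelQ.cup, ih, add_mul, smul_mul_assoc]

/-- Cup products of derivations are cocycles. -/
lemma bd_cup {ds : List (ExteriorAlgebra ℂ V →ₗ[ℂ] Q4 V)}
    (hd : ∀ d ∈ ds, ∀ x y, d (y * x) = emb y * d x + d y * emb x) (x : ExteriorAlgebra ℂ V)
    (l : List (ExteriorAlgebra ℂ V)) : bd actL (cup ds) (x :: l) = cup ds l * emb x := by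
  induction ds generalizing x l with
  | nil =>
    cases l with
    | nil => simp [cup]
    | cons y l =>
      have h := bd_sub actL (fun _ : List (ExteriorAlgebra ℂ V) => (0 : Q4 V)) (fun _ => 0) (y :: l)
      simp only [sub_self] at h
      rw [bd_cons_cons]
      change 0 - bd actL (fun _ => 0) (y :: l) = 0 * _
      rw [h, zero_mul, sub_zero]
  | cons d ds ih =>
    cases l with
    | nil => simp [cup]
    | cons y l =>
      have h := bd_comp (act := actL) (act' := actL) (AlgHom.id ℂ _) (LinearMap.mulRight ℂ (d x))
        (fun x z => by simp [mul_assoc]) (f := cup ds) (f' := fun w => cup (d :: ds) (x :: w))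
        (fun w => by simp [cup]) (y :: l)
      simp only [AlgHom.coe_id, List.map_id_fun, id] at h
      rw [bd_cons_cons, h, ih (fun d hd' => hd d (List.mem_cons_of_mem _ hd')), cup, cup,
        hd d List.mem_cons_self, LinearMap.mulRight_apply, mul_add, mul_assoc, mul_assoc]
      abel

/-- The sign operator, which anticommutes with vectors. -/
def signD : Q4 V := diagR fun k => (-1) ^ (k : ℕ)

lemma emb_ι_mul_signD (v : V) :
    emb (ExteriorAlgebra.ι ℂ v) * signD = -(signD * emb (ExteriorAlgebra.ι ℂ v)) := by
  refine Q4.ext_entry fun k j => ?_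
  rw [_root_.map_neg, signD, entry_mul_diagR, entry_diagR_mul, emb_ι, entry_arrowSum]
  split_ifs with h
  · subst h
    rw [← neg_smul]
    congr 1
    have h1 : ∀ j : Fin 4, (-1 : ℤ) ^ (j : ℕ) = -(-1) ^ ((j + 1 : Fin 4) : ℕ) := by decide
    exact_mod_cast congrArg (Int.cast : ℤ → ℂ) (h1 j)
  · simp

lemma signD_mul_signD : (signD * signD : Q4 V) = 1 := by
  rw [signD, diagR_mul, ← diagR_one]
  congr 1
  funext k
  fin_cases k <;> norm_num

variable (b : Module.Basis (Fin 4) ℂ V)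

/-- The derivation with values in `Q_4` given by a coordinate. -/
def deriv (i : Fin 4) : ExteriorAlgebra ℂ V →ₗ[ℂ] Q4 V :=
  (LinearMap.mulRight ℂ signD).comp (emb.toLinearMap.comp (contr b i))

lemma deriv_apply (i : Fin 4) (x : ExteriorAlgebra ℂ V) : deriv b i x = emb (contr b i x) * signD :=
  rfl

/-- Contraction alone is an antiderivation. The factor `signD`, which anticommutes with vectors,
corrects the sign in the Leibniz rule. -/
lemma deriv_mul_ι (i : Fin 4) (x : ExteriorAlgebra ℂ V) (v : V) :
    deriv b i (x * ExteriorAlgebra.ι ℂ v) =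
      b.coord i v • (emb x * signD) + deriv b i x * emb (ExteriorAlgebra.ι ℂ v) := by
  have h : signD * emb (ExteriorAlgebra.ι ℂ v) = -(emb (ExteriorAlgebra.ι ℂ v) * signD) := by
    rw [emb_ι_mul_signD, neg_neg]
  rw [deriv_apply, contr_mul_ι, map_sub, map_smul, map_mul emb, deriv_apply, sub_mul, smul_mul_assoc,
    mul_assoc _ signD, h, mul_assoc, sub_eq_add_neg]
  congr 1
  exact (mul_neg (emb (contr b i x)) (emb (ExteriorAlgebra.ι ℂ v) * signD)).symm

lemma deriv_algebraMap (i : Fin 4) (c : ℂ) : deriv b i (algebraMap ℂ (ExteriorAlgebra ℂ V) c) = 0 := by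
  rw [deriv_apply, contr_algebraMap, map_zero, zero_mul]

lemma deriv_ι (i : Fin 4) (v : V) :
    deriv b i (ExteriorAlgebra.ι ℂ v) = b.coord i v • signD := by
  have h := deriv_mul_ι b i 1 v
  have h1 := deriv_algebraMap b i 1
  rw [map_one] at h1
  rwa [one_mul, map_one emb, one_mul, h1, zero_mul, add_zero] at h

lemma deriv_mul (i : Fin 4) (x y : ExteriorAlgebra ℂ V) :
    deriv b i (y * x) = emb y * deriv b i x + deriv b i y * emb x := by
  induction x using CliffordAlgebra.right_induction with
  | algebraMap r =>
    change deriv b i (y * algebraMap ℂ (ExteriorAlgebra ℂ V) r) =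
      emb y * deriv b i (algebraMap ℂ (ExteriorAlgebra ℂ V) r) +
        deriv b i y * emb (algebraMap ℂ (ExteriorAlgebra ℂ V) r)
    rw [deriv_algebraMap, mul_zero, zero_add, Algebra.algebraMap_eq_smul_one, map_smul, map_one emb,
      mul_smul_comm, mul_one, map_smul, mul_smul_comm, mul_one]
  | add x x' hx hx' =>
    rw [mul_add, _root_.map_add, hx, hx', _root_.map_add, _root_.map_add, mul_add, mul_add]
    abel
  | mul_ι v x hx =>
    change deriv b i (y * (x * ExteriorAlgebra.ι ℂ v)) =
      emb y * deriv b i (x * ExteriorAlgebra.ι ℂ v) +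
        deriv b i y * emb (x * ExteriorAlgebra.ι ℂ v)
    rw [← mul_assoc, deriv_mul_ι, hx, deriv_mul_ι, map_mul emb, map_mul emb, add_mul, mul_add,
      mul_smul_comm]
    simp only [mul_assoc]
    abel

lemma deriv_extDiag (h : Fin 4 → ℂˣ) (i : Fin 4) (x : ExteriorAlgebra ℂ V) :
    deriv b i (extDiag b h x) = (h i : ℂ) • rhoG (diagEquiv b h) (deriv b i x) := by
  rw [deriv_apply, contr_extDiag, deriv_apply, rhoG_mul, signD, rhoG_diagR, map_smul, smul_mul_assoc]
  congr 2
  exact (rhoG_emb _ _).symm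

/-- The cup product of the derivations given by the coordinates. -/
def cup4 : List (ExteriorAlgebra ℂ V) → Q4 V := cup (List.ofFn (deriv b))

lemma cup4_extDiag (h : Fin 4 → ℂˣ) (l : List (ExteriorAlgebra ℂ V)) :
    cup4 b (l.map (extDiag b h)) = (∏ i, (h i : ℂ)) ^ 1 • rhoG (diagEquiv b h) (cup4 b l) := by
  by_cases hl : l.length = 4
  · obtain ⟨x1, x2, x3, x4, rfl⟩ : ∃ x1 x2 x3 x4, l = [x1, x2, x3, x4] := by
      match l, hl with
      | [x1, x2, x3, x4], _ => exact ⟨x1, x2, x3, x4, rfl⟩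
    simp only [cup4, List.ofFn_succ, List.ofFn_zero, List.map_cons, List.map_nil, cup, deriv_extDiag,
      rhoG_mul, Fin.prod_univ_four, one_mul, smul_mul_assoc, mul_smul_comm, smul_smul, pow_one]
    congr 1
    change (h 0 : ℂ) * (h 1 * (h 2 * h 3)) = _
    ring
  · rw [cup4, cup_of_length_ne (by simpa using hl), cup_of_length_ne (by simpa using hl), map_zero,
      smul_zero]

/-- Each derivation sends v to a coordinate times `signD`, and the four factors `signD` cancel in
pairs. -/
lemma cup4_ι (v : V) : cup4 b (List.replicate 4 (ExteriorAlgebra.ι ℂ v)) =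
    (∏ i, b.coord i v) • 1 := by
  simp only [cup4, List.ofFn_succ, List.ofFn_zero, List.replicate_succ, List.replicate_zero, cup,
    deriv_ι, one_mul, smul_mul_assoc, mul_smul_comm, smul_smul, signD_mul_signD, Fin.prod_univ_four]
  congr 1
  change b.coord 0 v * (b.coord 1 v * (b.coord 2 v * b.coord 3 v)) = _
  ring

end Cup

/-! ### Values of cocycles on powers of a vector. -/

section Scalar

variable {V : Type*} [AddCommGroup V] [Module ℂ V]

lemma psum_arrow (G : List (ExteriorAlgebra ℂ V) → Q4 V) (hG : ML G) (v : V) (j j' : Fin 4)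
    (l : List (Q4 V)) : psum G j' (arrow v j :: l) =
      if j = j' then psum (fun w => G (ExteriorAlgebra.ι ℂ v :: w)) (j + 1) l else 0 := by
  rw [psum, Finset.sum_eq_single (j + 1) (fun k _ hk => ?_) (by simp)]
  · simp only [entry_arrow, true_and]
    split_ifs
    · rfl
    · simp only [hG.head_zero, psum_zero]
  · simp only [entry_arrow, hk.symm, false_and, if_false, hG.head_zero, psum_zero]

lemma ext4_arrow {G : List (ExteriorAlgebra ℂ V) → Q4 V} (hG : ML G) (v : V) (j : Fin 4) :
    ext4 G (List.ofFn fun i : Fin 4 => arrow v (j + i)) =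
      idem j * G (List.replicate 4 (ExteriorAlgebra.ι ℂ v)) * idem j := by
  have e1 : j + 0 = j := add_zero j
  have e2 : j + 1 + 1 = j + 2 := by rw [add_assoc]; rfl
  have e3 : j + 2 + 1 = j + 3 := by rw [add_assoc]; rfl
  have e4 : j + 3 + 1 = j := by rw [add_assoc]; exact add_zero j
  have h : (List.ofFn fun i : Fin 4 => arrow v (j + i)) =
      [arrow v j, arrow v (j + 1), arrow v (j + 2), arrow v (j + 3)] := by
    simp [List.ofFn_succ, Fin.succ]
  rw [ext4, h, Finset.sum_eq_single j (fun j' _ hj => ?_) (by simp)]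
  · rw [psum_arrow G hG, if_pos rfl, psum_arrow _ (hG.cons _), if_pos rfl,
      psum_arrow _ ((hG.cons _).cons _), if_pos e2.symm, psum_arrow _ (((hG.cons _).cons _).cons _),
      if_pos e3.symm, e4, psum]
    rfl
  · rw [psum_arrow G hG, if_neg hj.symm, zero_mul]

/-- The scalar obstruction. -/
lemma exists_eq_smul_one (b : Module.Basis (Fin 4) ℂ V) {z : Q4 V}
    (hz : rhoG (scal (Units.mk0 2 two_ne_zero)) z = z) {v : V} (hv : v ≠ 0)
    (hc : z * emb (ExteriorAlgebra.ι ℂ v) = emb (ExteriorAlgebra.ι ℂ v) * z) :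
    ∃ c : ℂ, z = c • 1 := by
  have h0 : ∀ p, 1 ≤ p → qProj p z = 0 := by
    intro p hp
    -- Invariance under scaling by 2 excludes positive exterior degree, hence z is a diagonal matrix
    -- of scalars.
    have h1 := qProj_rhoG p (scal (Units.mk0 2 two_ne_zero)) z
    rw [hz, rhoG_scal_qProj] at h1
    by_contra h2
    have h3 : (2 : ℂ) ^ p = 1 := smul_left_injective ℂ h2 (by
      change (2 : ℂ) ^ p • qProj p z = (1 : ℂ) • qProj p z
      rw [one_smul]; exact h1.symm)
    have h4 : ((2 ^ p : ℕ) : ℂ) = ((1 : ℕ) : ℂ) := by push_cast; exact h3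
    exact (Nat.one_lt_two_pow (by omega)).ne' (Nat.cast_injective h4)
  have h1 : z = qProj 0 z := by
    rw [← sub_eq_zero]
    refine ext_qProj b fun p _ => ?_
    rw [map_sub, qProj_qProj]
    split_ifs with hp
    · subst hp; exact sub_self _
    · rw [h0 p (by omega), sub_zero]
  have h2 : ∀ k j, k ≠ j → entry k j z = 0 := fun k j hkj => by
    rw [h1, entry_qProj, extProj_of_mem_homSpace (entry_mem z k j), if_neg]
    intro h
    have := k.2; have := j.2
    exact hkj (Fin.ext (by simp only [Nat.ModEq] at h; omega))
  have h3 : ∀ k, ∃ r : ℂ, entry k k z = algebraMap ℂ _ r := fun k =>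
    ⟨aug (entry k k z), by conv_lhs => rw [h1, entry_qProj, extProj_zero]⟩
  choose r hr using h3
  have hι : ExteriorAlgebra.ι ℂ v ≠ 0 := fun h => hv ((ExteriorAlgebra.ι_eq_zero_iff v).mp h)
  -- Commuting with v identifies consecutive diagonal entries.
  have h4 : ∀ k, r (k + 1) = r k := fun k => by
    have h5 := congrArg (entry (k + 1) k) hc
    rw [entry_mul_emb_ι, entry_emb_ι_mul, hr, hr, Algebra.algebraMap_eq_smul_one,
      Algebra.algebraMap_eq_smul_one, smul_mul_assoc, mul_smul_comm, one_mul, mul_one] at h5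
    exact smul_left_injective ℂ hι h5
  have h5 : ∀ k, r k = r 0 := by
    have e1 := h4 0; have e2 := h4 1; have e3 := h4 2
    have e2' : r 2 = r 1 := e2
    have e3' : r 3 = r 2 := e3
    intro k
    fin_cases k
    · rfl
    · exact e1
    · exact e2'.trans e1
    · exact e3'.trans (e2'.trans e1)
  refine ⟨r 0, Q4.ext_entry fun k j => ?_⟩
  rw [map_smul, entry_one]
  split_ifs with h
  · subst h; rw [hr, h5, Algebra.algebraMap_eq_smul_one]
  · rw [h2 k j h, smul_zero]

end Scalar

/-! ### Transport of A∞-structures along symmetries. -/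

section Transport

variable {A T : Type*} [Ring A] [Algebra ℂ A] {𝒜 : ℤ → Submodule ℂ A} {R : Subalgebra ℂ A}
  {ρ : T → A →ₗ[ℂ] A}

/-- Conjugation of a multilinear map by a linear automorphism. -/
def Multi.conj (φ : A ≃ₗ[ℂ] A) {s : ℕ} (f : Multi A s) : Multi A s :=
  (φ.symm : A →ₗ[ℂ] A).compMultilinearMap (f.compLinearMap fun _ => (φ : A →ₗ[ℂ] A))

lemma Multi.conj_apply (φ : A ≃ₗ[ℂ] A) {s : ℕ} (f : Multi A s) (a : Fin s → A) :
    f.conj φ a = φ.symm (f fun i => φ (a i)) := rfl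

variable (𝒜 R ρ) in
/-- The symmetries which can be used to transport equivariant structures. -/
structure IsSymmetry (φ : A ≃ₗ[ℂ] A) : Prop where
  deg : ∀ n a, φ a ∈ 𝒜 n ↔ a ∈ 𝒜 n
  mul : ∀ a a', φ (a * a') = φ a * φ a'
  fixed : ∀ r ∈ R, φ r = r
  comm : ∀ t a, φ (ρ t a) = ρ t (φ a)

variable {φ : A ≃ₗ[ℂ] A}

lemma IsSymmetry.symm (hφ : IsSymmetry 𝒜 R ρ φ) : IsSymmetry 𝒜 R ρ φ.symm where
  deg n a := by rw [← hφ.deg, LinearEquiv.apply_symm_apply]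
  mul a a' := by rw [LinearEquiv.symm_apply_eq, hφ.mul]; simp
  fixed r hr := by rw [LinearEquiv.symm_apply_eq, hφ.fixed r hr]
  comm t a := by rw [LinearEquiv.symm_apply_eq, hφ.comm]; simp

lemma IsSymmetry.comp_mem_cochains (hφ : IsSymmetry 𝒜 R ρ φ) {s : ℕ} {t : ℤ} {f : Multi A s}
    (hf : f ∈ cochains 𝒜 R ρ s t) :
    (φ : A →ₗ[ℂ] A).compMultilinearMap f ∈ cochains 𝒜 R ρ s t := by
  refine ⟨fun p a ha => (hφ.deg _ _).mpr (hf.1 p a ha), fun r hr a => ⟨fun i j hij => ?_,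
    fun i hi => ?_, fun i hi => ?_⟩, fun u a => ?_⟩
  · exact congrArg φ ((hf.2.1 r hr a).1 i j hij)
  · exact (congrArg φ ((hf.2.1 r hr a).2.1 i hi)).trans (by rw [hφ.mul, hφ.fixed r hr]; rfl)
  · exact (congrArg φ ((hf.2.1 r hr a).2.2 i hi)).trans (by rw [hφ.mul, hφ.fixed r hr]; rfl)
  · exact (congrArg φ (hf.2.2 u a)).trans (hφ.comm _ _)

lemma IsSymmetry.precomp_mem_cochains (hφ : IsSymmetry 𝒜 R ρ φ) {s : ℕ} {t : ℤ} {f : Multi A s}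
    (hf : f ∈ cochains 𝒜 R ρ s t) :
    f.compLinearMap (fun _ => (φ : A →ₗ[ℂ] A)) ∈ cochains 𝒜 R ρ s t := by
  have hu : ∀ (a : Fin s → A) (i : Fin s) (x : A),
      (fun k => φ (Function.update a i x k)) = Function.update (fun k => φ (a k)) i (φ x) :=
    fun a i x => by
      funext k
      by_cases hk : k = i
      · subst hk; simp
      · simp [hk]
  refine ⟨fun p a ha => hf.1 p _ fun i => (hφ.deg _ _).mpr (ha i), fun r hr a => ⟨fun i j hij => ?_,
    fun i hi => ?_, fun i hi => ?_⟩, fun u a => ?_⟩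
  · change f (fun k => φ _) = f (fun k => φ _)
    rw [hu, hu, hφ.mul, hφ.mul, hφ.fixed r hr]
    exact (hf.2.1 r hr _).1 i j hij
  · change f (fun k => φ _) = _
    rw [hu, hφ.mul, hφ.fixed r hr]
    exact (hf.2.1 r hr _).2.1 i hi
  · change f (fun k => φ _) = _
    rw [hu, hφ.mul, hφ.fixed r hr]
    exact (hf.2.1 r hr _).2.2 i hi
  · change f (fun k => φ (ρ u (a k))) = _
    simp only [hφ.comm]
    exact hf.2.2 u _

lemma insertionSum_comp (φ : A →ₗ[ℂ] A) (f g : ∀ d : ℕ, Multi A d) (d : ℕ) (p : ℕ → ℤ)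
    (a : ℕ → A) : insertionSum (fun d => φ.compMultilinearMap (f d)) g d p a =
      φ (insertionSum f g d p a) := by
  simp only [insertionSum, map_sum, map_zsmul]
  rfl

/-- The pullback of an `A_∞`-structure by a symmetry. -/
def AInfStructure.pullback (hφ : IsSymmetry 𝒜 R ρ φ) (N : AInfStructure 𝒜 R ρ) :
    AInfStructure 𝒜 R ρ where
  μ d := (N.μ d).conj φ
  μ_zero := by ext a; rw [Multi.conj_apply, N.μ_zero]; exact map_zero _
  μ_mem d hd := hφ.symm.comp_mem_cochains (hφ.precomp_mem_cochains (N.μ_mem d hd))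
  ainfty d hd p a ha := by
    have h := N.ainfty d hd p (fun n => φ (a n)) fun n => (hφ.deg _ _).mpr (ha n)
    have h2 : ∀ (i e : ℕ) (x : A), (fun n => φ (splice a i e x n)) =
        splice (fun n => φ (a n)) i e (φ x) := fun i e x => by
      funext n
      simp only [splice]
      split_ifs <;> rfl
    have h1 : insertionSum (fun d => (N.μ d).conj φ) (fun d => (N.μ d).conj φ) d p a =
        φ.symm (insertionSum N.μ N.μ d p fun n => φ (a n)) := by
      simp only [insertionSum, map_sum, map_zsmul]
      refine Finset.sum_congr rfl fun e _ => Finset.sum_congr rfl fun i _ => ?_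
      congr 1
      change φ.symm (app (N.μ (d + 1 - e)) fun n => φ (splice a i e _ n)) = _
      rw [h2]
      congr 3
      exact φ.apply_symm_apply _
    rw [h1, h, map_zero]
  μ_one := by ext a; rw [Multi.conj_apply, N.μ_one]; exact map_zero _
  μ_two p a₁ a₂ h := by
    have h1 : (fun i => φ ((![a₁, a₂] : Fin 2 → A) i)) = ![φ a₁, φ a₂] := by
      funext i; fin_cases i <;> rfl
    rw [Multi.conj_apply, h1, N.μ_two p _ _ ((hφ.deg _ _).mpr h), map_zsmul, hφ.symm.mul]
    simp

/-- A gauge transformation to a pullback defines an isomorphism. -/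
lemma AInfHom.exists_isIso (hφ : IsSymmetry 𝒜 R ρ φ) {M N : AInfStructure 𝒜 R ρ}
    (F : AInfHom M (N.pullback hφ)) (hF : F.IsGauge) : ∃ H : AInfHom M N, H.IsIso := by
  refine ⟨⟨fun d => (φ : A →ₗ[ℂ] A).compMultilinearMap (F.F d), ?_, fun d hd =>
    hφ.comp_mem_cochains (F.F_mem d hd), fun d hd p a ha => ?_⟩, ?_⟩
  · rw [F.F_zero]; ext a; exact map_zero φ
  · rw [insertionSum_comp, ← F.map_eq d hd p a ha]
    simp only [partitionSum, map_sum]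
    exact Finset.sum_congr rfl fun c _ => (φ.apply_symm_apply _).symm
  · have h : (fun a : A => φ (F.F 1 fun _ => a)) = φ := funext fun a => congrArg φ (hF a)
    change Function.Bijective fun a : A => φ (F.F 1 fun _ => a)
    rw [h]
    exact φ.bijective

lemma app_splice_zero {s : ℕ} (f : Multi A s) (a : ℕ → A) {i : ℕ} (hi : i < s) (e : ℕ) :
    app f (splice a i e 0) = 0 :=
  f.map_coord_zero ⟨i, hi⟩ (by simp [splice])

/-- The trivial `A_∞`-structure. -/
def AInfStructure.trivial (M : AInfStructure 𝒜 R ρ) : AInfStructure 𝒜 R ρ where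
  μ d := if d = 2 then M.μ d else 0
  μ_zero := rfl
  μ_mem d hd := by
    split_ifs
    · exact M.μ_mem d hd
    · exact zero_mem _
  ainfty d hd p a ha := by
    have hz : ∀ (f g : ∀ d, Multi A d) (e i : ℕ), i ∈ Finset.range (d + 1 - e) →
        f (d + 1 - e) = 0 ∨ g e = 0 →
        app (f (d + 1 - e)) (splice a i e (app (g e) fun n => a (i + n))) = 0 := by
      rintro f g e i hi (h | h)
      · rw [h]; rfl
      · rw [h]; exact app_splice_zero _ _ (Finset.mem_range.mp hi) e
    -- The relation for d = 3 is that of M: as μ^1 vanishes, the terms with μ^3 contribute nothing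
    -- there. For other d every term contains a component that is zero.
    by_cases hd3 : d = 3
    · subst hd3
      rw [← M.ainfty 3 hd p a ha]
      refine Finset.sum_congr rfl fun e he => Finset.sum_congr rfl fun i hi => ?_
      congr 1
      by_cases h2 : e = 2
      · subst h2; rfl
      · refine (hz (fun d => if d = 2 then M.μ d else 0) (fun d => if d = 2 then M.μ d else 0) e i hi
          (Or.inr (if_neg h2))).trans (hz M.μ M.μ e i hi ?_).symm
        have : e = 1 ∨ e = 3 := by rw [Finset.mem_Icc] at he; omega
        rcases this with rfl | rfl
        · exact Or.inr M.μ_one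
        · exact Or.inl M.μ_one
    · refine Finset.sum_eq_zero fun e he => Finset.sum_eq_zero fun i hi => ?_
      refine (congrArg (_ • ·) (hz (fun d => if d = 2 then M.μ d else 0)
        (fun d => if d = 2 then M.μ d else 0) e i hi ?_)).trans (smul_zero _)
      by_cases h2 : e = 2
      · exact Or.inl (if_neg (by rw [Finset.mem_Icc] at he; omega))
      · exact Or.inr (if_neg h2)
  μ_one := rfl
  μ_two p a₁ a₂ h := M.μ_two p a₁ a₂ h

lemma AInfStructure.trivial_μ (M : AInfStructure 𝒜 R ρ) {d : ℕ} (hd : 2 < d) :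
    M.trivial.μ d = 0 := if_neg (by omega)

end Transport

/-! ### Scalings of V as symmetries. -/

section Scaling

variable {V : Type*} [AddCommGroup V] [Module ℂ V] {b : Module.Basis (Fin 4) ℂ V}
  {lift : projTorus b → torus b}

/-- The action of a linear automorphism on `Q_4` as a linear equivalence. -/
def rhoEquiv (g : V ≃ₗ[ℂ] V) : Q4 V ≃ₗ[ℂ] Q4 V :=
  LinearEquiv.ofLinearMap (rhoG g) (rhoG g.symm)
    (LinearMap.ext fun a => by
      rw [LinearMap.comp_apply, ← rhoG_trans, LinearEquiv.symm_trans_self, rhoG_refl]; rfl)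
    (LinearMap.ext fun a => by
      rw [LinearMap.comp_apply, ← rhoG_trans, LinearEquiv.self_trans_symm, rhoG_refl]; rfl)

lemma rhoG_mem_degree (g : V ≃ₗ[ℂ] V) {n : ℤ} {a : Q4 V} (ha : a ∈ Q4.degree V n) :
    rhoG g a ∈ Q4.degree V n := by
  intro j k
  have key : homDegree V j k n ≤ (homDegree V j k n).comap
      (ExteriorAlgebra.map (g : V →ₗ[ℂ] V)).toLinearMap := by
    refine iSup₂_le fun p hp x hx => ?_
    exact Submodule.mem_iSup_of_mem p (Submodule.mem_iSup_of_mem hp (map_mem_exteriorPower _ hx))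
  exact key (ha j k)

lemma isSymmetry_scal (c : ℂˣ) :
    IsSymmetry (Q4.degree V) (R4 V) (rhoT b lift) (rhoEquiv (scal c)) where
  deg n a := ⟨fun h => by
    have h1 := rhoG_mem_degree (scal c).symm h
    change rhoG (scal c).symm (rhoG (scal c) a) ∈ _ at h1
    rwa [← rhoG_trans, LinearEquiv.self_trans_symm, rhoG_refl] at h1, rhoG_mem_degree _⟩
  mul := rhoG_mul _
  fixed r hr := rhoG_of_mem_R4 _ hr
  comm t a := rhoG_scal_comm c _ a

end Scaling

section General

variable {A T : Type*} [Ring A] [Algebra ℂ A] {𝒜 : ℤ → Submodule ℂ A} {R : Subalgebra ℂ A}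
  {ρ : T → A →ₗ[ℂ] A}

lemma cocycles_sub_mem {s : ℕ} {t : ℤ} {f g : Multi A s} (hf : f ∈ cocycles 𝒜 R ρ s t)
    (hg : g ∈ cocycles 𝒜 R ρ s t) : f - g ∈ cocycles 𝒜 R ρ s t := sub_mem hf hg

lemma equivariantHH_eq_bot_of_le {s : ℕ} {t : ℤ}
    (h : cocycles 𝒜 R ρ (s + 1) t ≤ coboundaries 𝒜 R ρ s t) : equivariantHH 𝒜 R ρ s t = ⊥ := by
  rw [equivariantHH, eq_bot_iff, Submodule.map_le_iff_le_comap]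
  exact h.trans (Submodule.ker_mkQ _).ge

end General

/-! ### Computation of the obstruction groups and uniqueness. -/

section Main

variable {V : Type*} [AddCommGroup V] [Module ℂ V] {b : Module.Basis (Fin 4) ℂ V}
  {lift : projTorus b → torus b}

lemma ML.map_replicate_smul {A Z : Type*} [Ring A] [Algebra ℂ A] [AddCommGroup Z] [Module ℂ Z]
    {f : List A → Z} (hf : ML f) (c : ℂ) (n : ℕ) (x : A) :
    f (List.replicate n (c • x)) = c ^ n • f (List.replicate n x) := by
  induction n generalizing f with
  | zero => simp
  | succ n ih =>
    rw [List.replicate_succ, List.replicate_succ, hf.head_smul, ih (hf.cons x), smul_smul, pow_succ']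

lemma rhoG_scal_emb_ι (c : ℂˣ) (v : V) :
    rhoG (scal c) (emb (ExteriorAlgebra.ι ℂ v)) = (c : ℂ) • emb (ExteriorAlgebra.ι ℂ v) := by
  rw [rhoG_emb, ← map_smul, ← map_smul, ExteriorAlgebra.map_apply_ι]
  rfl

/-- The twist changes the sign of exactly two of four odd inputs. -/
lemma apply_twQ_ofFn {f : List (Q4 V) → Q4 V} (hf : ML f) {a : Fin 4 → Q4 V}
    (ha : ∀ i, parity (a i) = -a i) : f (twQ (List.ofFn a)) = f (List.ofFn a) := by
  have h1 : List.ofFn a = [a 0, a 1, a 2, a 3] := by simp [List.ofFn_succ]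
  have h2 : twQ [a 0, a 1, a 2, a 3] = [-a 0, a 1, -a 2, a 3] := by
    simp [twQ, tw, pow_succ, ha]
  rw [h1, h2, hf.head_neg, ((hf.cons _).cons _).head_neg, neg_neg]

lemma twF_apply {s : ℕ} (f : Multi (Q4 V) s) {l : List (Q4 V)} (hl : l.length = s) :
    twF f l = f fun i => seq (twQ l) i := toL_single f (by simpa using hl)

lemma twF_sub_smul {s : ℕ} (f g : Multi (Q4 V) s) (c : ℂ) (l : List (Q4 V)) :
    twF (f - c • g) l = twF f l - c • twF g l := by
  by_cases hl : l.length = s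
  · rw [twF_apply _ hl, twF_apply _ hl, twF_apply _ hl]; rfl
  · rw [twF_of_length_ne _ hl, twF_of_length_ne _ hl, twF_of_length_ne _ hl, smul_zero, sub_zero]

section

variable (hlift : ∀ t : projTorus b, (QuotientGroup.mk (lift t) : projTorus b) = t)

include hlift

lemma twF_weight {s : ℕ} (hs : 1 ≤ s) {f : Multi (Q4 V) s}
    (hf : f ∈ cochains (Q4.degree V) (R4 V) (rhoT b lift) s (-2)) (r : ℂˣ) (n : ℕ) (v : V) :
    (r : ℂ) ^ n • twF f (List.replicate n (emb (ExteriorAlgebra.ι ℂ v))) =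
      (r : ℂ) ^ 4 • rhoG (scal r) (twF f (List.replicate n (emb (ExteriorAlgebra.ι ℂ v)))) := by
  have h := twF_map_diag hf hs hlift (m := 1) (by norm_num) (fun _ => r)
    (List.replicate n (emb (ExteriorAlgebra.ι ℂ v)))
  rw [diagEquiv_const, List.map_replicate, rhoG_scal_emb_ι, (ML.twF f).map_replicate_smul] at h
  rw [h]
  simp

/-- The value of a cocycle on the powers of a vector is a scalar. -/
lemma exists_scalar {f : Multi (Q4 V) 4}
    (hf : f ∈ cocycles (Q4.degree V) (R4 V) (rhoT b lift) 4 (-2)) {v : V} (hv : v ≠ 0) :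
    ∃ c : ℂ, twF f (List.replicate 4 (emb (ExteriorAlgebra.ι ℂ v))) = c • 1 := by
  refine exists_eq_smul_one b ?_ hv ?_
  · have h := twF_weight hlift (by norm_num) hf.1 (Units.mk0 2 two_ne_zero) 4 v
    exact (smul_right_injective (Q4 V) (pow_ne_zero 4 (Units.ne_zero _)) h).symm
  -- In the cocycle equation on five copies of v all inner faces vanish; the two outer ones say that
  -- the value commutes with v.
  · have h := dQ_twF_of_mem_cocycles hf.1 (by norm_num) (by decide) hf
      ((List.replicate 5 (ExteriorAlgebra.ι ℂ v)).map emb) (by simp)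
    have hML : ML fun w : List (ExteriorAlgebra ℂ V) => twF f (w.map emb) := fun u w x y c => by
      simpa using ML.twF f (u.map emb) (w.map emb) (emb x) (emb y) c
    rw [dQ_map_emb, List.replicate_succ, cobd, ← List.replicate_succ,
      bd_const _ hML (ExteriorAlgebra.ι_sq_zero v), sub_eq_zero] at h
    simp only [List.map_replicate, actL_apply, actR_apply] at h
    rw [h]
    norm_num

/-- The value of a primitive on three copies of v would need exterior degree p with 3 = 4 + p, so it
is zero. The inner faces of its differential vanish since v * v = 0. -/
lemma twF_eq_zero_of_mem_coboundaries {f : Multi (Q4 V) 4}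
    (hf : f ∈ coboundaries (Q4.degree V) (R4 V) (rhoT b lift) 3 (-2)) (v : V) :
    twF f (List.replicate 4 (emb (ExteriorAlgebra.ι ℂ v))) = 0 := by
  obtain ⟨hfc, g, hg, h⟩ := hf
  have h1 := twF_eq_dQ_twF (by norm_num) (by decide) hfc hg h
    (List.replicate 4 (emb (ExteriorAlgebra.ι ℂ v))) (by simp)
  have h2 : twF g (List.replicate 3 (emb (ExteriorAlgebra.ι ℂ v))) = 0 := by
    refine ext_qProj b fun p _ => ?_
    have h3 := congrArg (qProj p) (twF_weight hlift (by norm_num) hg (Units.mk0 2 two_ne_zero) 3 v)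
    rw [map_smul, map_smul, qProj_rhoG, rhoG_scal_qProj, smul_smul, ← pow_add] at h3
    by_contra h4
    have h5 : (2 : ℂ) ^ 3 = 2 ^ (4 + p) := smul_left_injective ℂ h4 h3
    have h6 : ((2 ^ 3 : ℕ) : ℂ) = ((2 ^ (4 + p) : ℕ) : ℂ) := by exact_mod_cast h5
    have h7 := Nat.pow_right_injective le_rfl (Nat.cast_injective h6)
    omega
  have hML : ML fun w : List (ExteriorAlgebra ℂ V) => twF g (w.map emb) := fun u w x y c => by
    simpa using ML.twF g (u.map emb) (w.map emb) (emb x) (emb y) c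
  rw [h1, ← List.map_replicate, dQ_map_emb, List.replicate_succ, cobd, ← List.replicate_succ,
    bd_const _ hML (ExteriorAlgebra.ι_sq_zero v)]
  simp only [List.map_replicate, h2, map_zero, smul_zero, sub_zero]

lemma mem_coboundaries_of_twF_eq_zero {f : Multi (Q4 V) 4}
    (hf : f ∈ cocycles (Q4.degree V) (R4 V) (rhoT b lift) 4 (-2))
    (h : twF f (List.replicate 4 (emb (ExteriorAlgebra.ι ℂ (∑ i, b i)))) = 0) :
    f ∈ coboundaries (Q4.degree V) (R4 V) (rhoT b lift) 3 (-2) :=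
  mem_coboundaries (m := 1) hlift le_rfl (by norm_num) hf fun _ => by rw [h, map_zero]

/-- For even n the degree is odd and there are no nonzero cochains. For n = 2m + 1 the scalar
obstruction appears only when m = 1, the excluded case. -/
lemma cocycles_le_coboundaries {n : ℕ} (hn : 2 ≤ n) (hn3 : n ≠ 3) {t : ℤ} (ht : t = 1 - n) :
    cocycles (Q4.degree V) (R4 V) (rhoT b lift) (n + 1) t ≤
      coboundaries (Q4.degree V) (R4 V) (rhoT b lift) n t := by
  intro f hf
  rcases Nat.even_or_odd n with h | ⟨m, rfl⟩
  · have h1 : Odd t := by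
      rw [ht, sub_eq_add_neg]
      exact (odd_one).add_even (Even.neg (by exact_mod_cast h))
    rw [cochain_eq_zero_of_odd hf.1 (by omega) h1]
    exact zero_mem _
  · exact mem_coboundaries hlift (by omega) (by rw [ht]; push_cast; ring) hf fun h => by omega

end

/-- A cocycle corresponding to the product of the coordinates. -/
lemma exists_cocycle (b : Module.Basis (Fin 4) ℂ V) (lift : projTorus b → torus b) :
    ∃ τ ∈ cocycles (Q4.degree V) (R4 V) (rhoT b lift) 4 (-2),
      (∀ v : V, twF τ (List.replicate 4 (emb (ExteriorAlgebra.ι ℂ v))) = (∏ i, b.coord i v) • 1) ∧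
      ∀ (j : Fin 4) (v : V), τ (fun i => arrow v (j + i)) = (∏ i, b.coord i v) • idem j := by
  obtain ⟨hemb, τ, hτ, hE⟩ := exists_cochain (lift := lift) (s := 4) (m := 1) (by norm_num)
    (t := -2) (by norm_num) (G := cup4 b) (ML.cup _) (fun l hl => cup_of_length_ne (by simpa using hl))
    (cup4_extDiag b)
  have hval : ∀ w : List (ExteriorAlgebra ℂ V), twF τ (w.map emb) = cup4 b w := fun w => by
    rw [hE, hemb]
  have hs : 1 ≤ 4 := by norm_num
  refine ⟨τ, mem_cocycles_of_dQ_twF hτ hs (by decide) fun l hl => ?_, fun v => ?_, fun j v => ?_⟩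
  · refine eq_of_comp_emb (g := fun _ => 0) (ML.twF τ).dQ
      ((twF_bal hτ hs).cobd (twF_lastLin hτ hs) (twF_headLin hτ hs))
      ((twF_lastLin hτ hs).cobd (twF_nil hτ hs)) (fun u v x y c => by simp) (fun r hr u v x y => rfl)
      (fun r hr u x => by simp) ((twF_headLin hτ hs).cobd (twF_nil hτ hs))
      (fun r hr x l => by simp) l (by rintro rfl; simp at hl) fun w _ => ?_
    rw [dQ_map_emb]
    simp only [hval]
    cases w with
    | nil => rfl
    | cons x w =>
      rw [cobd, cup4, bd_cup, actR_apply, sub_self]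
      intro d hd x y
      obtain ⟨i, rfl⟩ := List.mem_ofFn.mp hd
      exact deriv_mul b i x y
  · rw [← List.map_replicate, hval, cup4_ι]
  · have h1 := toL_ofFn (Pi.single 4 τ) 4 fun i : Fin 4 => arrow v (j + i)
    rw [Pi.single_eq_same] at h1
    have h2 : twF τ (twQ (List.ofFn fun i : Fin 4 => arrow v (j + i))) =
        τ fun i : Fin 4 => arrow v (j + i) := by
      rw [← h1, twF, twQ_twQ]
    have h3 : ∀ j, parity (arrow v j) = -arrow v j := fun j => by
      refine Q4.ext_entry fun k j' => ?_
      rw [parity, entry_rhoG, _root_.map_neg, entry_arrow]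
      split_ifs
      · rw [ExteriorAlgebra.map_apply_ι, ← _root_.map_neg]
        congr 1
        exact neg_one_smul ℂ v
      · simp
    have hcM : ML (cup4 b) := ML.cup _
    rw [← h2, hE, apply_twQ_ofFn hcM.ext4 fun i => h3 _, ext4_arrow hcM, cup4_ι,
      mul_smul_comm, mul_one, smul_mul_assoc]
    congr 1
    refine Q4.ext_entry fun k k' => ?_
    rw [entry_idem_mul, entry_idem]
    split_ifs <;> simp_all

lemma prod_coord_sum : ∏ i, b.coord i (∑ k, b k) = 1 := by
  refine Finset.prod_eq_one fun i _ => ?_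
  rw [map_sum, Finset.sum_eq_single i (fun k _ hk => by simp [hk]) (by simp)]
  simp

lemma sum_basis_ne_zero : ∑ k, b k ≠ 0 := fun h => by
  have := prod_coord_sum (b := b)
  rw [h] at this
  simp at this

lemma AInfStructure.μ_three (M : AInfStructure (Q4.degree V) (R4 V) (rhoT b lift)) : M.μ 3 = 0 :=
  cochain_eq_zero_of_odd (M.μ_mem 3 (by norm_num)) (by norm_num) (by decide)

/-- This is the comparison of M with its trivial counterpart, which agrees with it up to order three
because μ^3 vanishes by parity. -/
lemma AInfStructure.μ_four_mem (M : AInfStructure (Q4.degree V) (R4 V) (rhoT b lift)) :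
    M.μ 4 ∈ cocycles (Q4.degree V) (R4 V) (rhoT b lift) 4 (-2) := by
  have h := (AInfStructure.sub_mem_cocycles (isSign_parity b lift) iSup_degree M.trivial M
    ((M.trivial_μ (by norm_num)).trans M.μ_three.symm)).2.2
  have e : M.μ 4 - M.trivial.μ 4 = M.μ 4 := by
    rw [M.trivial_μ (by norm_num)]
    ext a
    exact sub_zero _
  exact e ▸ h

lemma twF_zero (s : ℕ) (l : List (Q4 V)) : twF (0 : Multi (Q4 V) s) l = 0 := by
  by_cases hl : l.length = s
  · rw [twF_apply _ hl]; rfl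
  · exact twF_of_length_ne _ hl

lemma twF_conj {s : ℕ} (f : Multi (Q4 V) s) (g : V ≃ₗ[ℂ] V) (l : List (Q4 V)) :
    twF (f.conj (rhoEquiv g)) l = (rhoEquiv g).symm (twF f (l.map (rhoG g))) := by
  by_cases hl : l.length = s
  · rw [twF_apply _ hl, twF_apply _ (by simpa using hl), Multi.conj_apply, twQ_map]
    refine congrArg (fun a => (rhoEquiv g).symm (f a)) (funext fun i => ?_)
    have hi : (i : ℕ) < (twQ l).length := by rw [length_twQ, hl]; exact i.2
    change rhoG g (seq (twQ l) i) = _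
    simp [seq, List.getElem?_eq_getElem hi]
  · rw [twF_of_length_ne _ hl, twF_of_length_ne _ (by simpa using hl), map_zero]

section

variable (hlift : ∀ t : projTorus b, (QuotientGroup.mk (lift t) : projTorus b) = t)

include hlift

lemma equivariantHH_eq_bot {d : ℕ} (hd : 2 < d) (hd4 : d ≠ 4) :
    equivariantHH (Q4.degree V) (R4 V) (rhoT b lift) (d - 1) (2 - d) = ⊥ := by
  obtain ⟨n, rfl⟩ := Nat.exists_eq_add_of_le' (show 1 ≤ d by omega)
  rw [Nat.add_sub_cancel]
  refine equivariantHH_eq_bot_of_le ?_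
  exact cocycles_le_coboundaries hlift (by omega) (by omega) (by push_cast; ring)

/-- Coboundaries vanish on powers of a vector, whereas τ has value 1 at the sum of the basis
vectors. -/
lemma mk_ne_zero {τ : Multi (Q4 V) 4}
    (h : ∀ v : V, twF τ (List.replicate 4 (emb (ExteriorAlgebra.ι ℂ v))) = (∏ i, b.coord i v) • 1) :
    Submodule.Quotient.mk (p := coboundaries (Q4.degree V) (R4 V) (rhoT b lift) 3 (-2)) τ ≠ 0 := by
  rw [Ne, Submodule.Quotient.mk_eq_zero]
  intro h1
  have h2 := twF_eq_zero_of_mem_coboundaries hlift h1 (∑ k, b k)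
  rw [h, prod_coord_sum, one_smul] at h2
  have h3 := congrArg (entry 0 0) h2
  rw [entry_one, if_pos rfl, map_zero] at h3
  exact one_ne_zero h3

/-- Subtracting from a cocycle the multiple of τ with the same scalar leaves a cocycle with scalar
zero, which is a coboundary. -/
lemma equivariantHH_eq_span {τ : Multi (Q4 V) 4}
    (hτ : τ ∈ cocycles (Q4.degree V) (R4 V) (rhoT b lift) 4 (-2))
    (h : ∀ v : V, twF τ (List.replicate 4 (emb (ExteriorAlgebra.ι ℂ v))) = (∏ i, b.coord i v) • 1) :
    equivariantHH (Q4.degree V) (R4 V) (rhoT b lift) 3 (-2) =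
      Submodule.span ℂ {Submodule.Quotient.mk τ} := by
  refine le_antisymm ?_ ?_
  · rintro _ ⟨f, hf, rfl⟩
    obtain ⟨c, hc⟩ := exists_scalar hlift hf (sum_basis_ne_zero (b := b))
    rw [Submodule.mem_span_singleton]
    refine ⟨c, ?_⟩
    rw [← Submodule.Quotient.mk_smul, Submodule.mkQ_apply, eq_comm, Submodule.Quotient.eq]
    refine mem_coboundaries_of_twF_eq_zero hlift
      (cocycles_sub_mem hf (Submodule.smul_mem _ c hτ)) ?_
    rw [twF_sub_smul, hc, h, prod_coord_sum, one_smul, sub_self]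
  · rw [Submodule.span_singleton_le_iff_mem]
    exact ⟨τ, hτ, rfl⟩

/-- Both cubic terms vanish, equality of the scalars makes the quartic difference a coboundary, and
all higher obstruction groups are zero. -/
lemma AInfStructure.exists_gauge_of_scalar
    (M N : AInfStructure (Q4.degree V) (R4 V) (rhoT b lift))
    (h : twF (N.μ 4) (List.replicate 4 (emb (ExteriorAlgebra.ι ℂ (∑ i, b i)))) =
      twF (M.μ 4) (List.replicate 4 (emb (ExteriorAlgebra.ι ℂ (∑ i, b i))))) :
    ∃ F : AInfHom M N, F.IsGauge := by
  refine AInfStructure.exists_gauge (isSign_parity b lift) iSup_degree M N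
    (M.μ_three.trans N.μ_three.symm) ?_ fun n hn =>
      cocycles_le_coboundaries hlift (by omega) (by omega) (by push_cast; ring)
  have h1 := twF_sub_smul (N.μ 4) (M.μ 4) 1 (List.replicate 4 (emb (ExteriorAlgebra.ι ℂ (∑ i, b i))))
  rw [one_smul, one_smul, h, sub_self] at h1
  exact mem_coboundaries_of_twF_eq_zero hlift (cocycles_sub_mem N.μ_four_mem M.μ_four_mem) h1

lemma AInfStructure.scalar_ne_zero (M : AInfStructure (Q4.degree V) (R4 V) (rhoT b lift))
    (hM : ¬ M.IsGaugeTrivial) {c : ℂ}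
    (hc : twF (M.μ 4) (List.replicate 4 (emb (ExteriorAlgebra.ι ℂ (∑ i, b i)))) = c • 1) : c ≠ 0 := by
  rintro rfl
  refine hM ⟨M.trivial, fun d hd => M.trivial_μ hd, AInfStructure.exists_gauge_of_scalar hlift _ _ ?_⟩
  rw [hc, zero_smul, M.trivial_μ (by norm_num)]
  exact twF_zero 4 _

lemma AInfStructure.exists_iso (M N : AInfStructure (Q4.degree V) (R4 V) (rhoT b lift))
    (hM : ¬ M.IsGaugeTrivial) (hN : ¬ N.IsGaugeTrivial) : ∃ F : AInfHom M N, F.IsIso := by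
  obtain ⟨c, hc⟩ := exists_scalar hlift M.μ_four_mem (sum_basis_ne_zero (b := b))
  obtain ⟨c', hc'⟩ := exists_scalar hlift N.μ_four_mem (sum_basis_ne_zero (b := b))
  have hc0 := M.scalar_ne_zero hlift hM hc
  have hc0' := N.scalar_ne_zero hlift hN hc'
  -- Pulling N back along the scaling by r multiplies its scalar by r^4, one factor for each input.
  -- With this r the scalar becomes that of M.
  obtain ⟨r, hr⟩ := IsAlgClosed.exists_pow_nat_eq (c / c') (n := 4) (by norm_num)
  have hr0 : r ≠ 0 := by
    rintro rfl
    rw [zero_pow (by norm_num)] at hr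
    exact div_ne_zero hc0 hc0' hr.symm
  have hφ := isSymmetry_scal (b := b) (lift := lift) (Units.mk0 r hr0)
  obtain ⟨F, hF⟩ := AInfStructure.exists_gauge_of_scalar hlift M (N.pullback hφ) (by
    change twF ((N.μ 4).conj (rhoEquiv _)) _ = _
    rw [twF_conj, List.map_replicate, rhoG_scal_emb_ι, (ML.twF _).map_replicate_smul, hc', hc,
      LinearEquiv.symm_apply_eq, map_smul, hφ.fixed 1 (one_mem _), smul_smul, Units.val_mk0, hr,
      div_mul_cancel₀ _ hc0'])
  exact F.exists_isIso hφ hF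

end

end Main

end SeidelQ

end

theorem mainTheorem9 {V : Type*} [AddCommGroup V] [Module ℂ V]
    (b : Module.Basis (Fin 4) ℂ V)
    (lift : SeidelQ.projTorus b → SeidelQ.torus b)
    (hlift : ∀ t : SeidelQ.projTorus b, (QuotientGroup.mk (lift t) : SeidelQ.projTorus b) = t) :
    -- the equivariant obstruction groups `HH^2(Q_4, Q_4)^{2-d}`, `d > 2`, vanish for `d ≠ 4`
    (∀ d : ℕ, 2 < d → d ≠ 4 →
      SeidelQ.equivariantHH (SeidelQ.Q4.degree V) (SeidelQ.R4 V)
        (SeidelQ.rhoT b lift) (d - 1) (2 - d) = ⊥) ∧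
    -- for `d = 4` the group is one-dimensional, spanned by the class of `y_0 y_1 y_2 y_3`
    Module.finrank ℂ (SeidelQ.equivariantHH (SeidelQ.Q4.degree V) (SeidelQ.R4 V)
        (SeidelQ.rhoT b lift) 3 (-2)) = 1 ∧
    (∃ τ ∈ SeidelQ.cocycles (SeidelQ.Q4.degree V) (SeidelQ.R4 V) (SeidelQ.rhoT b lift) 4 (-2),
      (∀ (j : Fin 4) (v : V), τ (fun i => SeidelQ.arrow v (j + i)) =
        (∏ i, b.coord i v) • SeidelQ.idem j) ∧
      SeidelQ.equivariantHH (SeidelQ.Q4.degree V) (SeidelQ.R4 V) (SeidelQ.rhoT b lift) 3 (-2) =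
        Submodule.span ℂ {Submodule.Quotient.mk τ}) ∧
    -- nontrivial equivariant structures are unique up to equivariant isomorphism
    (∀ M N : SeidelQ.AInfStructure (SeidelQ.Q4.degree V) (SeidelQ.R4 V) (SeidelQ.rhoT b lift),
      ¬ M.IsGaugeTrivial → ¬ N.IsGaugeTrivial →
        ∃ F : SeidelQ.AInfHom M N, F.IsIso) := by
  obtain ⟨τ, hτ, hχ, harrow⟩ := SeidelQ.exists_cocycle b lift
  have hspan := SeidelQ.equivariantHH_eq_span hlift hτ hχ
  refine ⟨fun d hd hd4 => SeidelQ.equivariantHH_eq_bot hlift hd hd4, ?_, ⟨τ, hτ, harrow, hspan⟩,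
    fun M N hM hN => M.exists_iso hlift N hM hN⟩
  rw [hspan]
  exact finrank_span_singleton (SeidelQ.mk_ne_zero hlift hχ)
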